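/- **Definitions.** A *trisymplectic structure* on a finite-dimensional complex vector space $V$ is a 3-dimensional space $\mathbf\Omega$ of complex-bilinear alternating forms on $V$ which contains a non-degenerate form and in which every non-zero degenerate form has rank $\frac12\dim V$. Let $H\subset \mathrm{End}(V)$ be the linear span of the projections of $V$ onto $\mathrm{Ann}(\Omega_1)$ along $\mathrm{Ann}(\Omega_2)$, over all pairs of non-proportional degenerate forms $\Omega_1,\Omega_2\in\mathbf\Omega$ with $V=\mathrm{Ann}(\Omega_1)\oplus\mathrm{Ann}(\Omega_2)$. A subspace $W\subset V$ is *non-degenerate* if $W=0$ or the restriction of $\mathbf\Omega$ to $H\cdot W$ is a trisymplectic structure on $H\cdot W$. A *trisymplectic structure* on a complex manifold $M$ is a 3-dimensional space $\mathbf\Omega$ of closed holomorphic 2-forms on $M$ such that for every $x\in M$ the evaluation $\mathbf\Omega(x)$ is a trisymplectic structure on $T_xM$. Let a compact Lie group $G$ with Lie algebra $\mathfrak g$ act smoothly on $M$ by biholomorphisms preserving every form in $\mathbf\Omega$. An (equivariant) *trisymplectic moment map* is a map $\mu_{\mathbb C}:M\to\mathfrak g^*\otimes_{\mathbb R}\mathbf\Omega^*$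 such that for all $X\in\mathfrak g$, $\Omega\in\mathbf\Omega$ the function $f=\langle\mu_{\mathbb C},X\otimes\Omega\rangle$ is holomorphic and $df=\Omega(X_M,\cdot)$, where $X_M$ is the vector field on $M$ generated by $X$, and such that $\mu_{\mathbb C}$ is equivariant for the coadjoint action of $G$ on $\mathfrak g^*$ (and the trivial action on $\mathbf\Omega^*$). Let $G_{\mathbb C}$ be the complexification of $G$: a complex Lie group with a smooth homomorphism $\iota:G\to G_{\mathbb C}$ such that $\mathrm{Lie}(G_{\mathbb C})=\mathfrak g\oplus\sqrt{-1}\,\mathfrak g$ and $(k,X)\mapsto \iota(k)\exp(\sqrt{-1}X)$ is a bijection $G\times\mathfrak g\to G_{\mathbb C}$. **Theorem.** Let $(M,\mathbf\Omega)$ be a trisymplectic manifold, with an action of a compact Lie group $G$ preserving $\mathbf\Omega$ and an equivariant trisymplectic moment map $\mu_{\mathbb C}$. Assume that for every $x\in M$ the (complex span of the) image of $\mathfrak g$ in $T_xM$ is non-degenerate. Let $N:=\mu_{\mathbb C}^{-1}(0)$, and assume that the action of $G$ on $N$ extends to a holomorphic action of $G_{\mathbb C}$ on $N$ which is proper and free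 (holomorphic: the map $G_{\mathbb C}\times N\to M$ is locally the restriction of a holomorphic map $G_{\mathbb C}\times M\to M$). Assume also that $N\neq\emptyset$ and $\dim_{\mathbb C}M>4\dim_{\mathbb R}G$ (that is, the quotient is non-empty and of positive dimension). Then $N$ is an embedded complex submanifold of $M$ of dimension $\dim_{\mathbb C} M-3\dim_{\mathbb R} G$, the quotient $N/G_{\mathbb C}$ with the quotient topology carries the structure of a (Hausdorff, second countable) complex manifold of dimension $\dim_{\mathbb C}M-4\dim_{\mathbb R}G$ for which the projection $\pi:N\to N/G_{\mathbb C}$ is a holomorphic submersion, and there is a unique trisymplectic structure $\mathbf\Omega'$ on $N/G_{\mathbb C}$ such that $\pi^*\mathbf\Omega'=\mathbf\Omega|_N$. -/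

import Mathlib

open scoped Manifold ContDiff Topology

noncomputable section

namespace Trisymplectic

/-! ### Linear algebra: trisymplectic vector spaces -/

section Linear

variable {V : Type*} [AddCommGroup V] [Module ℂ V] [TopologicalSpace V]

/-- The annihilator of a 2-form: all `v` with `η(v, ·) = 0`. -/
def ann (η : V [⋀^Fin 2]→L[ℂ] ℂ) : Submodule ℂ V where
  carrier := {v | ∀ w, η ![v, w] = 0}
  add_mem' := by
    intro a b ha hb w
    have h := η.map_update_add ![0, w] 0 a b
    simp only [Matrix.vecCons, Fin.update_cons_zero] at h
    have h' : η ![a + b, w] = η ![a, w] + η ![b, w] := h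
    rw [h', ha w, hb w, add_zero]
  zero_mem' := fun w => η.map_coord_zero 0 rfl
  smul_mem' := by
    intro c a ha w
    have h := η.map_update_smul ![0, w] 0 c a
    simp only [Matrix.vecCons, Fin.update_cons_zero] at h
    have h' : η ![c • a, w] = c • η ![a, w] := h
    rw [h', ha w, smul_zero]

/-- The rank of a 2-form: the codimension of its annihilator. -/
def rank (η : V [⋀^Fin 2]→L[ℂ] ℂ) : ℕ := Module.finrank ℂ (V ⧸ ann η)

/-- A form is degenerate if its annihilator is non-zero. -/
def IsDegenerate (η : V [⋀^Fin 2]→L[ℂ] ℂ) : Prop := ann η ≠ ⊥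

/-- A trisymplectic structure on a complex vector space: a 3-dimensional space of 2-forms
containing a non-degenerate form, in which every non-zero degenerate form has rank
`(dim V) / 2`. -/
structure IsTrisymplecticSpace (S : Submodule ℂ (V [⋀^Fin 2]→L[ℂ] ℂ)) : Prop where
  finrank_eq : Module.finrank ℂ S = 3
  exists_nondegenerate : ∃ η ∈ S, ¬ IsDegenerate η
  rank_eq : ∀ η ∈ S, η ≠ 0 → IsDegenerate η → 2 * rank η = Module.finrank ℂ V

/-- The space `H ⊆ End V` spanned by the projections of `V` onto `Ann η₁` along `Ann η₂`, for
non-proportional degenerate forms `η₁, η₂` in `S`. -/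
def matAlgebra (S : Submodule ℂ (V [⋀^Fin 2]→L[ℂ] ℂ)) : Submodule ℂ (V →ₗ[ℂ] V) :=
  Submodule.span ℂ {P | ∃ η₁ ∈ S, ∃ η₂ ∈ S, IsDegenerate η₁ ∧ IsDegenerate η₂ ∧
    LinearIndependent ℂ ![η₁, η₂] ∧
    IsIdempotentElem P ∧ LinearMap.range P = ann η₁ ∧ LinearMap.ker P = ann η₂}

/-- The subspace `H · W`. -/
def matSpan (S : Submodule ℂ (V [⋀^Fin 2]→L[ℂ] ℂ)) (W : Submodule ℂ V) : Submodule ℂ V :=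
  Submodule.span ℂ {v | ∃ h ∈ matAlgebra S, ∃ w ∈ W, v = h w}

/-- The restriction of 2-forms to a subspace. -/
def restrictForm (W : Submodule ℂ V) :
    (V [⋀^Fin 2]→L[ℂ] ℂ) →ₗ[ℂ] (W [⋀^Fin 2]→L[ℂ] ℂ) where
  toFun η := η.compContinuousLinearMap W.subtypeL
  map_add' _ _ := rfl
  map_smul' _ _ := rfl

/-- The restriction of a space of 2-forms to a subspace. -/
def restrictForms (S : Submodule ℂ (V [⋀^Fin 2]→L[ℂ] ℂ)) (W : Submodule ℂ V) :
    Submodule ℂ (W [⋀^Fin 2]→L[ℂ] ℂ) :=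
  S.map (restrictForm W)

/-- A subspace `W` is non-degenerate if `H · W` is a trisymplectic space for the restricted forms.
The zero subspace counts as non-degenerate. -/
def IsNondegenerateSubspace (S : Submodule ℂ (V [⋀^Fin 2]→L[ℂ] ℂ)) (W : Submodule ℂ V) : Prop :=
  W = ⊥ ∨ IsTrisymplecticSpace (restrictForms S (matSpan S W))

end Linear

/-! ### Trisymplectic manifolds -/

section Manifolds

variable (E : Type*) [NormedAddCommGroup E] [NormedSpace ℂ E]
  (M : Type*) [TopologicalSpace M] [ChartedSpace E M]

/-- (Not necessarily continuous) fields of complex bilinear alternating forms on the holomorphic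
tangent spaces of a complex manifold. -/
abbrev TwoForm : Type _ := (x : M) → TangentSpace 𝓘(ℂ, E) x [⋀^Fin 2]→L[ℂ] ℂ

variable {E M}
variable {E' : Type*} [NormedAddCommGroup E'] [NormedSpace ℂ E']
  {M' : Type*} [TopologicalSpace M'] [ChartedSpace E' M']

/-- Pullback of 2-forms along a map, `(f^* η)_x(v, w) = η_{f x}(df v, df w)`. -/
def pullback (f : M → M') : TwoForm E' M' →ₗ[ℂ] TwoForm E M where
  toFun η x := (η (f x)).compContinuousLinearMap (mfderiv 𝓘(ℂ, E) 𝓘(ℂ, E') f x)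
  map_add' _ _ := rfl
  map_smul' _ _ := rfl

/-- The expression of a 2-form in a chart `e`, as a form on the model vector space: the pullback
by the inverse of `e` (meaningful on the target of `e`). -/
def inChart (e : OpenPartialHomeomorph M E) (η : TwoForm E M) : E → E [⋀^Fin 2]→L[ℂ] ℂ :=
  fun y => pullback (E := E) (M := E) e.symm η y

/-- Holomorphic 2-forms. -/
def IsHolomorphic (η : TwoForm E M) : Prop :=
  ∀ e ∈ atlas E M, AnalyticOnNhd ℂ (inChart e η) e.target

/-- Closed 2-forms. -/
def IsClosedForm (η : TwoForm E M) : Prop :=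
  ∀ e ∈ atlas E M, ∀ y ∈ e.target, extDeriv (inChart e η) y = 0

/-- The evaluation `Ω(x)` of a space of 2-forms at a point. -/
def evalAt (Ω : Submodule ℂ (TwoForm E M)) (x : M) :
    Submodule ℂ (TangentSpace 𝓘(ℂ, E) x [⋀^Fin 2]→L[ℂ] ℂ) :=
  Ω.map (LinearMap.proj x)

/-- A trisymplectic structure on a complex manifold: a 3-dimensional space of closed holomorphic
2-forms whose evaluation at each point is a trisymplectic structure on the tangent space. -/
structure IsTrisymplecticStructure (Ω : Submodule ℂ (TwoForm E M)) : Prop where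
  finrank_eq : Module.finrank ℂ Ω = 3
  holomorphic : ∀ η ∈ Ω, IsHolomorphic η
  closed : ∀ η ∈ Ω, IsClosedForm η
  trisymplectic_at : ∀ x, IsTrisymplecticSpace (evalAt Ω x)

end Manifolds

/-! ### Group actions and moment maps -/

section Actions

variable {E : Type*} [NormedAddCommGroup E] [NormedSpace ℂ E]
  {M : Type*} [TopologicalSpace M] [ChartedSpace E M]
  {EG : Type*} [NormedAddCommGroup EG] [NormedSpace ℝ EG]
  {G : Type*} [TopologicalSpace G] [ChartedSpace EG G] [Group G]

/-- A smooth action of a real Lie group on a complex manifold by biholomorphisms which preserve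
each form in `Ω`. -/
structure IsTrisymplecticAction (EG G : Type*) [NormedAddCommGroup EG] [NormedSpace ℝ EG]
    [TopologicalSpace G] [ChartedSpace EG G] [Group G] [MulAction G M]
    (Ω : Submodule ℂ (TwoForm E M)) : Prop where
  smooth : ContMDiff ((𝓘(ℝ, EG)).prod 𝓘(ℝ, E)) 𝓘(ℝ, E) ∞ (fun p : G × M => p.1 • p.2)
  holomorphic : ∀ g : G, ContMDiff 𝓘(ℂ, E) 𝓘(ℂ, E) ω (fun x : M => g • x)
  preserves : ∀ g : G, ∀ η ∈ Ω, pullback (fun x : M => g • x) η = η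

/-- The value at `x` of the vector field on `M` generated by `X ∈ Lie G`. -/
def fundamentalField [MulAction G M] (X : GroupLieAlgebra 𝓘(ℝ, EG) G) (x : M) :
    TangentSpace 𝓘(ℂ, E) x :=
  (mfderiv 𝓘(ℝ, EG) 𝓘(ℝ, E) (fun g : G => g • x) 1 X : E)

/-- The (complex span of the) image of `Lie G` in the tangent space at `x`. -/
def orbitDirections (EG G : Type*) [NormedAddCommGroup EG] [NormedSpace ℝ EG]
    [TopologicalSpace G] [ChartedSpace EG G] [Group G] [MulAction G M] (x : M) :
    Submodule ℂ (TangentSpace 𝓘(ℂ, E) x) :=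
  Submodule.span ℂ (Set.range fun X : GroupLieAlgebra 𝓘(ℝ, EG) G => fundamentalField X x)

/-- The adjoint action of `g` on `Lie G`. -/
def adjoint (g : G) (X : GroupLieAlgebra 𝓘(ℝ, EG) G) : GroupLieAlgebra 𝓘(ℝ, EG) G :=
  (mfderiv 𝓘(ℝ, EG) 𝓘(ℝ, EG) (fun h : G => g * h * g⁻¹) 1 X : EG)

/-- The space `(Lie G)^* ⊗_ℝ Ω^*`, as the space of real linear maps from `Lie G` to `Ω^*`. -/
abbrev MomentTarget (EG G : Type*) [NormedAddCommGroup EG] [NormedSpace ℝ EG]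
    [TopologicalSpace G] [ChartedSpace EG G] [Group G] (Ω : Submodule ℂ (TwoForm E M)) : Type _ :=
  GroupLieAlgebra 𝓘(ℝ, EG) G →ₗ[ℝ] Module.Dual ℂ Ω

/-- An equivariant trisymplectic moment map. -/
structure IsMomentMap [MulAction G M] (Ω : Submodule ℂ (TwoForm E M))
    (μ : M → MomentTarget EG G Ω) : Prop where
  holomorphic : ∀ X (η : Ω), ContMDiff 𝓘(ℂ, E) 𝓘(ℂ, ℂ) ω (fun x => μ x X η)
  differential : ∀ X (η : Ω) (x : M) (v : TangentSpace 𝓘(ℂ, E) x),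
    (mfderiv 𝓘(ℂ, E) 𝓘(ℂ, ℂ) (fun x => μ x X η) x v : ℂ)
      = (η : TwoForm E M) x ![fundamentalField X x, v]
  equivariant : ∀ (g : G) (x : M) X, μ (g • x) (adjoint g X) = μ x X

/-- The zero level set of a moment map. -/
def zeroLevel {Ω : Submodule ℂ (TwoForm E M)} (μ : M → MomentTarget EG G Ω) : Set M :=
  {x | μ x = 0}

end Actions

/-! ### Complexification of a compact Lie group -/

section Complexification

variable {EG : Type*} [NormedAddCommGroup EG] [NormedSpace ℝ EG]
  {G : Type*} [TopologicalSpace G] [ChartedSpace EG G] [Group G]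
  {EC : Type*} [NormedAddCommGroup EC] [NormedSpace ℂ EC]
  {GC : Type*} [TopologicalSpace GC] [ChartedSpace EC GC] [Group GC]

/-- `γ` is the one-parameter subgroup `t ↦ exp (t v)`. -/
structure IsOneParameterSubgroup (γ : ℝ → GC) (v : GroupLieAlgebra 𝓘(ℂ, EC) GC) : Prop where
  smooth : ContMDiff 𝓘(ℝ, ℝ) 𝓘(ℝ, EC) ∞ γ
  map_add : ∀ s t, γ (s + t) = γ s * γ t
  velocity : (mfderiv 𝓘(ℝ, ℝ) 𝓘(ℝ, EC) γ 0 (1 : ℝ) : EC) = v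

/-- The differential at the identity of a homomorphism from a real to a complex Lie group. -/
def lieMap (ι : G →* GC) (X : GroupLieAlgebra 𝓘(ℝ, EG) G) : GroupLieAlgebra 𝓘(ℂ, EC) GC :=
  (mfderiv 𝓘(ℝ, EG) 𝓘(ℝ, EC) ι 1 X : EC)

/-- `ι : G → G_ℂ` exhibits the complex Lie group `G_ℂ` as the complexification of the compact Lie
group `G`: `Lie G_ℂ = Lie G ⊕ i Lie G`, and the polar decomposition holds, i.e. the map
`G × Lie G → G_ℂ`, `(k, X) ↦ ι(k) exp(iX)` is bijective. -/
structure IsComplexification (ι : G →* GC) : Prop where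
  smooth : ContMDiff 𝓘(ℝ, EG) 𝓘(ℝ, EC) ∞ ι
  lieAlgebra : Function.Bijective
    fun p : GroupLieAlgebra 𝓘(ℝ, EG) G × GroupLieAlgebra 𝓘(ℝ, EG) G =>
      (lieMap ι p.1 + Complex.I • lieMap ι p.2 : GroupLieAlgebra 𝓘(ℂ, EC) GC)
  polar : ∀ z : GC, ∃! p : G × GroupLieAlgebra 𝓘(ℝ, EG) G,
    ∃ γ : ℝ → GC, IsOneParameterSubgroup (EC := EC) γ (Complex.I • lieMap ι p.2) ∧
      z = ι p.1 * γ 1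

/-- An action of a complex Lie group on a subset `N` of a complex manifold `M` is holomorphic if
the action map `G_ℂ × N → N ⊆ M` is locally the restriction of a holomorphic map
`G_ℂ × M → M`. -/
def IsHolomorphicActionOn {E : Type*} [NormedAddCommGroup E] [NormedSpace ℂ E]
    {M : Type*} [TopologicalSpace M] [ChartedSpace E M]
    (EC GC : Type*) [NormedAddCommGroup EC] [NormedSpace ℂ EC]
    [TopologicalSpace GC] [ChartedSpace EC GC] [Group GC]
    (N : Set M) [MulAction GC N] : Prop :=
  ∀ (z : GC) (n : N), ∃ F : GC × M → M,
    ContMDiffAt ((𝓘(ℂ, EC)).prod 𝓘(ℂ, E)) 𝓘(ℂ, E) ω F (z, (n : M)) ∧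
    ∀ᶠ p : GC × N in 𝓝 (z, n), F (p.1, (p.2 : M)) = ((p.1 • p.2 : N) : M)

end Complexification

/-! ### Submanifolds and quotient manifolds -/

/-- The given charts make the subset `N` of `M` (with the subspace topology) an embedded complex
submanifold of `M`. -/
structure IsComplexSubmanifold {E : Type*} [NormedAddCommGroup E] [NormedSpace ℂ E]
    {M : Type*} [TopologicalSpace M] [ChartedSpace E M]
    (F : Type*) [NormedAddCommGroup F] [NormedSpace ℂ F]
    (N : Set M) [ChartedSpace F N] : Prop where
  isManifold : IsManifold 𝓘(ℂ, F) ω N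
  holomorphic : ContMDiff 𝓘(ℂ, F) 𝓘(ℂ, E) ω (Subtype.val : N → M)
  immersion : ∀ x : N, Function.Injective (mfderiv 𝓘(ℂ, F) 𝓘(ℂ, E) (Subtype.val : N → M) x)

/-- The given charts make the orbit space `N / Γ` (with the quotient topology) a complex manifold
such that the projection `N → N / Γ` is a holomorphic submersion. -/
structure IsComplexQuotient (F : Type*) [NormedAddCommGroup F] [NormedSpace ℂ F]
    (N : Type*) [TopologicalSpace N] [ChartedSpace F N] (Γ : Type*) [Group Γ] [MulAction Γ N]
    (F' : Type*) [NormedAddCommGroup F'] [NormedSpace ℂ F']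
    [ChartedSpace F' (Quotient (MulAction.orbitRel Γ N))] : Prop where
  t2 : T2Space (Quotient (MulAction.orbitRel Γ N))
  secondCountable : SecondCountableTopology (Quotient (MulAction.orbitRel Γ N))
  isManifold : IsManifold 𝓘(ℂ, F') ω (Quotient (MulAction.orbitRel Γ N))
  holomorphic : ContMDiff 𝓘(ℂ, F) 𝓘(ℂ, F') ω
    (Quotient.mk (MulAction.orbitRel Γ N))
  submersion : ∀ x : N, Function.Surjective
    (mfderiv 𝓘(ℂ, F) 𝓘(ℂ, F') (Quotient.mk (MulAction.orbitRel Γ N)) x)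

end Trisymplectic

end

open scoped Manifold ContDiff Topology

noncomputable section

namespace Trisymplectic

/-! ### Calculus of 2-forms and their representing operators -/

section TwoForms

variable {V : Type*} [AddCommGroup V] [Module ℂ V] [TopologicalSpace V]

/-! The core is linear. Let `W` be non-degenerate and isotropic for all forms in `S`, and let `W^⊥`
be its orthogonal for all of them. Then `W^⊥` has codimension `3 dim W`, and `W^⊥ / W` is
trisymplectic as soon as `dim V > 4 dim W` (`finrank_perp`, `exists_reduced_complement`).

Two independent degenerate forms with complementary annihilators have a non-degenerate sum `κ`,
which turns every form of `S` into a `κ`-self-adjoint operator. The half-rank condition says that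
degenerate forms are half-dimensional eigenspaces. It forces the operators to be `x P + y (1 - P) +
z (q + r)`, where `P` is a projection, `q` and `r` exchange its two eigenspaces, `q r = b P` and `r
q = b (1 - P)` (`exists_frame`). The scalar `b` is allowed to vanish, so only these relations are
used and not an isomorphism of `H` with 2 by 2 matrices.

In such a frame `H · W = P W + (1 - P) W + q W + r W` (`Frame.mem_matSpan`). Isotropy of `W` and
non-degeneracy of `κ` on `H · W` make this sum direct, with four summands of dimension `dim W`. The
space `W^⊥` is the `κ`-orthogonal of `P W + (1 - P) W + (q + r) W`, which gives its codimension. The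
`κ`-orthogonal `U` of `H · W` is stable under all the operators and is a complement of `W` in `W^⊥`.
Kernels of operators split along `V = H · W ⊕ U`. A form degenerate on `U` has half-dimensional
kernel in `V` and in `H · W`, hence in `U`.

On the manifold, `W` is the complex span of the orbit directions at a point of `N`. Since `Lie G_ℂ =
𝔤 ⊕ i𝔤` and `G_ℂ` preserves `N`, `W` is tangent to the `G_ℂ`-orbit inside `N`, and tangent vectors
of `N` lie in `W^⊥`; so `W` is isotropic. Freeness makes the orbit maps injective, and equivariance
makes them immersions (`injective_mfderiv_orbit`), so `dim W = dim G`. The differential of the `3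
dim G` equations of `N` has its kernel inside `W^⊥`, hence is onto, and `N` is a submanifold with
tangent space `W^⊥`. The slice theorem for proper free actions (`exists_quotientChart`) gives the
quotient, with tangent space `W^⊥ / W`.

The restricted forms are annihilated by orbit directions. Being closed, they are constant along
paths in `G_ℂ`; being `G`-invariant, they are `G_ℂ`-invariant by the polar decomposition
(`pullback_smul_pullback_val`). So they descend. Locally they are pullbacks along holomorphic lifts
into `M`, hence holomorphic and closed. Uniqueness is injectivity of `π^*` for a surjective
submersion. -/

theorem form_add_left (η : V [⋀^Fin 2]→L[ℂ] ℂ) (a b w : V) :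
    η ![a + b, w] = η ![a, w] + η ![b, w] := by
  have h := η.map_update_add ![0, w] 0 a b
  simp only [Matrix.vecCons, Fin.update_cons_zero] at h
  exact h

theorem form_smul_left (η : V [⋀^Fin 2]→L[ℂ] ℂ) (c : ℂ) (a w : V) :
    η ![c • a, w] = c * η ![a, w] := by
  have h := η.map_update_smul ![0, w] 0 c a
  simp only [Matrix.vecCons, Fin.update_cons_zero] at h
  exact h

theorem form_swap (η : V [⋀^Fin 2]→L[ℂ] ℂ) (a b : V) : η ![a, b] = - η ![b, a] := by
  have h := η.toAlternatingMap.map_swap ![b, a] (i := 0) (j := 1) (by simp)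
  have e : (![b, a] ∘ (Equiv.swap (0 : Fin 2) 1)) = ![a, b] := by
    ext i; fin_cases i <;> simp
  rw [e] at h
  exact h

theorem form_add_right (η : V [⋀^Fin 2]→L[ℂ] ℂ) (a b w : V) :
    η ![w, a + b] = η ![w, a] + η ![w, b] := by
  rw [form_swap, form_add_left, form_swap η w a, form_swap η w b]; ring

theorem form_smul_right (η : V [⋀^Fin 2]→L[ℂ] ℂ) (c : ℂ) (a w : V) :
    η ![w, c • a] = c * η ![w, a] := by
  rw [form_swap, form_smul_left, form_swap η w a]; ring

theorem form_ext {η θ : V [⋀^Fin 2]→L[ℂ] ℂ} (h : ∀ v w, η ![v, w] = θ ![v, w]) : η = θ := by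
  ext m
  have : m = ![m 0, m 1] := by ext i; fin_cases i <;> rfl
  rw [this]; exact h _ _

/-- The bilinear form underlying a 2-form. -/
def bil : (V [⋀^Fin 2]→L[ℂ] ℂ) →ₗ[ℂ] V →ₗ[ℂ] V →ₗ[ℂ] ℂ where
  toFun η := LinearMap.mk₂ ℂ (fun v w => η ![v, w]) (form_add_left η) (form_smul_left η)
    (fun w a b => form_add_right η a b w) (fun c w a => form_smul_right η c a w)
  map_add' _ _ := rfl
  map_smul' _ _ := rfl

@[simp] theorem bil_apply (η : V [⋀^Fin 2]→L[ℂ] ℂ) (v w : V) : bil η v w = η ![v, w] := rfl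

theorem ker_bil (η : V [⋀^Fin 2]→L[ℂ] ℂ) : LinearMap.ker (bil η) = ann η := by
  ext v
  simp only [LinearMap.mem_ker]
  exact ⟨fun h w => by rw [← bil_apply, h]; rfl, fun h => LinearMap.ext h⟩

theorem mem_ann {η : V [⋀^Fin 2]→L[ℂ] ℂ} {v : V} : v ∈ ann η ↔ ∀ w, η ![v, w] = 0 := Iff.rfl

theorem not_isDegenerate_iff {η : V [⋀^Fin 2]→L[ℂ] ℂ} :
    ¬ IsDegenerate η ↔ ∀ v, (∀ w, η ![v, w] = 0) → v = 0 := by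
  rw [IsDegenerate, not_not, Submodule.eq_bot_iff]; rfl

variable [FiniteDimensional ℂ V]

theorem two_mul_finrank_ann_iff (η : V [⋀^Fin 2]→L[ℂ] ℂ) :
    2 * rank η = Module.finrank ℂ V ↔ 2 * Module.finrank ℂ (ann η) = Module.finrank ℂ V := by
  have := Submodule.finrank_quotient_add_finrank (ann η)
  rw [rank]; omega

/-- A non-degenerate form represents every form by an operator. -/
theorem exists_operator {κ : V [⋀^Fin 2]→L[ℂ] ℂ} (hκ : ¬ IsDegenerate κ) :
    ∃ A : (V [⋀^Fin 2]→L[ℂ] ℂ) →ₗ[ℂ] V →ₗ[ℂ] V,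
      ∀ η v w, κ ![A η v, w] = η ![v, w] := by
  have hk : LinearMap.ker (bil κ) = ⊥ := by rw [ker_bil]; exact not_not.1 hκ
  let e : V ≃ₗ[ℂ] (V →ₗ[ℂ] ℂ) := LinearEquiv.ofInjectiveOfFinrankEq (bil κ)
    (LinearMap.ker_eq_bot.1 hk) (Subspace.dual_finrank_eq (K := ℂ) (V := V)).symm
  refine ⟨{ toFun := fun η => e.symm.toLinearMap ∘ₗ bil η, map_add' := ?_, map_smul' := ?_ }, ?_⟩
  · intro η θ; ext v; simp
  · intro c η; ext v; simp
  · intro η v w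
    have : e (e.symm (bil η v)) = bil η v := e.apply_symm_apply _
    exact LinearMap.congr_fun this w

end TwoForms

/-! ### Operators with half-dimensional eigenspaces -/

section Quadratic

variable {V : Type*} [AddCommGroup V] [Module ℂ V] [FiniteDimensional ℂ V]

/-- Over `ℂ` the generalised eigenspaces span, and only the one at `0` can be non-zero. -/
theorem isNilpotent_of_eigenvalue_unique {A : Module.End ℂ V}
    (h : ∀ c, A.HasEigenvalue c → c = 0) : IsNilpotent A := by
  have htop := Module.End.iSup_maxGenEigenspace_eq_top A
  have h0 : A.maxGenEigenspace 0 = ⊤ := by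
    rw [eq_top_iff, ← htop]
    refine iSup_le fun c => ?_
    by_cases hc : c = 0
    · rw [hc]
    · have : ¬ A.HasEigenvalue c := fun hh => hc (h c hh)
      have h2 : A.maxGenEigenspace c = ⊥ := by
        by_contra hne
        apply this
        rw [Module.End.maxGenEigenspace_eq] at hne
        exact Module.End.hasEigenvalue_of_hasGenEigenvalue (k := A.maxGenEigenspaceIndex c) hne
      rw [h2]; exact bot_le
  refine ⟨A.maxGenEigenspaceIndex 0, ?_⟩
  rw [Module.End.maxGenEigenspace_eq, Module.End.genEigenspace_nat] at h0
  simpa using LinearMap.ker_eq_top.1 h0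

/-- A traceless operator with non-zero trace of the square, such that all eigenspaces of its
non-zero multiples are of half the dimension, has scalar square. -/
theorem sq_eq_smul_of_half_eigenspaces {A : Module.End ℂ V} (htr : LinearMap.trace ℂ V A = 0)
    (htr2 : LinearMap.trace ℂ V (A * A) ≠ 0)
    (h : ∀ c, A.HasEigenvalue c → 2 * Module.finrank ℂ (A.eigenspace c) = Module.finrank ℂ V) :
    ∃ b : ℂ, A * A = b • (1 : Module.End ℂ V) := by
  classical
  have hnil : ¬ IsNilpotent A := fun hA => htr2 <| by
    have : IsNilpotent (A * A) := Commute.isNilpotent_mul_left (Commute.refl A) hA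
    exact (LinearMap.isNilpotent_trace_of_isNilpotent this).eq_zero
  obtain ⟨c, hc, hc0⟩ : ∃ c, A.HasEigenvalue c ∧ c ≠ 0 := by
    by_contra! hcon
    exact hnil (isNilpotent_of_eigenvalue_unique hcon)
  have hfin : (Module.finrank ℂ V : ℂ) ≠ 0 := by
    intro h0
    have h0' : Module.finrank ℂ V = 0 := by exact_mod_cast h0
    have := Module.finrank_zero_iff.1 h0'
    exact hc.exists_hasEigenvector.choose_spec.2 (Subsingleton.elim _ _)
  -- With `c` as the only eigenvalue, `A - c` would be nilpotent, although its trace is `-c dim V ≠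
  -- 0`.
  obtain ⟨c', hc', hne⟩ : ∃ c', A.HasEigenvalue c' ∧ c' ≠ c := by
    by_contra! hcon
    have hB : IsNilpotent (A - c • (1 : Module.End ℂ V)) := by
      apply isNilpotent_of_eigenvalue_unique
      intro e he
      have : A.HasEigenvalue (e + c) := by
        obtain ⟨v, hv⟩ := he.exists_hasEigenvector
        refine Module.End.hasEigenvalue_of_hasEigenvector (x := v) ⟨?_, hv.2⟩
        have := hv.apply_eq_smul
        rw [Module.End.mem_eigenspace_iff, add_smul, ← this]
        simp
      simpa using hcon _ this
    have := (LinearMap.isNilpotent_trace_of_isNilpotent hB).eq_zero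
    simp [htr] at this
    rcases this with h | h
    · exact hc0 h
    · exact hfin (by rw [h]; simp)
  have hdis : Disjoint (A.eigenspace c) (A.eigenspace c') :=
    Module.End.disjoint_genEigenspace A hne.symm 1 1
  have htop : A.eigenspace c ⊔ A.eigenspace c' = ⊤ := by
    apply Submodule.eq_top_of_finrank_eq
    have h1 := Submodule.finrank_sup_add_finrank_inf_eq (A.eigenspace c) (A.eigenspace c')
    rw [hdis.eq_bot, finrank_bot] at h1
    have := h c hc
    have := h c' hc'
    omega
  have hprod : ∀ v, A (A v) - (c + c') • A v + (c * c') • v = 0 := by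
    intro v
    have hv : v ∈ A.eigenspace c ⊔ A.eigenspace c' := htop ▸ Submodule.mem_top
    obtain ⟨x, hx, y, hy, rfl⟩ := Submodule.mem_sup.1 hv
    rw [Module.End.mem_eigenspace_iff] at hx hy
    simp only [map_add, hx, hy, map_smul]
    module
  have hA : A * A = (c + c') • A - (c * c') • (1 : Module.End ℂ V) := by
    ext v
    have := hprod v
    simp only [Module.End.mul_apply, LinearMap.sub_apply, LinearMap.smul_apply,
      Module.End.one_apply]
    rw [← sub_eq_zero, ← this]; module
  refine ⟨-(c * c'), ?_⟩
  have hsum : c + c' = 0 := by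
    -- conjugate eigenvalues: compare the traces on the two eigenspaces
    have h1 : (A - c • (1 : Module.End ℂ V)) * (A - c' • (1 : Module.End ℂ V)) = 0 := by
      ext v
      have := hprod v
      simp only [Module.End.mul_apply, LinearMap.sub_apply, LinearMap.smul_apply,
        Module.End.one_apply, map_sub, map_smul, LinearMap.zero_apply]
      rw [← this]; module
    -- `Q` is the projection onto the `c'`-eigenspace along the `c`-eigenspace. Its trace is `dim V
    -- / 2` by rank and `-c dim V / (c' - c)` by formula.
    let Q : Module.End ℂ V := (c' - c)⁻¹ • (A - c • (1 : Module.End ℂ V))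
    have hcc : c' - c ≠ 0 := sub_ne_zero.2 hne
    have hQ : IsIdempotentElem Q := by
      have : (A - c • (1 : Module.End ℂ V)) * (A - c • (1 : Module.End ℂ V)) =
          (c' - c) • (A - c • (1 : Module.End ℂ V)) := by
        have e : (A - c • (1 : Module.End ℂ V)) =
          (A - c' • (1 : Module.End ℂ V)) + (c' - c) • (1 : Module.End ℂ V) := by module
        conv_lhs => rw [e]
        rw [← e]
        nth_rewrite 2 [e]
        rw [mul_add, h1, zero_add, mul_smul_comm, mul_one]
      rw [IsIdempotentElem]
      simp only [Q]
      rw [smul_mul_smul_comm, this, smul_smul]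
      congr 1
      field_simp
    have hker : LinearMap.ker Q = A.eigenspace c := by
      ext v
      simp only [Q, LinearMap.mem_ker, LinearMap.smul_apply, smul_eq_zero, inv_eq_zero, hcc,
        false_or, LinearMap.sub_apply, Module.End.one_apply, Module.End.mem_eigenspace_iff,
        sub_eq_zero]
    have ht := LinearMap.IsProj.trace (LinearMap.isProj_range_iff_isIdempotentElem Q |>.2 hQ)
    have hr := LinearMap.finrank_range_add_finrank_ker Q
    rw [hker] at hr
    have hc2 := h c hc
    have : (2 : ℂ) * (Module.finrank ℂ (LinearMap.range Q) : ℂ) = Module.finrank ℂ V := by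
      have : 2 * Module.finrank ℂ (LinearMap.range Q) = Module.finrank ℂ V := by omega
      exact_mod_cast this
    rw [← ht] at this
    simp only [Q, map_smul, map_sub, htr, LinearMap.trace_one, smul_eq_mul] at this
    field_simp at this
    have h3 : (c + c') * (Module.finrank ℂ V : ℂ) = 0 := by linear_combination -this
    exact (mul_eq_zero.1 h3).resolve_right hfin
  rw [hA, hsum, zero_smul, zero_sub, neg_smul]

end Quadratic

/-! ### Anticommuting generators from the half-rank condition -/

section Clifford

variable {V : Type*} [AddCommGroup V] [Module ℂ V] [FiniteDimensional ℂ V]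

/-- For all but finitely many `t` the square of `J + t B` has non-zero trace and is therefore
scalar. This square is `1/4 + t (JB + BJ) + t² B²`, and two values of `t` separate the two unknown
coefficients. -/
theorem exists_scalar_anticommutator {J B : Module.End ℂ V} (hV : Module.finrank ℂ V ≠ 0)
    (hJ : J * J = (1 / 4 : ℂ) • (1 : Module.End ℂ V)) (htJ : LinearMap.trace ℂ V J = 0)
    (htB : LinearMap.trace ℂ V B = 0)
    (h : ∀ t : ℂ, t ≠ 0 → ∀ c, (J + t • B).HasEigenvalue c →
      2 * Module.finrank ℂ ((J + t • B).eigenspace c) = Module.finrank ℂ V) :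
    ∃ c b : ℂ, J * B + B * J = c • (1 : Module.End ℂ V) ∧ B * B = b • (1 : Module.End ℂ V) := by
  classical
  have hn : (Module.finrank ℂ V : ℂ) ≠ 0 := by exact_mod_cast hV
  have hexp : ∀ t : ℂ, (J + t • B) * (J + t • B) =
      (1 / 4 : ℂ) • (1 : Module.End ℂ V) + t • (J * B + B * J) + t ^ 2 • (B * B) := by
    intro t
    rw [← hJ]
    simp only [mul_add, add_mul, smul_mul_assoc, mul_smul_comm]
    module
  -- `p(t)` is the trace of `(J + t B)²`. It is not the zero polynomial because `p(0) = dim V / 4`.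
  let p : Polynomial ℂ := Polynomial.C ((1 / 4) * (Module.finrank ℂ V : ℂ)) +
    Polynomial.C (LinearMap.trace ℂ V (J * B + B * J)) * Polynomial.X +
    Polynomial.C (LinearMap.trace ℂ V (B * B)) * Polynomial.X ^ 2
  have hp : p ≠ 0 := by
    intro h0
    have : p.eval 0 = 0 := by rw [h0]; simp
    simp [p] at this
    exact hV this
  have hgood : ∀ t : ℂ, t ∉ p.roots.toFinset → t ≠ 0 →
      ∃ k : ℂ, (J * B + B * J) + t • (B * B) = k • (1 : Module.End ℂ V) := by
    intro t ht ht0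
    have hpe : p.eval t ≠ 0 := by simpa [hp] using ht
    obtain ⟨b, hb⟩ := sq_eq_smul_of_half_eigenspaces (A := J + t • B) (by simp [htJ, htB])
      (by
        rw [hexp t]
        intro h0
        apply hpe
        simp only [map_add, map_smul, LinearMap.trace_one, smul_eq_mul] at h0
        simp only [p, Polynomial.eval_add, Polynomial.eval_mul, Polynomial.eval_C,
          Polynomial.eval_X, Polynomial.eval_pow, map_add]
        linear_combination h0)
      (h t ht0)
    rw [hexp t] at hb
    refine ⟨t⁻¹ * (b - 1 / 4), ?_⟩
    have : t • (J * B + B * J) + t ^ 2 • (B * B) = (b - 1 / 4) • (1 : Module.End ℂ V) := by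
      rw [sub_smul, ← hb]; module
    rw [mul_smul, ← this, smul_add, smul_smul, smul_smul, inv_mul_cancel₀ ht0, one_smul, pow_two,
      ← mul_assoc, inv_mul_cancel₀ ht0, one_mul]
  obtain ⟨t, ht⟩ := Infinite.exists_notMem_finset (insert 0 p.roots.toFinset)
  obtain ⟨s, hs⟩ := Infinite.exists_notMem_finset (insert t (insert 0 p.roots.toFinset))
  simp only [Finset.mem_insert, not_or] at ht hs
  obtain ⟨k, hk⟩ := hgood t ht.2 ht.1
  obtain ⟨l, hl⟩ := hgood s hs.2.2 hs.2.1
  have hst : s - t ≠ 0 := sub_ne_zero.2 hs.1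
  have hBB : B * B = ((s - t)⁻¹ * (l - k)) • (1 : Module.End ℂ V) := by
    have : (s - t) • (B * B) = (l - k) • (1 : Module.End ℂ V) := by
      rw [sub_smul, sub_smul, ← hk, ← hl]; abel
    rw [mul_smul, ← this, smul_smul, inv_mul_cancel₀ hst, one_smul]
  refine ⟨k - t * ((s - t)⁻¹ * (l - k)), _, ?_, hBB⟩
  rw [sub_smul, ← hk, mul_smul, ← hBB]; abel

end Clifford

theorem exists_third_generator {X : Type*} [AddCommGroup X] [Module ℂ X] {S : Submodule ℂ X}
    (hS : Module.finrank ℂ S = 3) {x₁ x₂ : X} (h₁ : x₁ ∈ S) (h₂ : x₂ ∈ S)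
    (hne : ∀ a c : ℂ, a • x₁ + c • x₂ = 0 → a = 0 ∧ c = 0) :
    ∃ x₃ ∈ S, (∀ a c d : ℂ, a • x₁ + c • x₂ + d • x₃ = 0 → d = 0) ∧
      ∀ x ∈ S, ∃ a c d : ℂ, x = a • x₁ + c • x₂ + d • x₃ := by
  have hli : LinearIndependent ℂ ![x₁, x₂] := LinearIndependent.pair_iff.2 hne
  obtain ⟨x₃, h₃, hn₃⟩ : ∃ x₃ ∈ S, x₃ ∉ Submodule.span ℂ (Set.range ![x₁, x₂]) := by
    by_contra! hcon
    have hle : S ≤ Submodule.span ℂ (Set.range ![x₁, x₂]) := hcon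
    have h2 := finrank_span_eq_card (R := ℂ) hli
    have : Module.Finite ℂ (Submodule.span ℂ (Set.range ![x₁, x₂])) :=
      Module.Finite.span_of_finite ℂ (Set.finite_range _)
    have := Submodule.finrank_mono hle
    rw [hS, h2] at this
    simp at this
  have hspan : ∀ a c : ℂ, a • x₁ + c • x₂ ∈ Submodule.span ℂ (Set.range ![x₁, x₂]) := fun a c =>
    Submodule.add_mem _ (Submodule.smul_mem _ _ (Submodule.subset_span ⟨0, rfl⟩))
      (Submodule.smul_mem _ _ (Submodule.subset_span ⟨1, rfl⟩))
  have hli₃ : ∀ a c d : ℂ, a • x₁ + c • x₂ + d • x₃ = 0 → d = 0 := by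
    intro a c d h0
    by_contra hd
    apply hn₃
    have : x₃ = (-d⁻¹ * a) • x₁ + (-d⁻¹ * c) • x₂ := by
      have e : d⁻¹ • (a • x₁ + c • x₂ + d • x₃) = 0 := by rw [h0, smul_zero]
      rw [smul_add, smul_smul d⁻¹ d, inv_mul_cancel₀ hd, one_smul] at e
      rw [← sub_eq_zero, ← e]; module
    rw [this]; exact hspan _ _
  refine ⟨x₃, h₃, hli₃, ?_⟩
  let f : Fin 3 → S := ![⟨x₁, h₁⟩, ⟨x₂, h₂⟩, ⟨x₃, h₃⟩]
  have hf : LinearIndependent ℂ f := by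
    rw [Fintype.linearIndependent_iff]
    intro g hg
    have hg' : g 0 • x₁ + g 1 • x₂ + g 2 • x₃ = 0 := by
      have := congrArg Subtype.val hg
      simpa [Fin.sum_univ_three, f] using this
    have g2 := hli₃ _ _ _ hg'
    rw [g2, zero_smul, add_zero] at hg'
    have := hne _ _ hg'
    intro i; fin_cases i
    · exact this.1
    · exact this.2
    · exact g2
  have : Module.Finite ℂ S := Module.finite_of_finrank_pos (by rw [hS]; norm_num)
  have htop := hf.span_eq_top_of_card_eq_finrank (by rw [hS]; simp)
  intro x hx
  have hm : (⟨x, hx⟩ : S) ∈ Submodule.span ℂ (Set.range f) := htop ▸ Submodule.mem_top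
  obtain ⟨c, hc⟩ := (Submodule.mem_span_range_iff_exists_fun ℂ).1 hm
  refine ⟨c 0, c 1, c 2, ?_⟩
  have := congrArg Subtype.val hc
  simpa [Fin.sum_univ_three, f] using this.symm

/-! ### Frames of a trisymplectic space -/

section Frames

variable {V : Type*} [AddCommGroup V] [Module ℂ V] [TopologicalSpace V]

/-- A description of a space `S` of 2-forms by operators: a non-degenerate form `κ`, a projection
`P` and operators `q`, `r` which exchange the two eigenspaces of `P`. -/
structure Frame (S : Submodule ℂ (V [⋀^Fin 2]→L[ℂ] ℂ)) where
  /-- the reference form -/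
  κ : V [⋀^Fin 2]→L[ℂ] ℂ
  /-- the projection -/
  P : Module.End ℂ V
  /-- the upper off-diagonal block -/
  q : Module.End ℂ V
  /-- the lower off-diagonal block -/
  r : Module.End ℂ V
  /-- the square of `q + r` -/
  b : ℂ
  nondeg : ∀ v, (∀ w, κ ![v, w] = 0) → v = 0
  P_mul_P : P * P = P
  P_mul_q : P * q = q
  q_mul_P : q * P = 0
  P_mul_r : P * r = 0
  r_mul_P : r * P = r
  q_mul_r : q * r = b • P
  r_mul_q : r * q = b • (1 - P)
  adj_P : ∀ v w, κ ![P v, w] = κ ![v, P w]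
  adj_q : ∀ v w, κ ![q v, w] = κ ![v, r w]
  exists_repr : ∀ η ∈ S, ∃ x y z : ℂ, ∀ v w,
    η ![v, w] = κ ![(x • P + y • (1 - P) + z • (q + r)) v, w]
  exists_form : ∀ x y z : ℂ, ∃ η ∈ S, ∀ v w,
    η ![v, w] = κ ![(x • P + y • (1 - P) + z • (q + r)) v, w]
  P_ne_zero : P ≠ 0
  P_ne_one : P ≠ 1

variable [FiniteDimensional ℂ V]

-- Relative to `κ = η₁ + η₂` the forms `η₂` and `η₁` are represented by `P` and `1 - P`.
-- Annihilators of forms become eigenspaces of operators, so the half-rank condition feeds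
-- `exists_scalar_anticommutator` with `J = P - 1/2`. Once its trace and its `J`-component are
-- removed, the third generator anticommutes with `J`, so it has only off-diagonal blocks.
set_option maxHeartbeats 800000 in
theorem exists_frame {S : Submodule ℂ (V [⋀^Fin 2]→L[ℂ] ℂ)} (hS : IsTrisymplecticSpace S)
    {η₁ η₂ : V [⋀^Fin 2]→L[ℂ] ℂ} (h₁ : η₁ ∈ S) (h₂ : η₂ ∈ S) (hd₁ : IsDegenerate η₁)
    (hd₂ : IsDegenerate η₂) (hli : LinearIndependent ℂ ![η₁, η₂]) {P : Module.End ℂ V}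
    (hP : IsIdempotentElem P) (hr : LinearMap.range P = ann η₁) (hk : LinearMap.ker P = ann η₂) :
    Nonempty (Frame S) := by
  have hPP : ∀ v, P (P v) = P v := fun v => LinearMap.congr_fun hP v
  have e₁ : ∀ v w, η₁ ![P v, w] = 0 := fun v w => by
    have : P v ∈ ann η₁ := hr ▸ ⟨v, rfl⟩
    exact this w
  have e₂ : ∀ v w, η₂ ![P v, w] = η₂ ![v, w] := fun v w => by
    have : v - P v ∈ ann η₂ := hk ▸ by simp [hPP]
    have h := this w
    rw [sub_eq_add_neg, ← neg_one_smul ℂ, form_add_left, form_smul_left] at h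
    linear_combination -h
  set κ := η₁ + η₂ with hκ
  have hκS : κ ∈ S := S.add_mem h₁ h₂
  have k₂ : ∀ v w, κ ![P v, w] = η₂ ![v, w] := fun v w => by
    simp [hκ, e₁, e₂]
  have adjP : ∀ v w, κ ![P v, w] = κ ![v, P w] := fun v w => by
    rw [k₂, form_swap, ← k₂, form_swap κ v]
  have hnd : ∀ v, (∀ w, κ ![v, w] = 0) → v = 0 := by
    intro v hv
    have a₂ : ∀ w, η₂ ![v, w] = 0 := fun w => by rw [← k₂, adjP, hv]
    have a₁ : ∀ w, η₁ ![v, w] = 0 := fun w => by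
      have := hv w
      simpa [hκ, a₂] using this
    have m₂ : v ∈ LinearMap.ker P := hk ▸ a₂
    have m₁ : v ∈ LinearMap.range P := hr ▸ a₁
    obtain ⟨u, rfl⟩ := m₁
    have := LinearMap.mem_ker.1 m₂
    rwa [hPP] at this
  obtain ⟨A, hA⟩ := exists_operator (not_isDegenerate_iff.2 hnd)
  have hop : ∀ {f g : Module.End ℂ V}, (∀ v w, κ ![f v, w] = κ ![g v, w]) → f = g := by
    intro f g hfg
    ext v
    rw [← sub_eq_zero]
    apply hnd
    intro w
    rw [sub_eq_add_neg, ← neg_one_smul ℂ, form_add_left, form_smul_left, hfg]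
    ring
  have Aκ : A κ = 1 := hop fun v w => by rw [hA]; rfl
  have A₂ : A η₂ = P := hop fun v w => by rw [hA, k₂]
  have A₁ : A η₁ = 1 - P := by
    rw [← Aκ, ← A₂, ← map_sub]; congr 1; rw [hκ]; abel
  have adjA : ∀ η v w, κ ![A η v, w] = κ ![v, A η w] := fun η v w => by
    rw [hA, form_swap, ← hA, form_swap κ v]
  have kerA : ∀ η, LinearMap.ker (A η) = ann η := by
    intro η
    ext v
    rw [LinearMap.mem_ker, mem_ann]
    constructor
    · intro h w
      rw [← hA, h, ← zero_smul ℂ (0 : V), form_smul_left, zero_mul]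
    · intro h
      exact hnd _ fun w => by rw [hA, h]
  have hP0 : P ≠ 0 := by
    rintro rfl
    exact hd₁ (by rw [← hr]; simp)
  have hP1 : P ≠ 1 := by
    rintro rfl
    exact hd₂ (by rw [← hk]; ext; simp)
  have hV : Module.finrank ℂ V ≠ 0 := fun h0 => by
    have := Module.finrank_zero_iff.1 h0
    exact hP0 (LinearMap.ext fun v => Subsingleton.elim _ _)
  have hn : (Module.finrank ℂ V : ℂ) ≠ 0 := by exact_mod_cast hV
  have hne : ∀ a c : ℂ, a • η₁ + c • η₂ = 0 → a = 0 ∧ c = 0 :=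
    LinearIndependent.pair_iff.1 hli
  obtain ⟨η₃, h₃, hli₃, hrepr⟩ := exists_third_generator hS.finrank_eq h₁ h₂ hne
  -- traceless operators
  have htP : LinearMap.trace ℂ V P = (1 / 2) * (Module.finrank ℂ V : ℂ) := by
    rw [LinearMap.IsProj.trace (LinearMap.isProj_range_iff_isIdempotentElem P |>.2 hP), hr]
    have h0 : η₁ ≠ 0 := fun h0 => by simpa using (hne 1 0 (by rw [h0]; exact form_ext fun v w => by simp)).1
    have := (two_mul_finrank_ann_iff η₁).1 (hS.rank_eq _ h₁ h0 hd₁)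
    rw [← this]; push_cast; ring
  set τ : ℂ := LinearMap.trace ℂ V (A η₃) / (Module.finrank ℂ V : ℂ) with hτ
  set J : Module.End ℂ V := P - (1 / 2 : ℂ) • 1 with hJdef
  have hJ : J * J = (1 / 4 : ℂ) • (1 : Module.End ℂ V) := by
    rw [hJdef, sub_mul, mul_sub, hP.eq]
    simp only [smul_mul_assoc, mul_smul_comm, one_mul, mul_one, mul_sub]
    module
  have htJ : LinearMap.trace ℂ V J = 0 := by
    rw [hJdef, map_sub, map_smul, LinearMap.trace_one, htP, smul_eq_mul, sub_self]
  obtain ⟨c, b, hc, hb⟩ := exists_scalar_anticommutator (J := J)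
    (B := A η₃ - τ • (1 : Module.End ℂ V)) hV hJ htJ
    (by rw [map_sub, map_smul, LinearMap.trace_one, hτ, smul_eq_mul, div_mul_cancel₀ _ hn, sub_self])
    (by
      intro t ht e he
      -- The multiple of `κ` is chosen so that the operator of `η` is `J + t (A η₃ - τ) - e`; its
      -- kernel is the `e`-eigenspace. Independence of the three generators and `t ≠ 0` give `η ≠
      -- 0`.
      set η := η₂ + t • η₃ - (1 / 2 + t * τ + e) • κ with hη
      have hηS : η ∈ S := S.sub_mem (S.add_mem h₂ (S.smul_mem _ h₃)) (S.smul_mem _ hκS)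
      have hAη : A η = J + t • (A η₃ - τ • (1 : Module.End ℂ V)) - e • 1 := by
        rw [hη, map_sub, map_add, map_smul, map_smul, Aκ, A₂, hJdef]; module
      have hη0 : η ≠ 0 := by
        intro h0
        apply ht
        refine hli₃ (-(1 / 2 + t * τ + e)) (1 - (1 / 2 + t * τ + e)) t ?_
        rw [← h0, hη, hκ]; module
      have heig : (J + t • (A η₃ - τ • (1 : Module.End ℂ V))).eigenspace e = ann η := by
        rw [← kerA, hAη]
        ext v
        simp only [Module.End.mem_eigenspace_iff, LinearMap.mem_ker, LinearMap.sub_apply,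
          LinearMap.smul_apply, Module.End.one_apply, sub_eq_zero]
      rw [heig]
      refine (two_mul_finrank_ann_iff η).1 (hS.rank_eq _ hηS hη0 ?_)
      rw [IsDegenerate, ← heig]
      exact he)
  set B₀ := A η₃ - τ • (1 : Module.End ℂ V) with hB₀
  -- Since `J² = 1/4`, the anticommutator of `J` with `2c J` is `c`, which cancels that of `B₀`.
  set B : Module.End ℂ V := B₀ - (2 * c) • J with hB
  have hBJ : J * B + B * J = 0 := by
    have : J * B + B * J = (J * B₀ + B₀ * J) - (4 * c) • (J * J) := by
      rw [hB]; simp only [mul_sub, sub_mul, mul_smul_comm, smul_mul_assoc]; module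
    rw [this, hc, hJ]; module
  have hBB : B * B = (b - c ^ 2) • (1 : Module.End ℂ V) := by
    have : B * B = B₀ * B₀ - (2 * c) • (J * B₀ + B₀ * J) + (4 * c ^ 2) • (J * J) := by
      rw [hB]; simp only [mul_sub, sub_mul, mul_smul_comm, smul_mul_assoc]; module
    rw [this, hc, hJ, hb]; module
  have hPB : P * B + B * P = B := by
    have : P = J + (1 / 2 : ℂ) • 1 := by rw [hJdef]; abel
    rw [this, add_mul, mul_add, smul_mul_assoc, mul_smul_comm, one_mul, mul_one]
    calc _ = (J * B + B * J) + B := by module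
      _ = B := by rw [hBJ, zero_add]
  -- Multiplying `PB + BP = B` by `P` on the left gives `PB + PBP = PB`.
  have hPBP : P * B * P = 0 := by
    have h := congrArg (fun X => P * X) hPB
    simp only [mul_add, ← mul_assoc, hP.eq] at h
    exact left_eq_add.1 h.symm
  -- `S` contains the form with operator `B`, which makes `B` self-adjoint and gives the third
  -- generator of `exists_form`.
  set ηB := η₃ - τ • κ - (2 * c) • (η₂ - (1 / 2 : ℂ) • κ) with hηB
  have hηBS : ηB ∈ S := S.sub_mem (S.sub_mem h₃ (S.smul_mem _ hκS))
    (S.smul_mem _ (S.sub_mem h₂ (S.smul_mem _ hκS)))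
  have AB : A ηB = B := by
    simp only [hηB, map_sub, map_smul, Aκ, A₂]
    rw [hB, hB₀, hJdef]
  refine ⟨{ κ := κ, P := P, q := P * B, r := B * P, b := b - c ^ 2, nondeg := hnd,
            P_mul_P := hP, P_mul_q := by rw [← mul_assoc, hP.eq], q_mul_P := hPBP,
            P_mul_r := by rw [← mul_assoc, hPBP], r_mul_P := by rw [mul_assoc, hP.eq],
            q_mul_r := ?_, r_mul_q := ?_, adj_P := adjP, adj_q := ?_, exists_repr := ?_,
            exists_form := ?_, P_ne_zero := hP0, P_ne_one := hP1 }⟩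
  · rw [mul_assoc, ← mul_assoc B B P, hBB]; simp [hP.eq]
  · rw [mul_assoc, ← mul_assoc P P B, hP.eq, ← mul_assoc]
    have : B * P = B - P * B := by
      rw [eq_sub_iff_add_eq, add_comm, hPB]
    rw [this, sub_mul, mul_assoc, hBB]; simp [smul_sub]
  · intro v w
    rw [Module.End.mul_apply, adjP, ← AB, adjA]; rfl
  · intro η hη
    obtain ⟨x, y, z, rfl⟩ := hrepr η hη
    have : A (x • η₁ + y • η₂ + z • η₃) = (y + z * τ + z * c) • P + (x + z * τ - z * c) • (1 - P)
        + z • B := by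
      simp only [map_add, map_smul, A₁, A₂]
      have : A η₃ = B + (2 * c) • J + τ • 1 := by rw [hB, hB₀]; abel
      rw [this, hJdef]; module
    refine ⟨y + z * τ + z * c, x + z * τ - z * c, z, fun v w => ?_⟩
    rw [hPB, ← this, hA]
  · intro x y z
    refine ⟨y • η₁ + x • η₂ + z • ηB, S.add_mem (S.add_mem (S.smul_mem _ h₁) (S.smul_mem _ h₂))
      (S.smul_mem _ hηBS), fun v w => ?_⟩
    have : A (y • η₁ + x • η₂ + z • ηB) = x • P + y • (1 - P) + z • (P * B + B * P) := by
      simp only [map_add, map_smul, A₁, A₂, AB, hPB]; abel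
    rw [← this, hA]

end Frames

/-! ### The space `H · W` in a frame -/

variable {V : Type*} [AddCommGroup V] [Module ℂ V] [TopologicalSpace V]

theorem form_zero_left (η : V [⋀^Fin 2]→L[ℂ] ℂ) (w : V) : η ![0, w] = 0 := by
  rw [← zero_smul ℂ (0 : V), form_smul_left, zero_mul]

theorem form_zero_right (η : V [⋀^Fin 2]→L[ℂ] ℂ) (w : V) : η ![w, 0] = 0 := by
  rw [form_swap, form_zero_left, neg_zero]

theorem form_sub_left (η : V [⋀^Fin 2]→L[ℂ] ℂ) (a b w : V) :
    η ![a - b, w] = η ![a, w] - η ![b, w] := by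
  rw [sub_eq_add_neg, ← neg_one_smul ℂ, form_add_left, form_smul_left]; ring

theorem form_sub_right (η : V [⋀^Fin 2]→L[ℂ] ℂ) (a b w : V) :
    η ![w, a - b] = η ![w, a] - η ![w, b] := by
  rw [sub_eq_add_neg, ← neg_one_smul ℂ, form_add_right, form_smul_right]; ring

/-- The sum of two forms with complementary annihilators is non-degenerate. -/
theorem eq_zero_of_sum_ann {η₁ η₂ : V [⋀^Fin 2]→L[ℂ] ℂ} {P : Module.End ℂ V}
    (hP : IsIdempotentElem P) (hr : LinearMap.range P = ann η₁) (hk : LinearMap.ker P = ann η₂)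
    {v : V} (hv : ∀ w, η₁ ![v, w] + η₂ ![v, w] = 0) : v = 0 := by
  have hPP : ∀ v, P (P v) = P v := fun v => LinearMap.congr_fun hP v
  have e₁ : ∀ v w, η₁ ![P v, w] = 0 := fun v w => by
    have : P v ∈ ann η₁ := hr ▸ ⟨v, rfl⟩
    exact this w
  have e₂ : ∀ v w, η₂ ![P v, w] = η₂ ![v, w] := fun v w => by
    have : v - P v ∈ ann η₂ := hk ▸ by simp [hPP]
    have h := this w
    rw [form_sub_left] at h
    linear_combination -h
  have a₂ : ∀ w, η₂ ![v, w] = 0 := fun w => by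
    have h := hv (P w)
    rw [form_swap η₁, e₁, form_swap η₂, e₂, form_swap η₂ w v] at h
    linear_combination h
  have a₁ : ∀ w, η₁ ![v, w] = 0 := fun w => by
    have := hv w
    rwa [a₂, add_zero] at this
  have m₂ : v ∈ LinearMap.ker P := hk ▸ a₂
  have m₁ : v ∈ LinearMap.range P := hr ▸ a₁
  obtain ⟨u, rfl⟩ := m₁
  have := LinearMap.mem_ker.1 m₂
  rwa [hPP] at this

namespace Frame

variable {S : Submodule ℂ (V [⋀^Fin 2]→L[ℂ] ℂ)} (F : Frame S)

/-- The operators which represent the forms in `S`. -/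
def op (x y z : ℂ) : Module.End ℂ V := x • F.P + y • (1 - F.P) + z • (F.q + F.r)

theorem op_apply (x y z : ℂ) (v : V) :
    F.op x y z v = x • F.P v + y • (v - F.P v) + z • (F.q v + F.r v) := rfl

theorem P_P (v : V) : F.P (F.P v) = F.P v := LinearMap.congr_fun F.P_mul_P v
theorem P_q (v : V) : F.P (F.q v) = F.q v := LinearMap.congr_fun F.P_mul_q v
theorem q_P (v : V) : F.q (F.P v) = 0 := LinearMap.congr_fun F.q_mul_P v
theorem P_r (v : V) : F.P (F.r v) = 0 := LinearMap.congr_fun F.P_mul_r v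
theorem r_P (v : V) : F.r (F.P v) = F.r v := LinearMap.congr_fun F.r_mul_P v
theorem q_r (v : V) : F.q (F.r v) = F.b • F.P v := LinearMap.congr_fun F.q_mul_r v
theorem r_q (v : V) : F.r (F.q v) = F.b • (v - F.P v) := LinearMap.congr_fun F.r_mul_q v
theorem q_q (v : V) : F.q (F.q v) = 0 := by rw [← F.P_q v, F.q_P]
theorem r_r (v : V) : F.r (F.r v) = 0 := by rw [← F.r_P (F.r v), F.P_r, map_zero]

/-- Exchange of the two blocks. -/
def swap : Frame S where
  κ := F.κ
  P := 1 - F.P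
  q := F.r
  r := F.q
  b := F.b
  nondeg := F.nondeg
  P_mul_P := by rw [sub_mul, one_mul, mul_sub, F.P_mul_P]; simp
  P_mul_q := by rw [sub_mul, F.P_mul_r]; simp
  q_mul_P := by rw [mul_sub, F.r_mul_P]; simp
  P_mul_r := by rw [sub_mul, F.P_mul_q]; simp
  r_mul_P := by rw [mul_sub, F.q_mul_P]; simp
  q_mul_r := F.r_mul_q
  r_mul_q := by rw [F.q_mul_r]; simp
  adj_P v w := by
    simp only [LinearMap.sub_apply, Module.End.one_apply, form_sub_left, form_sub_right, F.adj_P]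
  adj_q v w := by rw [form_swap, ← F.adj_q, form_swap F.κ v]
  exists_repr η hη := by
    obtain ⟨x, y, z, h⟩ := F.exists_repr η hη
    refine ⟨y, x, z, fun v w => (h v w).trans ?_⟩
    congr 3
    rw [sub_sub_cancel, add_comm F.r, add_comm (y • _)]
  exists_form x y z := by
    obtain ⟨η, hη, h⟩ := F.exists_form y x z
    refine ⟨η, hη, fun v w => (h v w).trans ?_⟩
    congr 3
    rw [sub_sub_cancel, add_comm F.r, add_comm (y • _)]
  P_ne_zero h := F.P_ne_one (sub_eq_zero.1 h).symm
  P_ne_one h := F.P_ne_zero (by simpa using h)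

theorem adj_r (v w : V) : F.κ ![F.r v, w] = F.κ ![v, F.q w] := F.swap.adj_q v w

theorem adj_op (x y z : ℂ) (v w : V) : F.κ ![F.op x y z v, w] = F.κ ![v, F.op x y z w] := by
  simp only [op_apply, form_add_left, form_add_right, form_smul_left, form_smul_right,
    form_sub_left, form_sub_right, F.adj_P, F.adj_q, F.adj_r]
  ring

/-- Cayley–Hamilton for a 2 by 2 matrix with trace `x + y` and determinant `x y - b z²`. -/
theorem op_op (x y z : ℂ) (v : V) :
    F.op x y z (F.op x y z v) = (x + y) • F.op x y z v - (x * y - F.b * z ^ 2) • v := by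
  simp only [op_apply, map_add, map_sub, map_smul, F.P_P, F.P_q, F.q_P, F.P_r, F.r_P, F.q_r,
    F.r_q, F.q_q, F.r_r]
  module

theorem ann_eq {η : V [⋀^Fin 2]→L[ℂ] ℂ} {x y z : ℂ}
    (h : ∀ v w, η ![v, w] = F.κ ![F.op x y z v, w]) : ann η = LinearMap.ker (F.op x y z) := by
  ext v
  rw [LinearMap.mem_ker, mem_ann]
  exact ⟨fun hv => F.nondeg _ fun w => by rw [← h, hv], fun hv w => by
    rw [h, hv, form_zero_left]⟩

/-- The diagonal blocks are read off on the range and on the kernel of `P`, both non-zero. Nothing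
follows for `z`, since a frame does not exclude `q + r = 0`. -/
theorem op_eq_zero {x y z : ℂ} (h : ∀ v, F.op x y z v = 0) : x = 0 ∧ y = 0 := by
  obtain ⟨u, hu⟩ : ∃ u, F.P u ≠ 0 := by
    by_contra! hc; exact F.P_ne_zero (LinearMap.ext hc)
  obtain ⟨w, hw⟩ : ∃ w, w - F.P w ≠ 0 := by
    by_contra! hc; exact F.P_ne_one (LinearMap.ext fun w => (sub_eq_zero.1 (hc w)).symm)
  constructor
  · have := congrArg F.P (h (F.P u))
    simp only [op_apply, F.P_P, F.q_P, F.P_r, map_add, map_smul, sub_self, map_zero] at this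
    simpa [hu] using this
  · have := h (w - F.P w)
    have := congrArg (fun v => v - F.P v) this
    simp only [op_apply, F.P_P, F.q_P, F.P_r, F.r_P, F.P_q, map_add, map_sub, map_smul, sub_self,
      map_zero] at this
    have h' : y • (w - F.P w) = 0 := by rw [← this]; module
    exact (smul_eq_zero.1 h').resolve_right hw

/-- Translates the definition of a generator of `H` into operators: the annihilator of a form is the
kernel of its operator, so `Q` must project onto the first kernel along the second. -/
theorem mem_matAlgebra {x y z x' y' z' : ℂ} {Q : Module.End ℂ V} (hQ : IsIdempotentElem Q)
    (h₁ : ∀ v, F.op x y z (Q v) = 0) (h₁' : ∀ v, F.op x y z v = 0 → Q v = v)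
    (h₂ : ∀ v, F.op x' y' z' v = 0 ↔ Q v = 0) (h0 : Q ≠ 0) (h1 : Q ≠ 1)
    (hli : ∀ a c : ℂ, (∀ v, a • F.op x y z v + c • F.op x' y' z' v = 0) → a = 0 ∧ c = 0) :
    Q ∈ matAlgebra S := by
  obtain ⟨η₁, hS₁, e₁⟩ := F.exists_form x y z
  obtain ⟨η₂, hS₂, e₂⟩ := F.exists_form x' y' z'
  have r₁ : LinearMap.range Q = ann η₁ := by
    rw [F.ann_eq e₁]
    ext v
    constructor
    · rintro ⟨u, rfl⟩; exact h₁ u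
    · intro hv; exact ⟨v, h₁' v hv⟩
  have r₂ : LinearMap.ker Q = ann η₂ := by
    rw [F.ann_eq e₂]
    ext v; exact (h₂ v).symm
  refine Submodule.subset_span ⟨η₁, hS₁, η₂, hS₂, ?_, ?_, ?_, hQ, r₁, r₂⟩
  · rw [IsDegenerate, ← r₁]
    exact fun h => h0 (LinearMap.range_eq_bot.1 h)
  · rw [IsDegenerate, ← r₂]
    intro h
    apply h1
    ext v
    have : v - Q v ∈ LinearMap.ker Q := by
      have := LinearMap.congr_fun hQ v
      simp only [Module.End.mul_apply] at this
      simp [this]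
    rw [h, Submodule.mem_bot, sub_eq_zero] at this
    exact this.symm
  · refine LinearIndependent.pair_iff.2 fun a c hac => hli a c fun v => F.nondeg _ fun w => ?_
    have : (a • η₁ + c • η₂) ![v, w] = 0 := by rw [hac]; rfl
    rw [form_add_left, form_smul_left, form_smul_left]
    exact (congrArg₂ (fun s t => a * s + c * t) (e₁ v w) (e₂ v w)).symm.trans this

theorem P_mem : F.P ∈ matAlgebra S := by
  refine F.mem_matAlgebra (x := 0) (y := 1) (z := 0) (x' := 1) (y' := 0) (z' := 0) F.P_mul_P
    ?_ ?_ ?_ F.P_ne_zero F.P_ne_one ?_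
  · intro v; simp [op_apply, F.P_P]
  · intro v hv
    simp only [op_apply, zero_smul, one_smul, zero_add, add_zero, sub_eq_zero] at hv
    exact hv.symm
  · intro v; simp [op_apply]
  · intro a c h
    have : ∀ v, F.op c a 0 v = 0 := fun v => by
      rw [← h v]; simp only [op_apply]; module
    exact (F.op_eq_zero this).symm

/-- `P - r` is the projection onto the kernel of `F.op F.b 1 1`, an operator of determinant zero,
along the kernel of `P`. Hence `r = P - (P - r)` is a difference of two generators. -/
theorem r_mem : F.r ∈ matAlgebra S := by
  have : F.P - F.r ∈ matAlgebra S := by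
    refine F.mem_matAlgebra (x := F.b) (y := 1) (z := 1) (x' := 1) (y' := 0) (z' := 0) ?_
      ?_ ?_ ?_ ?_ ?_ ?_
    · ext v
      simp [F.P_P, F.P_r, F.r_P, F.r_r]
    · intro v
      simp only [op_apply, LinearMap.sub_apply, map_sub, F.P_P, F.P_r, F.r_P, F.r_r, F.q_P, F.q_r]
      module
    · intro v hv
      have := congrArg (fun v => v - F.P v) hv
      simp only [op_apply, F.P_P, F.P_r, F.P_q, map_add, map_sub, map_smul, sub_self,
        map_zero, one_smul] at this
      rw [LinearMap.sub_apply, ← sub_eq_zero, ← neg_eq_zero, ← this]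
      module
    · intro v
      simp only [op_apply, one_smul, zero_smul, add_zero, LinearMap.sub_apply]
      constructor
      · intro h; rw [h, ← F.r_P, h, map_zero, sub_zero]
      · intro h
        have := congrArg F.P h
        simpa [F.P_P, F.P_r] using this
    · intro h
      apply F.P_ne_zero
      ext v
      have := congrArg F.P (LinearMap.congr_fun h v)
      simpa [F.P_P, F.P_r] using this
    · intro h
      apply F.P_ne_one
      ext v
      have h1 := LinearMap.congr_fun h v
      have h2 := LinearMap.congr_fun h (v - F.P v)
      simp [F.P_P, F.r_P] at h1 h2
      exact (sub_eq_zero.1 h2.symm).symm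
    · intro a c h
      have : ∀ v, F.op (a * F.b + c) a a v = 0 := fun v => by
        rw [← h v]; simp only [op_apply]; module
      have h2 := F.op_eq_zero this
      refine ⟨h2.2, ?_⟩
      simpa [h2.2] using h2.1
  have h := Submodule.sub_mem _ F.P_mem this
  rwa [sub_sub_cancel] at h

/-- `H · W` in terms of a frame. -/
theorem mem_matSpan [FiniteDimensional ℂ V] (W : Submodule ℂ V) (v : V) :
    v ∈ matSpan S W ↔ ∃ w₁ ∈ W, ∃ w₂ ∈ W, ∃ w₃ ∈ W, ∃ w₄ ∈ W,
      v = F.P w₁ + (w₂ - F.P w₂) + F.q w₃ + F.r w₄ := by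
  constructor
  · let K : Submodule ℂ V := W.map F.P ⊔ W.map (1 - F.P) ⊔ W.map F.q ⊔ W.map F.r
    have hK : ∀ v, v ∈ K ↔ ∃ w₁ ∈ W, ∃ w₂ ∈ W, ∃ w₃ ∈ W, ∃ w₄ ∈ W,
        v = F.P w₁ + (w₂ - F.P w₂) + F.q w₃ + F.r w₄ := by
      intro v
      constructor
      · intro hv
        obtain ⟨a, ha, _, ⟨w₄, h₄, rfl⟩, rfl⟩ := Submodule.mem_sup.1 hv
        obtain ⟨c, hc, _, ⟨w₃, h₃, rfl⟩, rfl⟩ := Submodule.mem_sup.1 ha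
        obtain ⟨_, ⟨w₁, h₁, rfl⟩, _, ⟨w₂, h₂, rfl⟩, rfl⟩ := Submodule.mem_sup.1 hc
        exact ⟨w₁, h₁, w₂, h₂, w₃, h₃, w₄, h₄, rfl⟩
      · rintro ⟨w₁, h₁, w₂, h₂, w₃, h₃, w₄, h₄, rfl⟩
        exact Submodule.add_mem_sup (Submodule.add_mem_sup (Submodule.add_mem_sup ⟨w₁, h₁, rfl⟩
          ⟨w₂, h₂, rfl⟩) ⟨w₃, h₃, rfl⟩) ⟨w₄, h₄, rfl⟩
    rw [← hK]
    -- The products `q r` and `r q` are multiples of the diagonal blocks, so applying an operator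
    -- only recombines the four vectors of `W`, with coefficients as in a matrix product.
    have hop : ∀ x y z, ∀ v ∈ K, F.op x y z v ∈ K := by
      intro x y z v hv
      obtain ⟨w₁, h₁, w₂, h₂, w₃, h₃, w₄, h₄, rfl⟩ := (hK v).1 hv
      refine (hK _).2 ⟨x • w₁ + (z * F.b) • w₄, W.add_mem (W.smul_mem _ h₁) (W.smul_mem _ h₄),
        y • w₂ + (z * F.b) • w₃, W.add_mem (W.smul_mem _ h₂) (W.smul_mem _ h₃),
        x • w₃ + z • w₂, W.add_mem (W.smul_mem _ h₃) (W.smul_mem _ h₂),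
        y • w₄ + z • w₁, W.add_mem (W.smul_mem _ h₄) (W.smul_mem _ h₁), ?_⟩
      simp only [op_apply, map_add, map_sub, map_smul, F.P_P, F.P_q, F.q_P, F.P_r, F.r_P, F.q_r,
        F.r_q, F.q_q, F.r_r]
      module
    have hWK : W ≤ K := fun w hw => (hK w).2
      ⟨w, hw, w, hw, 0, W.zero_mem, 0, W.zero_mem, by simp⟩
    suffices h : ∀ T ∈ matAlgebra S, ∀ w ∈ W, T w ∈ K by
      refine fun hv => Submodule.span_le.2 ?_ hv
      rintro _ ⟨T, hT, w, hw, rfl⟩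
      exact h T hT w hw
    intro T hT
    induction hT using Submodule.span_induction with
    | zero => intro w _; exact K.zero_mem
    | add a b _ _ ha hb => intro w hw; exact K.add_mem (ha w hw) (hb w hw)
    | smul c a _ ha => intro w hw; exact K.smul_mem c (ha w hw)
    | mem Q hQ =>
      obtain ⟨η₁, hS₁, η₂, hS₂, -, -, -, hQ, hr, hk⟩ := hQ
      intro w hw
      obtain ⟨x, y, z, e₁⟩ := F.exists_repr η₁ hS₁
      obtain ⟨x', y', z', e₂⟩ := F.exists_repr η₂ hS₂
      have hsum : ∀ v, F.op (x + x') (y + y') (z + z') v = F.op x y z v + F.op x' y' z' v :=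
        fun v => by simp only [op_apply]; module
      have hinj : Function.Injective (F.op (x + x') (y + y') (z + z')) := by
        rw [← LinearMap.ker_eq_bot, Submodule.eq_bot_iff]
        intro v hv
        refine eq_zero_of_sum_ann hQ hr hk fun u => ?_
        rw [e₁, e₂, ← form_add_left]
        have : F.op x y z v + F.op x' y' z' v = 0 := by rw [← hsum]; exact hv
        exact (congrArg (fun t => F.κ ![t, u]) this).trans (form_zero_left _ _)
      -- Let `T₁`, `T₂` be the operators of `η₁`, `η₂`. From `T₁ Q = 0` and `T₂ (1 - Q) = 0` it
      -- follows that `(T₁ + T₂) Q = T₂`.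
      have hQw : F.op (x + x') (y + y') (z + z') (Q w) = F.op x' y' z' w := by
        have h1 : Q w ∈ LinearMap.ker (F.op x y z) := by
          rw [← F.ann_eq e₁, ← hr]; exact ⟨w, rfl⟩
        have h2 : w - Q w ∈ LinearMap.ker (F.op x' y' z') := by
          rw [← F.ann_eq e₂, ← hk]
          have := LinearMap.congr_fun hQ w
          simp only [Module.End.mul_apply] at this
          simp [this]
        rw [LinearMap.mem_ker] at h1 h2
        rw [map_sub, sub_eq_zero] at h2
        rw [hsum, h1, zero_add, h2]
      -- An injective operator preserving the finite-dimensional `K` maps it onto itself. So `Q w`,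
      -- the unique preimage of `T₂ w ∈ K`, lies in `K`.
      have hmap : K.map (F.op (x + x') (y + y') (z + z')) = K := by
        apply Submodule.eq_of_le_of_finrank_eq
        · rintro _ ⟨k, hk, rfl⟩; exact hop _ _ _ k hk
        · exact (Submodule.equivMapOfInjective _ hinj K).finrank_eq.symm
      have : F.op x' y' z' w ∈ K.map (F.op (x + x') (y + y') (z + z')) := by
        rw [hmap]; exact hop _ _ _ w (hWK hw)
      obtain ⟨k, hk, hk'⟩ := this
      rw [← hQw] at hk'
      rwa [← hinj hk']
  · rintro ⟨w₁, h₁, w₂, h₂, w₃, h₃, w₄, h₄, rfl⟩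
    have h : ∀ T ∈ matAlgebra S, ∀ w ∈ W, T w ∈ matSpan S W := fun T hT w hw =>
      Submodule.subset_span ⟨T, hT, w, hw, rfl⟩
    exact Submodule.add_mem _ (Submodule.add_mem _ (Submodule.add_mem _ (h _ F.P_mem _ h₁)
      (h _ F.swap.P_mem _ h₂)) (h _ F.swap.r_mem _ h₃)) (h _ F.r_mem _ h₄)

end Frame

/-! ### Isotropic non-degenerate subspaces -/

variable {V : Type*} [AddCommGroup V] [Module ℂ V] [TopologicalSpace V]

/-- The orthogonal complement of a subspace with respect to all forms in `S`. -/
def perp (S : Submodule ℂ (V [⋀^Fin 2]→L[ℂ] ℂ)) (W : Submodule ℂ V) : Submodule ℂ V where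
  carrier := {v | ∀ η ∈ S, ∀ w ∈ W, η ![w, v] = 0}
  add_mem' ha hb η hη w hw := by rw [form_add_right, ha η hη w hw, hb η hη w hw, add_zero]
  zero_mem' η _ w _ := form_zero_right η w
  smul_mem' c a ha η hη w hw := by rw [form_smul_right, ha η hη w hw, mul_zero]

theorem mem_perp {S : Submodule ℂ (V [⋀^Fin 2]→L[ℂ] ℂ)} {W : Submodule ℂ V} {v : V} :
    v ∈ perp S W ↔ ∀ η ∈ S, ∀ w ∈ W, η ![w, v] = 0 := Iff.rfl

@[simp] theorem restrictForm_apply (W : Submodule ℂ V) (η : V [⋀^Fin 2]→L[ℂ] ℂ) (v w : W) :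
    restrictForm W η ![v, w] = η ![(v : V), (w : V)] := by
  change η (W.subtypeL ∘ ![v, w]) = _
  congr 1
  ext i; fin_cases i <;> rfl

theorem finrank_map_eq_iff {X Y : Type*} [AddCommGroup X] [Module ℂ X] [AddCommGroup Y]
    [Module ℂ Y] (f : X →ₗ[ℂ] Y) (S : Submodule ℂ X) (hS : Module.finrank ℂ S = 3) :
    Module.finrank ℂ (S.map f) = 3 ↔ ∀ x ∈ S, f x = 0 → x = 0 := by
  have : Module.Finite ℂ S := Module.finite_of_finrank_pos (by rw [hS]; norm_num)
  have hr : LinearMap.range (f.domRestrict S) = S.map f := LinearMap.range_domRestrict S f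
  have hrk := LinearMap.finrank_range_add_finrank_ker (f.domRestrict S)
  rw [hr, hS] at hrk
  have : (∀ x ∈ S, f x = 0 → x = 0) ↔ LinearMap.ker (f.domRestrict S) = ⊥ := by
    rw [Submodule.eq_bot_iff]
    constructor
    · rintro h ⟨x, hx⟩ h0
      exact Subtype.ext (h x hx h0)
    · intro h x hx h0
      exact congrArg Subtype.val (h ⟨x, hx⟩ h0)
  rw [this, ← Submodule.finrank_eq_zero]
  omega

theorem finrank_restrictForms_iff {S : Submodule ℂ (V [⋀^Fin 2]→L[ℂ] ℂ)} {W : Submodule ℂ V}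
    (hS : Module.finrank ℂ S = 3) :
    Module.finrank ℂ (restrictForms S W) = 3 ↔
      ∀ η ∈ S, (∀ v ∈ W, ∀ w ∈ W, η ![v, w] = 0) → η = 0 := by
  refine (finrank_map_eq_iff (restrictForm W) S hS).trans ?_
  refine forall₂_congr fun η _ => imp_congr ⟨fun h v hv w hw => ?_, fun h => ?_⟩ Iff.rfl
  · rw [← restrictForm_apply W η ⟨v, hv⟩ ⟨w, hw⟩, h]; rfl
  · exact form_ext fun v w => by rw [restrictForm_apply]; exact h _ v.2 _ w.2

variable [FiniteDimensional ℂ V]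

/-- Without a frame `H` has no generators, so `H · W = 0` and every form restricts to zero there,
against dimension 3. -/
theorem exists_frame_of_matSpan {S : Submodule ℂ (V [⋀^Fin 2]→L[ℂ] ℂ)}
    (hS : IsTrisymplecticSpace S) {W : Submodule ℂ V}
    (hW : IsTrisymplecticSpace (restrictForms S (matSpan S W))) : Nonempty (Frame S) := by
  by_contra hcon
  have hbot : matAlgebra S = ⊥ := by
    rw [matAlgebra, Submodule.span_eq_bot]
    rintro P ⟨η₁, h₁, η₂, h₂, hd₁, hd₂, hli, hP, hr, hk⟩
    exact (hcon (exists_frame hS h₁ h₂ hd₁ hd₂ hli hP hr hk)).elim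
  have hspan : ∀ v ∈ matSpan S W, v = 0 := by
    intro v hv
    have : matSpan S W = ⊥ := by
      rw [matSpan, Submodule.span_eq_bot]
      rintro _ ⟨h, hh, w, -, rfl⟩
      rw [hbot, Submodule.mem_bot] at hh
      rw [hh]; rfl
    rwa [this, Submodule.mem_bot] at hv
  have h0 := (finrank_restrictForms_iff hS.finrank_eq).1 hW.finrank_eq
  have : S = ⊥ := (Submodule.eq_bot_iff _).2 fun η hη => h0 η hη fun v hv w hw => by
    rw [hspan v hv, form_zero_left]
  have h3 := hS.finrank_eq
  rw [this] at h3
  simp at h3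

namespace Frame

variable {S : Submodule ℂ (V [⋀^Fin 2]→L[ℂ] ℂ)} (F : Frame S) {W : Submodule ℂ V}

include F in
theorem le_matSpan : W ≤ matSpan S W := fun w hw => (F.mem_matSpan W w).2
  ⟨w, hw, w, hw, 0, W.zero_mem, 0, W.zero_mem, by simp⟩

theorem op_mem_matSpan (x y z : ℂ) {v : V} (hv : v ∈ matSpan S W) :
    F.op x y z v ∈ matSpan S W := by
  obtain ⟨w₁, h₁, w₂, h₂, w₃, h₃, w₄, h₄, rfl⟩ := (F.mem_matSpan W v).1 hv
  refine (F.mem_matSpan W _).2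
    ⟨x • w₁ + (z * F.b) • w₄, W.add_mem (W.smul_mem _ h₁) (W.smul_mem _ h₄),
    y • w₂ + (z * F.b) • w₃, W.add_mem (W.smul_mem _ h₂) (W.smul_mem _ h₃),
    x • w₃ + z • w₂, W.add_mem (W.smul_mem _ h₃) (W.smul_mem _ h₂),
    y • w₄ + z • w₁, W.add_mem (W.smul_mem _ h₄) (W.smul_mem _ h₁), ?_⟩
  simp only [op_apply, map_add, map_sub, map_smul, F.P_P, F.P_q, F.q_P, F.P_r, F.r_P, F.q_r,
    F.r_q, F.q_q, F.r_r]
  module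

/-- Some form in `S` is non-degenerate on `H · W`. Its operator is self-adjoint and preserves `H ·
W`, so a vector `κ`-orthogonal to `H · W` is in the radical of that form. -/
theorem κ_nondeg_matSpan (hW : IsTrisymplecticSpace (restrictForms S (matSpan S W))) {v : V}
    (hv : v ∈ matSpan S W) (h : ∀ w ∈ matSpan S W, F.κ ![v, w] = 0) : v = 0 := by
  obtain ⟨_, ⟨η, hη, rfl⟩, hnd⟩ := hW.exists_nondegenerate
  rw [not_isDegenerate_iff] at hnd
  obtain ⟨x, y, z, e⟩ := F.exists_repr η hη
  have := hnd ⟨v, hv⟩ fun w => by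
    rw [restrictForm_apply, e]
    exact (F.adj_op x y z v w).trans (h _ (F.op_mem_matSpan x y z w.2))
  exact congrArg Subtype.val this

section Isotropic

variable (hnd : ∀ v ∈ matSpan S W, (∀ w ∈ matSpan S W, F.κ ![v, w] = 0) → v = 0)
  (hiso : ∀ η ∈ S, ∀ w ∈ W, ∀ w' ∈ W, η ![w, w'] = 0)

include hiso in
omit [FiniteDimensional ℂ V] in
theorem op_isotropic (x y z : ℂ) {w w' : V} (hw : w ∈ W) (hw' : w' ∈ W) :
    F.κ ![F.op x y z w, w'] = 0 := by
  obtain ⟨η, hη, e⟩ := F.exists_form x y z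
  exact (e w w').symm.trans (hiso η hη w hw w' hw')

include hiso in
omit [FiniteDimensional ℂ V] in
theorem P_isotropic {w w' : V} (hw : w ∈ W) (hw' : w' ∈ W) : F.κ ![F.P w, w'] = 0 := by
  simpa [op_apply] using F.op_isotropic hiso 1 0 0 hw hw'

include hiso in
omit [FiniteDimensional ℂ V] in
theorem κ_isotropic {w w' : V} (hw : w ∈ W) (hw' : w' ∈ W) : F.κ ![w, w'] = 0 := by
  simpa [op_apply] using F.op_isotropic hiso 1 1 0 hw hw'

include hiso in
omit [FiniteDimensional ℂ V] in
theorem qr_isotropic {w w' : V} (hw : w ∈ W) (hw' : w' ∈ W) :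
    F.κ ![F.q w, w'] + F.κ ![F.r w, w'] = 0 := by
  rw [← form_add_left]
  simpa [op_apply] using F.op_isotropic hiso 0 0 1 hw hw'

-- By adjointness, pairing `v` with the four blocks applied to vectors of `W` moves the blocks onto
-- `v`, with `q` and `r` exchanged.
include hnd in
theorem eq_zero_of_orthogonal {v : V} (hv : v ∈ matSpan S W) (h₁ : ∀ w ∈ W, F.κ ![F.P v, w] = 0)
    (h₂ : ∀ w ∈ W, F.κ ![v - F.P v, w] = 0) (h₃ : ∀ w ∈ W, F.κ ![F.q v, w] = 0)
    (h₄ : ∀ w ∈ W, F.κ ![F.r v, w] = 0) : v = 0 := by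
  refine hnd v hv fun w hw => ?_
  obtain ⟨w₁, m₁, w₂, m₂, w₃, m₃, w₄, m₄, rfl⟩ := (F.mem_matSpan W w).1 hw
  rw [form_add_right, form_add_right, form_add_right, ← F.adj_P, h₁ _ m₁, form_sub_right,
    ← F.adj_P, ← form_sub_left, h₂ _ m₂, ← F.adj_q, h₃ _ m₄, ← F.adj_r, h₄ _ m₃]
  simp

-- Here `r w = r P w = 0`, and isotropy for `q + r` then makes `q w` orthogonal to `W` too, so all
-- four pairings vanish.
include hnd hiso in
theorem eq_zero_of_P_eq_zero {w : V} (hw : w ∈ W) (h : F.P w = 0) : w = 0 := by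
  have hr : F.r w = 0 := by rw [← F.r_P, h, map_zero]
  refine F.eq_zero_of_orthogonal hnd (F.le_matSpan hw) ?_ ?_ ?_ ?_
  · intro u hu; rw [h, form_zero_left]
  · intro u hu; rw [h, sub_zero]; exact F.κ_isotropic hiso hw hu
  · intro u hu
    have := F.qr_isotropic hiso hw hu
    rwa [hr, form_zero_left, add_zero] at this
  · intro u hu; rw [hr, form_zero_left]

-- The vector `w - P w` is killed by `P`, `q` and `r` and is orthogonal to `W` by isotropy. So it is
-- zero, and `eq_zero_of_P_eq_zero` applies in the swapped frame.
include hnd hiso in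
theorem eq_zero_of_q_eq_zero {w : V} (hw : w ∈ W) (h : F.q w = 0) : w = 0 := by
  refine F.swap.eq_zero_of_P_eq_zero hnd hiso hw ?_
  change w - F.P w = 0
  refine F.eq_zero_of_orthogonal hnd
    ((F.mem_matSpan W _).2 ⟨0, W.zero_mem, w, hw, 0, W.zero_mem, 0, W.zero_mem, by simp⟩) ?_ ?_ ?_ ?_
  · intro u hu; rw [map_sub, F.P_P, sub_self, form_zero_left]
  · intro u hu
    rw [map_sub, F.P_P, sub_self, sub_zero, form_sub_left, F.κ_isotropic hiso hw hu,
      F.P_isotropic hiso hw hu, sub_zero]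
  · intro u hu; rw [map_sub, F.q_P, h, sub_zero, form_zero_left]
  · intro u hu; rw [map_sub, F.r_P, sub_self, form_zero_left]

-- The only pairing of `P w = -q u` that is not immediate is the one through `r`. Since `r q u = b
-- (u - P u)`, it reduces to isotropy of `u`.
include hnd hiso in
theorem eq_zero_of_P_add_q {w u : V} (hw : w ∈ W) (hu : u ∈ W) (h : F.P w + F.q u = 0) :
    w = 0 ∧ u = 0 := by
  have hP : F.P w = 0 := by
    refine F.eq_zero_of_orthogonal hnd
      ((F.mem_matSpan W _).2 ⟨w, hw, 0, W.zero_mem, 0, W.zero_mem, 0, W.zero_mem, by simp⟩)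
      ?_ ?_ ?_ ?_
    · intro u hu; rw [F.P_P]; exact F.P_isotropic hiso hw hu
    · intro u hu; rw [F.P_P, sub_self, form_zero_left]
    · intro u hu; rw [F.q_P, form_zero_left]
    · intro u' hu'
      rw [eq_neg_of_add_eq_zero_left h, map_neg, F.r_q, ← neg_one_smul ℂ, form_smul_left,
        form_smul_left, form_sub_left, F.κ_isotropic hiso hu hu', F.P_isotropic hiso hu hu']
      simp
  refine ⟨F.eq_zero_of_P_eq_zero hnd hiso hw hP, F.eq_zero_of_q_eq_zero hnd hiso hu ?_⟩
  rwa [hP, zero_add] at h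

-- Applying `P` separates the relation into the range and the kernel of `P`. The second half is the
-- first half in the swapped frame.
include hnd hiso in
theorem eq_zero_of_sum {w₁ w₂ w₃ w₄ : V} (h₁ : w₁ ∈ W) (h₂ : w₂ ∈ W) (h₃ : w₃ ∈ W) (h₄ : w₄ ∈ W)
    (h : F.P w₁ + (w₂ - F.P w₂) + F.q w₃ + F.r w₄ = 0) : w₁ = 0 ∧ w₂ = 0 ∧ w₃ = 0 ∧ w₄ = 0 := by
  have hP : F.P w₁ + F.q w₃ = 0 := by
    have := congrArg F.P h
    simpa [F.P_P, F.P_q, F.P_r] using this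
  have a := F.eq_zero_of_P_add_q hnd hiso h₁ h₃ hP
  have hP' : (w₂ - F.P w₂) + F.r w₄ = 0 := by simpa [a.1, a.2] using h
  have b := F.swap.eq_zero_of_P_add_q hnd hiso h₂ h₄ hP'
  exact ⟨a.1, b.1, a.2, b.2⟩

include hnd hiso in
theorem finrank_matSpan : Module.finrank ℂ (matSpan S W) = 4 * Module.finrank ℂ W := by
  let f : (W × W) × (W × W) →ₗ[ℂ] V :=
    LinearMap.coprod (LinearMap.coprod (F.P ∘ₗ W.subtype) ((1 - F.P) ∘ₗ W.subtype))
      (LinearMap.coprod (F.q ∘ₗ W.subtype) (F.r ∘ₗ W.subtype))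
  have hf : ∀ p, f p = F.P p.1.1 + (p.1.2 - F.P p.1.2) + F.q p.2.1 + F.r p.2.2 := by
    intro p; simp [f, add_assoc]
  have hinj : Function.Injective f := by
    rw [← LinearMap.ker_eq_bot, Submodule.eq_bot_iff]
    rintro ⟨⟨w₁, w₂⟩, w₃, w₄⟩ h
    rw [LinearMap.mem_ker, hf] at h
    have := F.eq_zero_of_sum hnd hiso w₁.2 w₂.2 w₃.2 w₄.2 h
    ext <;> simp [this]
  have hr : LinearMap.range f = matSpan S W := by
    ext v
    rw [F.mem_matSpan]
    constructor
    · rintro ⟨p, rfl⟩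
      exact ⟨_, p.1.1.2, _, p.1.2.2, _, p.2.1.2, _, p.2.2.2, hf p⟩
    · rintro ⟨w₁, h₁, w₂, h₂, w₃, h₃, w₄, h₄, rfl⟩
      exact ⟨⟨⟨⟨w₁, h₁⟩, ⟨w₂, h₂⟩⟩, ⟨w₃, h₃⟩, ⟨w₄, h₄⟩⟩, hf _⟩
  rw [← hr, LinearMap.finrank_range_of_inj hinj]
  simp only [Module.finrank_prod]
  ring

omit [FiniteDimensional ℂ V] in
theorem ker_bil_κ : LinearMap.ker (bil F.κ) = ⊥ := by
  rw [ker_bil, Submodule.eq_bot_iff]; exact F.nondeg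

theorem finrank_orthogonal (K : Submodule ℂ V) :
    Module.finrank ℂ K + Module.finrank ℂ (LinearMap.BilinForm.orthogonal (bil F.κ) K) =
      Module.finrank ℂ V := by
  have h := LinearMap.BilinForm.finrank_add_finrank_orthogonal' (B := bil F.κ) K
  rwa [F.ker_bil_κ, inf_bot_eq, finrank_bot, add_zero] at h

-- The three families `P w`, `w - P w`, `(q + r) w` span the images of `W` under all operators of
-- `S`, so `perp S W` is the `κ`-orthogonal of their span. They are independent by the case `w₃ =
-- w₄` of `eq_zero_of_sum`.
include F hnd hiso in
theorem finrank_perp :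
    Module.finrank ℂ (perp S W) + 3 * Module.finrank ℂ W = Module.finrank ℂ V := by
  let f : W × W × W →ₗ[ℂ] V :=
    LinearMap.coprod (F.P ∘ₗ W.subtype) (LinearMap.coprod ((1 - F.P) ∘ₗ W.subtype)
      ((F.q + F.r) ∘ₗ W.subtype))
  have hf : ∀ p, f p = F.P p.1 + (p.2.1 - F.P p.2.1) + F.q p.2.2 + F.r p.2.2 := by
    intro p; simp [f, add_assoc]
  have hinj : Function.Injective f := by
    rw [← LinearMap.ker_eq_bot, Submodule.eq_bot_iff]
    rintro ⟨w₁, w₂, w₃⟩ h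
    rw [LinearMap.mem_ker, hf] at h
    have := F.eq_zero_of_sum hnd hiso w₁.2 w₂.2 w₃.2 w₃.2 h
    ext <;> simp [this]
  have hperp : perp S W = LinearMap.BilinForm.orthogonal (bil F.κ) (LinearMap.range f) := by
    ext v
    rw [mem_perp, LinearMap.BilinForm.mem_orthogonal_iff]
    constructor
    · rintro h _ ⟨p, rfl⟩
      change F.κ ![f p, v] = 0
      have key : ∀ x y z : ℂ, ∀ w ∈ W, F.κ ![F.op x y z w, v] = 0 := by
        intro x y z w hw
        obtain ⟨η, hη, e⟩ := F.exists_form x y z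
        exact (e w v).symm.trans (h η hη w hw)
      have e : f p = F.op 1 0 0 p.1 + F.op 0 1 0 p.2.1 + F.op 0 0 1 p.2.2 := by
        rw [hf]; simp only [op_apply]; module
      rw [e, form_add_left, form_add_left, key _ _ _ _ p.1.2, key _ _ _ _ p.2.1.2,
        key _ _ _ _ p.2.2.2]; simp
    · intro h η hη w hw
      obtain ⟨x, y, z, e⟩ := F.exists_repr η hη
      have := h (f (x • ⟨w, hw⟩, y • ⟨w, hw⟩, z • ⟨w, hw⟩)) ⟨_, rfl⟩
      rw [e]
      refine Eq.trans ?_ this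
      change _ = F.κ ![_, v]
      congr 2
      rw [hf]
      change F.op x y z w = _
      simp only [op_apply, Submodule.coe_smul, map_smul]; module
  have := F.finrank_orthogonal (LinearMap.range f)
  rw [← hperp, LinearMap.finrank_range_of_inj hinj] at this
  simp only [Module.finrank_prod] at this
  omega

end Isotropic

/-- A non-zero degenerate form is degenerate on `H · W`. -/
theorem exists_mem_ker_matSpan (hS : IsTrisymplecticSpace S)
    (hW : IsTrisymplecticSpace (restrictForms S (matSpan S W)))
    {η : V [⋀^Fin 2]→L[ℂ] ℂ} (hη : η ∈ S) (h0 : η ≠ 0) {x y z : ℂ}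
    (e : ∀ v w, η ![v, w] = F.κ ![F.op x y z v, w]) {v : V} (hv : v ≠ 0)
    (hker : F.op x y z v = 0) : ∃ k ∈ matSpan S W, k ≠ 0 ∧ F.op x y z k = 0 := by
  by_contra! hcon
  -- A non-zero vector in the kernel makes the determinant vanish, so the operator `T` satisfies `T²
  -- = (x + y) T`.
  have hN : x * y - F.b * z ^ 2 = 0 := by
    have := F.op_op x y z v
    rw [hker, map_zero, smul_zero, zero_sub, eq_comm, neg_eq_zero] at this
    exact (smul_eq_zero.1 this).resolve_right hv
  -- `T` kills `T k - (x + y) k`. If `T` had no kernel in `H · W`, it would be the scalar `x + y`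
  -- there.
  have hscal : ∀ k ∈ matSpan S W, F.op x y z k = (x + y) • k := by
    intro k hk
    rw [← sub_eq_zero]
    by_contra hne
    refine hcon _ (Submodule.sub_mem _ (F.op_mem_matSpan x y z hk) (Submodule.smul_mem _ _ hk))
      hne ?_
    rw [map_sub, map_smul, F.op_op, hN, zero_smul, sub_zero, sub_self]
  have hinj := (finrank_restrictForms_iff hS.finrank_eq).1 hW.finrank_eq
  obtain ⟨κ', hκ', eκ⟩ := F.exists_form 1 1 0
  have eκ' : ∀ v w, κ' ![v, w] = F.κ ![v, w] := fun v w => (eκ v w).trans <| by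
    congr 2; change F.op 1 1 0 v = v; simp [op_apply]
  -- Restriction to `H · W` is injective on `S`, so `η = (x + y) κ` on all of `V`; the kernel vector
  -- `v` then gives `x + y = 0`.
  have hz := hinj (η - (x + y) • κ') (S.sub_mem hη (S.smul_mem _ hκ')) fun k hk w hw => by
    change η ![k, w] - (x + y) * κ' ![k, w] = 0
    rw [e, hscal k hk, form_smul_left, eκ', sub_self]
  have hz' : ∀ w, F.κ ![(x + y) • v, w] = 0 := fun w => by
    have h1 : η ![v, w] - (x + y) * κ' ![v, w] = 0 := by
      change (η - (x + y) • κ') ![v, w] = 0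
      rw [hz]; rfl
    rw [e, hker, form_zero_left, zero_sub, neg_eq_zero, eκ'] at h1
    rwa [form_smul_left]
  have hxy : x + y = 0 := (smul_eq_zero.1 (F.nondeg _ hz')).resolve_right hv
  apply h0
  rw [sub_eq_zero] at hz
  rw [hz, hxy]
  exact form_ext fun v w => by simp

end Frame

/-! ### Linear reduction -/

theorem IsTrisymplecticSpace.of_equiv {U V : Type*} [AddCommGroup U] [Module ℂ U]
    [TopologicalSpace U] [AddCommGroup V] [Module ℂ V] [TopologicalSpace V]
    [FiniteDimensional ℂ U] [FiniteDimensional ℂ V] (φ : U ≃ₗ[ℂ] V)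
    {S : Submodule ℂ (U [⋀^Fin 2]→L[ℂ] ℂ)} {S' : Submodule ℂ (V [⋀^Fin 2]→L[ℂ] ℂ)}
    (hS : IsTrisymplecticSpace S)
    (h : ∀ η ∈ S, ∃ η' ∈ S', ∀ u v, η' ![φ u, φ v] = η ![u, v])
    (h' : ∀ η' ∈ S', ∃ η ∈ S, ∀ u v, η' ![φ u, φ v] = η ![u, v]) :
    IsTrisymplecticSpace S' := by
  have hann : ∀ {η : U [⋀^Fin 2]→L[ℂ] ℂ} {η' : V [⋀^Fin 2]→L[ℂ] ℂ},
      (∀ u v, η' ![φ u, φ v] = η ![u, v]) → ann η' = (ann η).map (φ : U →ₗ[ℂ] V) := by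
    intro η η' e
    ext v
    simp only [Submodule.mem_map, mem_ann]
    constructor
    · intro hv
      refine ⟨φ.symm v, fun w => ?_, by simp⟩
      rw [← e, φ.apply_symm_apply]; exact hv _
    · rintro ⟨u, hu, rfl⟩ w
      obtain ⟨w, rfl⟩ := φ.surjective w
      exact (e u w).trans (hu w)
  have hdeg : ∀ {η : U [⋀^Fin 2]→L[ℂ] ℂ} {η' : V [⋀^Fin 2]→L[ℂ] ℂ},
      (∀ u v, η' ![φ u, φ v] = η ![u, v]) → (IsDegenerate η' ↔ IsDegenerate η) := by
    intro η η' e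
    rw [IsDegenerate, IsDegenerate, hann e, Ne, Ne, Submodule.map_eq_bot_iff]
  have hzero : ∀ {η : U [⋀^Fin 2]→L[ℂ] ℂ} {η' : V [⋀^Fin 2]→L[ℂ] ℂ},
      (∀ u v, η' ![φ u, φ v] = η ![u, v]) → η = 0 → η' = 0 := by
    rintro η η' e rfl
    refine form_ext fun v w => ?_
    obtain ⟨v, rfl⟩ := φ.surjective v
    obtain ⟨w, rfl⟩ := φ.surjective w
    rw [e]; rfl
  refine ⟨?_, ?_, ?_⟩
  · choose! g hg hge using h
    let G : S →ₗ[ℂ] S' :=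
      { toFun := fun η => ⟨g η, hg η η.2⟩
        map_add' := fun a b => Subtype.ext <| form_ext fun v w => by
          obtain ⟨v, rfl⟩ := φ.surjective v
          obtain ⟨w, rfl⟩ := φ.surjective w
          change g (a + b : S) ![φ v, φ w] = g a ![φ v, φ w] + g b ![φ v, φ w]
          rw [hge _ (a + b).2, hge _ a.2, hge _ b.2]; rfl
        map_smul' := fun c a => Subtype.ext <| form_ext fun v w => by
          obtain ⟨v, rfl⟩ := φ.surjective v
          obtain ⟨w, rfl⟩ := φ.surjective w
          change g (c • a : S) ![φ v, φ w] = c * g a ![φ v, φ w]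
          rw [hge _ (c • a).2, hge _ a.2]; rfl }
    have hG : Function.Bijective G := by
      constructor
      · intro a b hab
        refine Subtype.ext <| form_ext fun u v => ?_
        rw [← hge _ a.2, ← hge _ b.2]
        exact congrArg (fun t : S' => (t : V [⋀^Fin 2]→L[ℂ] ℂ) ![φ u, φ v]) hab
      · rintro ⟨η', hη'⟩
        obtain ⟨η, hη, e⟩ := h' η' hη'
        refine ⟨⟨η, hη⟩, Subtype.ext <| form_ext fun v w => ?_⟩
        obtain ⟨v, rfl⟩ := φ.surjective v
        obtain ⟨w, rfl⟩ := φ.surjective w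
        exact (hge η hη v w).trans (e v w).symm
    rw [← (LinearEquiv.ofBijective G hG).finrank_eq, hS.finrank_eq]
  · obtain ⟨η, hη, hnd⟩ := hS.exists_nondegenerate
    obtain ⟨η', hη', e⟩ := h η hη
    exact ⟨η', hη', fun hd => hnd ((hdeg e).1 hd)⟩
  · intro η' hη' h0 hd
    obtain ⟨η, hη, e⟩ := h' η' hη'
    have := (two_mul_finrank_ann_iff η).1 (hS.rank_eq η hη (fun h => h0 (hzero e h))
      ((hdeg e).1 hd))
    rw [two_mul_finrank_ann_iff, hann e, ← φ.finrank_eq, ← this]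
    congr 1
    exact LinearEquiv.finrank_map_eq φ (ann η)

variable {V : Type*} [AddCommGroup V] [Module ℂ V] [TopologicalSpace V] [FiniteDimensional ℂ V]
  {S : Submodule ℂ (V [⋀^Fin 2]→L[ℂ] ℂ)} {W : Submodule ℂ V}

omit [FiniteDimensional ℂ V] in
theorem perp_bot : perp S (⊥ : Submodule ℂ V) = ⊤ := by
  rw [eq_top_iff]
  intro v _ η _ w hw
  rw [(Submodule.mem_bot ℂ).1 hw, form_zero_left]

theorem finrank_perp (hS : IsTrisymplecticSpace S) (hW : IsNondegenerateSubspace S W)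
    (hiso : ∀ η ∈ S, ∀ w ∈ W, ∀ w' ∈ W, η ![w, w'] = 0) :
    Module.finrank ℂ (perp S W) + 3 * Module.finrank ℂ W = Module.finrank ℂ V := by
  rcases hW with rfl | hW
  · rw [perp_bot]; simp
  · obtain ⟨F⟩ := exists_frame_of_matSpan hS hW
    exact F.finrank_perp (fun v hv h => F.κ_nondeg_matSpan hW hv h) hiso

omit [FiniteDimensional ℂ V] in
theorem finrank_ann_restrictForm (K : Submodule ℂ V) (η : V [⋀^Fin 2]→L[ℂ] ℂ)
    {T : Module.End ℂ V} (h : ∀ v ∈ K, (∀ w ∈ K, η ![v, w] = 0) ↔ T v = 0) :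
    Module.finrank ℂ (ann (restrictForm K η)) =
      Module.finrank ℂ (LinearMap.ker T ⊓ K : Submodule ℂ V) := by
  have : (ann (restrictForm K η)).map K.subtype = LinearMap.ker T ⊓ K := by
    ext v
    simp only [Submodule.mem_map, Submodule.mem_inf, LinearMap.mem_ker, mem_ann]
    constructor
    · rintro ⟨u, hu, rfl⟩
      refine ⟨(h _ u.2).1 fun w hw => ?_, u.2⟩
      have := hu ⟨w, hw⟩
      rwa [restrictForm_apply] at this
    · rintro ⟨hv, hK⟩
      refine ⟨⟨v, hK⟩, fun w => ?_, rfl⟩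
      rw [restrictForm_apply]
      exact (h v hK).2 hv _ w.2
  rw [← this]
  exact (Submodule.equivMapOfInjective _ K.injective_subtype _).finrank_eq

/-- Linear reduction: `W` has a complement in its orthogonal complement which is a trisymplectic
space. -/
theorem exists_reduced_complement (hS : IsTrisymplecticSpace S)
    (hW : IsNondegenerateSubspace S W)
    (hiso : ∀ η ∈ S, ∀ w ∈ W, ∀ w' ∈ W, η ![w, w'] = 0)
    (hdim : 4 * Module.finrank ℂ W < Module.finrank ℂ V) :
    ∃ U : Submodule ℂ V, U ⊔ W = perp S W ∧ U ⊓ W = ⊥ ∧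
      IsTrisymplecticSpace (restrictForms S U) := by
  rcases hW with rfl | hW
  · refine ⟨⊤, by rw [perp_bot]; simp, by simp, ?_⟩
    refine hS.of_equiv (Submodule.topEquiv (R := ℂ) (M := V)).symm ?_ ?_
    · intro η hη
      exact ⟨_, ⟨η, hη, rfl⟩, fun u v => restrictForm_apply _ _ _ _⟩
    · rintro _ ⟨η, hη, rfl⟩
      exact ⟨η, hη, fun u v => restrictForm_apply _ _ _ _⟩
  obtain ⟨F⟩ := exists_frame_of_matSpan hS hW
  set K := matSpan S W with hK
  have hnd : ∀ v ∈ K, (∀ w ∈ K, F.κ ![v, w] = 0) → v = 0 :=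
    fun v hv h => F.κ_nondeg_matSpan hW hv h
  -- The complement of `W` in `perp S W` is the `κ`-orthogonal of `H · W`: self-adjointness makes it
  -- stable under all operators, and `V = K ⊕ U`.
  set U : Submodule ℂ V := LinearMap.BilinForm.orthogonal (bil F.κ) K with hU
  have memU : ∀ {v}, v ∈ U ↔ ∀ k ∈ K, F.κ ![k, v] = 0 := fun {v} => by
    rw [hU, LinearMap.BilinForm.mem_orthogonal_iff]; rfl
  have hopU : ∀ x y z : ℂ, ∀ v ∈ U, F.op x y z v ∈ U := fun x y z v hv => memU.2 fun k hk => by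
    rw [← F.adj_op]; exact memU.1 hv _ (F.op_mem_matSpan x y z hk)
  have hKU : K ⊓ U = ⊥ := (Submodule.eq_bot_iff _).2 fun v hv => hnd v hv.1 fun w hw => by
    rw [form_swap, memU.1 hv.2 w hw, neg_zero]
  have hfK : Module.finrank ℂ K = 4 * Module.finrank ℂ W := F.finrank_matSpan hnd hiso
  have hfU : Module.finrank ℂ K + Module.finrank ℂ U = Module.finrank ℂ V := F.finrank_orthogonal K
  have hfp := F.finrank_perp hnd hiso
  have htop : K ⊔ U = ⊤ := by
    apply Submodule.eq_top_of_finrank_eq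
    have := Submodule.finrank_sup_add_finrank_inf_eq K U
    rw [hKU, finrank_bot] at this
    omega
  have hndU : ∀ v ∈ U, (∀ w ∈ U, F.κ ![v, w] = 0) → v = 0 := fun v hv h => F.nondeg v fun w => by
    have hw : w ∈ K ⊔ U := htop ▸ Submodule.mem_top
    obtain ⟨k, hk, u, hu, rfl⟩ := Submodule.mem_sup.1 hw
    rw [form_add_right, h u hu, form_swap, memU.1 hv k hk]; simp
  have hUW : U ⊓ W = ⊥ := by
    rw [eq_bot_iff, ← hKU]
    exact fun v hv => ⟨F.le_matSpan hv.2, hv.1⟩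
  have hUp : U ≤ perp S W := by
    intro v hv η hη w hw
    obtain ⟨x, y, z, e⟩ := F.exists_repr η hη
    exact (e w v).trans (memU.1 hv _ (F.op_mem_matSpan x y z (F.le_matSpan hw)))
  have hsup : U ⊔ W = perp S W := by
    apply Submodule.eq_of_le_of_finrank_eq
    · exact sup_le hUp fun w hw η hη w' hw' => hiso η hη w' hw' w hw
    · have := Submodule.finrank_sup_add_finrank_inf_eq U W
      rw [hUW, finrank_bot] at this
      omega
  refine ⟨U, hsup, hUW, ?_⟩
  -- As `κ` is non-degenerate on `K` and the operators preserve `K`, the radical of a restricted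
  -- form is the kernel of its operator in `K`. The same holds for `U` below.
  have radK : ∀ {η : V [⋀^Fin 2]→L[ℂ] ℂ} {x y z : ℂ},
      (∀ v w, η ![v, w] = F.κ ![F.op x y z v, w]) →
      ∀ v ∈ K, (∀ w ∈ K, η ![v, w] = 0) ↔ F.op x y z v = 0 := by
    intro η x y z e v hv
    refine ⟨fun h => hnd _ (F.op_mem_matSpan x y z hv) fun w hw => ?_, fun h w _ => ?_⟩
    · rw [← e]; exact h w hw
    · rw [e, h, form_zero_left]
  have radU : ∀ {η : V [⋀^Fin 2]→L[ℂ] ℂ} {x y z : ℂ},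
      (∀ v w, η ![v, w] = F.κ ![F.op x y z v, w]) →
      ∀ v ∈ U, (∀ w ∈ U, η ![v, w] = 0) ↔ F.op x y z v = 0 := by
    intro η x y z e v hv
    refine ⟨fun h => hndU _ (hopU x y z v hv) fun w hw => ?_, fun h w _ => ?_⟩
    · rw [← e]; exact h w hw
    · rw [e, h, form_zero_left]
  have key : ∀ η ∈ S, η ≠ 0 → (∃ v ∈ U, v ≠ 0 ∧ ∀ w ∈ U, η ![v, w] = 0) →
      2 * Module.finrank ℂ (ann (restrictForm U η)) = Module.finrank ℂ U := by
    rintro η hη h0 ⟨v, hvU, hv0, hv⟩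
    obtain ⟨x, y, z, e⟩ := F.exists_repr η hη
    have e : ∀ v w, η ![v, w] = F.κ ![F.op x y z v, w] := e
    have hkv : F.op x y z v = 0 := (radU e v hvU).1 hv
    have h1 : 2 * Module.finrank ℂ (ann η) = Module.finrank ℂ V := by
      rw [← two_mul_finrank_ann_iff]
      refine hS.rank_eq η hη h0 fun hbot => hv0 ?_
      have : v ∈ ann η := by rw [F.ann_eq e]; exact hkv
      rwa [hbot, Submodule.mem_bot] at this
    have h2 : 2 * Module.finrank ℂ (ann (restrictForm K η)) = Module.finrank ℂ K := by
      rw [← two_mul_finrank_ann_iff]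
      obtain ⟨k, hk, hk0, hker⟩ := F.exists_mem_ker_matSpan hS hW hη h0 e hv0 hkv
      refine hW.rank_eq _ ⟨η, hη, rfl⟩ ?_ fun hbot => hk0 ?_
      · intro hz
        apply h0
        refine (finrank_restrictForms_iff hS.finrank_eq).1 hW.finrank_eq η hη fun a ha b hb => ?_
        rw [← restrictForm_apply K η ⟨a, ha⟩ ⟨b, hb⟩, hz]; rfl
      · have : (⟨k, hk⟩ : K) ∈ ann (restrictForm K η) := fun w => by
          rw [restrictForm_apply]; exact (radK e k hk).2 hker _ w.2
        rw [hbot, Submodule.mem_bot] at this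
        exact congrArg Subtype.val this
    rw [F.ann_eq e] at h1
    rw [finrank_ann_restrictForm K η (radK e)] at h2
    rw [finrank_ann_restrictForm U η (radU e)]
    -- The operator preserves both summands of `V = K ⊕ U`, so its kernel is the sum of its kernels
    -- there. Half-dimensionality in `V` and in `K` then leaves half of `U`.
    have hsplit : (LinearMap.ker (F.op x y z) ⊓ K) ⊔ (LinearMap.ker (F.op x y z) ⊓ U) =
        LinearMap.ker (F.op x y z) := by
      apply le_antisymm (sup_le inf_le_left inf_le_left)
      intro t ht
      have htt : t ∈ K ⊔ U := htop ▸ Submodule.mem_top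
      obtain ⟨k, hk, u, hu, rfl⟩ := Submodule.mem_sup.1 htt
      rw [LinearMap.mem_ker, map_add] at ht
      have hk0 : F.op x y z k = 0 := by
        have : F.op x y z k ∈ K ⊓ U := ⟨F.op_mem_matSpan x y z hk, by
          rw [eq_neg_of_add_eq_zero_left ht]; exact U.neg_mem (hopU x y z u hu)⟩
        rwa [hKU, Submodule.mem_bot] at this
      have hu0 : F.op x y z u = 0 := by rwa [hk0, zero_add] at ht
      exact Submodule.add_mem_sup ⟨hk0, hk⟩ ⟨hu0, hu⟩
    have hinf : (LinearMap.ker (F.op x y z) ⊓ K) ⊓ (LinearMap.ker (F.op x y z) ⊓ U) = ⊥ := by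
      rw [eq_bot_iff, ← hKU]
      exact fun t ht => ⟨ht.1.2, ht.2.2⟩
    have h3 := Submodule.finrank_sup_add_finrank_inf_eq (LinearMap.ker (F.op x y z) ⊓ K)
      (LinearMap.ker (F.op x y z) ⊓ U)
    rw [hsplit, hinf, finrank_bot] at h3
    omega
  refine ⟨?_, ?_, ?_⟩
  · rw [finrank_restrictForms_iff hS.finrank_eq]
    intro η hη hz
    by_contra h0
    -- This is where the strict inequality enters. On a non-zero `U`, a form that vanishes
    -- identically would have a radical of dimension both `dim U` and `dim U / 2`.
    have hUpos : 0 < Module.finrank ℂ U := by omega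
    obtain ⟨v, hv⟩ := (Module.finrank_pos_iff_exists_ne_zero (R := ℂ)).1 hUpos
    have h1 := key η hη h0 ⟨v, v.2, fun h => hv (Subtype.ext h), hz v v.2⟩
    have : ann (restrictForm U η) = ⊤ := by
      rw [eq_top_iff]
      intro u _ w
      rw [restrictForm_apply]; exact hz _ u.2 _ w.2
    rw [this, finrank_top] at h1
    omega
  · obtain ⟨κ', hκ', eκ⟩ := F.exists_form 1 1 0
    refine ⟨_, ⟨κ', hκ', rfl⟩, not_isDegenerate_iff.2 fun v hv => Subtype.ext ?_⟩
    refine hndU v v.2 fun w hw => ?_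
    have := hv ⟨w, hw⟩
    rw [restrictForm_apply, eκ] at this
    refine Eq.trans ?_ this
    congr 2
    change (v : V) = F.op 1 1 0 v
    simp [Frame.op_apply]
  · rintro _ ⟨η, hη, rfl⟩ h0 hd
    rw [two_mul_finrank_ann_iff]
    refine key η hη (fun h => h0 (by rw [h, map_zero])) ?_
    obtain ⟨v, hv, hv0⟩ := (Submodule.ne_bot_iff _).1 hd
    refine ⟨v, v.2, fun h => hv0 (Subtype.ext h), fun w hw => ?_⟩
    have := hv ⟨w, hw⟩
    rwa [restrictForm_apply] at this

/-- The reduction of a trisymplectic space by a non-degenerate isotropic subspace `W`, on an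
arbitrary model `Q` of `W^⊥ / W`. -/
theorem isTrisymplecticSpace_reduction (hS : IsTrisymplecticSpace S)
    (hW : IsNondegenerateSubspace S W)
    (hiso : ∀ η ∈ S, ∀ w ∈ W, ∀ w' ∈ W, η ![w, w'] = 0)
    (hdim : 4 * Module.finrank ℂ W < Module.finrank ℂ V)
    {T Q : Type*} [AddCommGroup T] [Module ℂ T] [AddCommGroup Q] [Module ℂ Q] [TopologicalSpace Q]
    [FiniteDimensional ℂ Q]
    {f : T →ₗ[ℂ] V} {p : T →ₗ[ℂ] Q} (hf : Function.Injective f)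
    (hfr : LinearMap.range f = perp S W) (hp : Function.Surjective p)
    (hk : ∀ t, p t = 0 ↔ f t ∈ W)
    {S' : Submodule ℂ (Q [⋀^Fin 2]→L[ℂ] ℂ)}
    (h : ∀ η ∈ S, ∃ η' ∈ S', ∀ u v, η' ![p u, p v] = η ![f u, f v])
    (h' : ∀ η' ∈ S', ∃ η ∈ S, ∀ u v, η' ![p u, p v] = η ![f u, f v]) :
    IsTrisymplecticSpace S' := by
  obtain ⟨U, hsup, hinf, hU⟩ := exists_reduced_complement hS hW hiso hdim
  have hUr : ∀ u : U, ∃ t, f t = u := fun u => by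
    have : (u : V) ∈ LinearMap.range f := by
      rw [hfr, ← hsup]; exact Submodule.mem_sup_left u.2
    exact this
  choose s hs using hUr
  -- Lifting `U` through `f` and projecting by `p` identifies `U` with `Q`, since `p` has kernel
  -- `f⁻¹(W)` and `U` is a complement of `W`.
  let g : U →ₗ[ℂ] Q :=
    { toFun := fun u => p (s u)
      map_add' := fun a b => by
        rw [← map_add]; congr 1; apply hf; rw [map_add, hs, hs, hs]; rfl
      map_smul' := fun c a => by
        rw [RingHom.id_apply, ← map_smul]; congr 1; apply hf; rw [map_smul, hs, hs]; rfl }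
  have hg : Function.Bijective g := by
    constructor
    · rw [← LinearMap.ker_eq_bot, Submodule.eq_bot_iff]
      intro u hu
      have h1 : f (s u) ∈ W := (hk _).1 hu
      rw [hs] at h1
      have : (u : V) ∈ U ⊓ W := ⟨u.2, h1⟩
      rw [hinf, Submodule.mem_bot] at this
      exact Subtype.ext this
    · intro x
      obtain ⟨t, rfl⟩ := hp x
      have ht : f t ∈ U ⊔ W := by rw [hsup, ← hfr]; exact ⟨t, rfl⟩
      obtain ⟨u, hu, w, hw, e⟩ := Submodule.mem_sup.1 ht
      refine ⟨⟨u, hu⟩, ?_⟩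
      change p (s ⟨u, hu⟩) = p t
      rw [← sub_eq_zero, ← map_sub, hk, map_sub, hs, ← e]
      simpa using hw
  refine hU.of_equiv (LinearEquiv.ofBijective g hg) ?_ ?_
  · rintro _ ⟨η, hη, rfl⟩
    obtain ⟨η', hη', e⟩ := h η hη
    refine ⟨η', hη', fun u v => ?_⟩
    rw [restrictForm_apply, ← hs u, ← hs v]
    exact e _ _
  · intro η' hη'
    obtain ⟨η, hη, e⟩ := h' η' hη'
    refine ⟨_, ⟨η, hη, rfl⟩, fun u v => ?_⟩
    rw [restrictForm_apply, ← hs u, ← hs v]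
    exact e _ _

/-! ### Analytic inverse function theorem -/

section InverseFunction

variable {E E' : Type*} [NormedAddCommGroup E] [NormedSpace ℂ E] [CompleteSpace E]
  [NormedAddCommGroup E'] [NormedSpace ℂ E']

/-- The inverse function theorem gives analyticity of the inverse at one point. Being analytic is an
open condition, so shrinking the source gives it on the whole target. -/
theorem exists_analytic_openPartialHomeomorph {f : E → E'} {a : E} (hf : ContDiffAt ℂ ω f a)
    {D : E ≃L[ℂ] E'} (hD : HasFDerivAt f (D : E →L[ℂ] E') a) {A : Set E} (hA : A ∈ 𝓝 a) :
    ∃ H : OpenPartialHomeomorph E E', a ∈ H.source ∧ (∀ x, H x = f x) ∧ H.source ⊆ A ∧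
      (∀ x ∈ H.source, ContDiffAt ℂ ω f x) ∧ ∀ b ∈ H.target, ContDiffAt ℂ ω H.symm b := by
  have h0 : (ω : WithTop ℕ∞) ≠ 0 := by simp
  set H₀ := hf.toOpenPartialHomeomorph f hD h0
  have ha : a ∈ H₀.source := hf.mem_toOpenPartialHomeomorph_source hD h0
  have hsymm : ContDiffAt ℂ ω H₀.symm (H₀ a) := hf.to_localInverse hD h0
  have h1 : ∀ᶠ x in 𝓝 a, ContDiffAt ℂ ω H₀.symm (H₀ x) :=
    (H₀.continuousAt ha).eventually (hsymm.eventually (by simp))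
  have h2 : ∀ᶠ x in 𝓝 a, ContDiffAt ℂ ω f x := hf.eventually (by simp)
  have h3 : {x | x ∈ A ∧ ContDiffAt ℂ ω f x ∧ ContDiffAt ℂ ω H₀.symm (H₀ x)} ∈ 𝓝 a := by
    filter_upwards [hA, h1, h2] with x a b c using ⟨a, c, b⟩
  refine ⟨H₀.restr _, ⟨ha, mem_interior_iff_mem_nhds.2 h3⟩, fun x => rfl,
    fun x hx => (interior_subset hx.2).1, fun x hx => (interior_subset hx.2).2.1, ?_⟩
  intro b hb
  have hb' := (H₀.restr _).map_target hb
  have := (interior_subset hb'.2).2.2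
  have e : H₀ ((H₀.restr _).symm b) = b := (H₀.restr _).right_inv hb
  rw [e] at this
  exact this

end InverseFunction

/-! ### Embedded submanifolds -/

section Slice

variable {E : Type*} [NormedAddCommGroup E] [NormedSpace ℂ E]
  {M : Type*} [TopologicalSpace M] [ChartedSpace E M]
  {F : Type*} [NormedAddCommGroup F] [NormedSpace ℂ F]

/-- Charts of a subset `N` of a complex manifold which are locally restrictions of holomorphic
maps on `M`, and whose inverses are holomorphic into `M`. -/
structure IsSliceChart (E : Type*) [NormedAddCommGroup E] [NormedSpace ℂ E] {M : Type*}
    [TopologicalSpace M] [ChartedSpace E M] {N : Set M} (e : OpenPartialHomeomorph N F) :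
    Prop where
  symm_holomorphic : ∀ y ∈ e.target, ContMDiffAt 𝓘(ℂ, F) 𝓘(ℂ, E) ω (fun y => (e.symm y : M)) y
  exists_extension : ∀ x ∈ e.source, ∃ g : M → F,
    ContMDiffAt 𝓘(ℂ, E) 𝓘(ℂ, F) ω g (x : M) ∧ ∀ᶠ y : N in 𝓝 x, g y = e y

/-- The charted space structure given by all slice charts. -/
@[reducible] def sliceChartedSpace (E : Type*) [NormedAddCommGroup E] [NormedSpace ℂ E]
    {M : Type*} [TopologicalSpace M] [ChartedSpace E M]
    (F : Type*) [NormedAddCommGroup F] [NormedSpace ℂ F] (N : Set M)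
    (h : ∀ x : N, ∃ e : OpenPartialHomeomorph N F, IsSliceChart E e ∧ x ∈ e.source) :
    ChartedSpace F N where
  atlas := {e | IsSliceChart E e}
  chartAt x := (h x).choose
  mem_chart_source x := (h x).choose_spec.2
  chart_mem_atlas x := (h x).choose_spec.1

variable {N : Set M}
  (h : ∀ x : N, ∃ e : OpenPartialHomeomorph N F, IsSliceChart E e ∧ x ∈ e.source)

/-- A transition map is `e.symm`, holomorphic into `M`, followed by a local ambient extension of
`e'`. -/
theorem slice_isManifold :
    letI := sliceChartedSpace E F N h
    IsManifold 𝓘(ℂ, F) ω N := by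
  let := sliceChartedSpace E F N h
  refine isManifold_of_contDiffOn _ _ _ fun e e' he he' => ?_
  have he : IsSliceChart E e := he
  have he' : IsSliceChart E e' := he'
  intro y hy
  simp only [modelWithCornersSelf_coe, modelWithCornersSelf_coe_symm, Set.preimage_id,
    Set.range_id, Set.inter_univ, Function.id_comp, Function.comp_id] at hy ⊢
  have hyt : y ∈ e.target := hy.1
  have hys : e.symm y ∈ e'.source := hy.2
  obtain ⟨g, hg, hge⟩ := he'.exists_extension _ hys
  have h1 : ContMDiffAt 𝓘(ℂ, F) 𝓘(ℂ, F) ω (fun y => g (e.symm y : M)) y :=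
    hg.comp y (he.symm_holomorphic y hyt)
  have h2 : (fun y => g (e.symm y : M)) =ᶠ[𝓝 y] (e.symm ≫ₕ e') :=
    (e.symm.continuousAt hyt).eventually hge
  exact ((contMDiffAt_iff_contDiffAt.1 h1).congr_of_eventuallyEq h2.symm).contDiffWithinAt

theorem slice_contMDiff_val :
    letI := sliceChartedSpace E F N h
    ContMDiff 𝓘(ℂ, F) 𝓘(ℂ, E) ω (Subtype.val : N → M) := by
  let := sliceChartedSpace E F N h
  have := slice_isManifold h
  intro x
  obtain ⟨e, he, hx⟩ := h x
  have hat : e ∈ IsManifold.maximalAtlas 𝓘(ℂ, F) ω N := IsManifold.subset_maximalAtlas he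
  have h1 := (he.symm_holomorphic _ (e.map_source hx)).comp x
    (contMDiffAt_of_mem_maximalAtlas hat hx)
  refine h1.congr_of_eventuallyEq ?_
  filter_upwards [e.open_source.mem_nhds hx] with y hy
  simp [e.left_inv hy]

/-- A continuous map into a submanifold is holomorphic if it is as a map to the ambient
manifold. -/
theorem slice_contMDiffAt_of_val {E₁ : Type*} [NormedAddCommGroup E₁] [NormedSpace ℂ E₁]
    {H₁ : Type*} [TopologicalSpace H₁] {I₁ : ModelWithCorners ℂ E₁ H₁}
    {X : Type*} [TopologicalSpace X] [ChartedSpace H₁ X] {f : X → N} {x : X}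
    (hc : ContinuousAt f x) (hf : ContMDiffAt I₁ 𝓘(ℂ, E) ω (fun x => (f x : M)) x) :
    letI := sliceChartedSpace E F N h
    ContMDiffAt I₁ 𝓘(ℂ, F) ω f x := by
  let := sliceChartedSpace E F N h
  have := slice_isManifold h
  obtain ⟨e, he, hx⟩ := h (f x)
  have hat : e ∈ IsManifold.maximalAtlas 𝓘(ℂ, F) ω N := IsManifold.subset_maximalAtlas he
  obtain ⟨g, hg, hge⟩ := he.exists_extension _ hx
  have h1 : ContMDiffAt I₁ 𝓘(ℂ, F) ω (fun x => g (f x : M)) x := hg.comp x hf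
  have hgx : g (f x : M) = e (f x) := hge.self_of_nhds
  have h2 : ContMDiffAt I₁ 𝓘(ℂ, F) ω (fun x => e.symm (g (f x : M))) x := by
    refine ContMDiffAt.comp x ?_ h1
    rw [hgx]
    exact contMDiffAt_symm_of_mem_maximalAtlas hat (e.map_source hx)
  refine h2.congr_of_eventuallyEq ?_
  filter_upwards [hc.eventually hge, hc.eventually (e.open_source.mem_nhds hx)] with y hy hy'
  rw [hy, e.left_inv hy']

/-- If `g` extends a chart `e` to the ambient manifold, then `e.symm ∘ g` is a local left inverse of
the inclusion. -/
theorem slice_mfderiv_val_injective (x : N) :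
    letI := sliceChartedSpace E F N h
    Function.Injective (mfderiv 𝓘(ℂ, F) 𝓘(ℂ, E) (Subtype.val : N → M) x) := by
  let := sliceChartedSpace E F N h
  have := slice_isManifold h
  obtain ⟨e, he, hx⟩ := h x
  have hat : e ∈ IsManifold.maximalAtlas 𝓘(ℂ, F) ω N := IsManifold.subset_maximalAtlas he
  obtain ⟨g, hg, hge⟩ := he.exists_extension _ hx
  have hval := ((slice_contMDiff_val h) x).mdifferentiableAt (by simp)
  have hgd : MDifferentiableAt 𝓘(ℂ, E) 𝓘(ℂ, F) g (x : M) := hg.mdifferentiableAt (by simp)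
  have hed : MDifferentiableAt 𝓘(ℂ, F) 𝓘(ℂ, F) e x :=
    (contMDiffAt_of_mem_maximalAtlas hat hx).mdifferentiableAt (by simp)
  have hsd : MDifferentiableAt 𝓘(ℂ, F) 𝓘(ℂ, F) e.symm (g x) := by
    rw [hge.self_of_nhds]
    exact (contMDiffAt_symm_of_mem_maximalAtlas hat (e.map_source hx)).mdifferentiableAt (by simp)
  have hid : (e.symm ∘ g ∘ Subtype.val : N → N) =ᶠ[𝓝 x] id := by
    filter_upwards [hge, e.open_source.mem_nhds hx] with y hy hy'
    simp only [Function.comp_apply, hy, e.left_inv hy', id]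
  have h1 := hid.mfderiv_eq (I := 𝓘(ℂ, F)) (I' := 𝓘(ℂ, F))
  have h2 := mfderiv_comp x (I := 𝓘(ℂ, F)) (I'' := 𝓘(ℂ, F)) hsd (hgd.comp x hval)
  have h3 := mfderiv_comp x (I := 𝓘(ℂ, F)) (I'' := 𝓘(ℂ, F)) hgd hval
  intro u v huv
  have key : ∀ w, mfderiv 𝓘(ℂ, F) 𝓘(ℂ, F) (e.symm ∘ g ∘ Subtype.val : N → N) x w = w := by
    intro w; rw [h1, mfderiv_id]; rfl
  rw [← key u, ← key v, h2, h3]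
  simp only [ContinuousLinearMap.comp_apply]
  exact congrArg _ (congrArg _ huv)

end Slice

/-! ### Level sets -/

section LevelSet

variable {E : Type*} [NormedAddCommGroup E] [NormedSpace ℂ E] [FiniteDimensional ℂ E]
  {M : Type*} [TopologicalSpace M] [ChartedSpace E M] [IsManifold 𝓘(ℂ, E) ω M]
  {F : Type*} [NormedAddCommGroup F] [NormedSpace ℂ F] [FiniteDimensional ℂ F]
  {P : Type*} [NormedAddCommGroup P] [NormedSpace ℂ P] [FiniteDimensional ℂ P]

omit [IsManifold 𝓘(ℂ, E) ω M] [FiniteDimensional ℂ E] [FiniteDimensional ℂ P] in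
theorem hasFDerivAt_comp_chart_symm {f : M → P} {x : M} {D : E →L[ℂ] P}
    (hf : HasMFDerivAt 𝓘(ℂ, E) 𝓘(ℂ, P) f x D) :
    HasFDerivAt (f ∘ (chartAt E x).symm) D (chartAt E x x) := by
  rw [← hasFDerivWithinAt_univ]
  have : HasFDerivWithinAt (writtenInExtChartAt 𝓘(ℂ, E) 𝓘(ℂ, P) x f) D (Set.range 𝓘(ℂ, E))
    (extChartAt 𝓘(ℂ, E) x x) := hf.2
  simpa [writtenInExtChartAt, extChartAt, mfld_simps, chartAt_self_eq] using this

theorem exists_complementary_map {D : E →ₗ[ℂ] P} (hD : Function.Surjective D)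
    (hdim : Module.finrank ℂ P + Module.finrank ℂ F = Module.finrank ℂ E) :
    ∃ L : E →ₗ[ℂ] F, Function.Bijective (D.prod L) := by
  obtain ⟨C, hC⟩ := Submodule.exists_isCompl (LinearMap.ker D)
  have hr := LinearMap.finrank_range_add_finrank_ker D
  rw [LinearMap.range_eq_top.2 hD, finrank_top] at hr
  let i : LinearMap.ker D ≃ₗ[ℂ] F := LinearEquiv.ofFinrankEq _ _ (by omega)
  let L : E →ₗ[ℂ] F := i.toLinearMap ∘ₗ (LinearMap.ker D).projectionOnto C hC
  refine ⟨L, ?_⟩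
  have hinj : Function.Injective (D.prod L) := by
    rw [← LinearMap.ker_eq_bot, Submodule.eq_bot_iff]
    intro v hv
    have h1 : D v = 0 := congrArg Prod.fst hv
    have h2 : L v = 0 := congrArg Prod.snd hv
    have h3 : (LinearMap.ker D).projectionOnto C hC v = ⟨v, h1⟩ :=
      Submodule.projectionOnto_apply_left hC ⟨v, h1⟩
    have h4 : i ⟨v, h1⟩ = 0 := by rw [← h3]; exact h2
    exact congrArg Subtype.val (i.map_eq_zero_iff.1 h4)
  exact ⟨hinj, (LinearMap.injective_iff_surjective_of_finrank_eq_finrank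
    (by rw [Module.finrank_prod]; exact hdim.symm)).1 hinj⟩

/-- Regular level sets have slice charts. -/
theorem exists_sliceChart_levelSet {f : M → P} (hf : ContMDiff 𝓘(ℂ, E) 𝓘(ℂ, P) ω f)
    {N : Set M} (hN : ∀ x, x ∈ N ↔ f x = 0) (x : N)
    (hsurj : Function.Surjective (mfderiv 𝓘(ℂ, E) 𝓘(ℂ, P) f (x : M)))
    (hdim : Module.finrank ℂ P + Module.finrank ℂ F = Module.finrank ℂ E) :
    ∃ e : OpenPartialHomeomorph N F, IsSliceChart E e ∧ x ∈ e.source := by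
  have : CompleteSpace E := FiniteDimensional.complete ℂ E
  set φ := chartAt E (x : M) with hφ
  have hφat : φ ∈ IsManifold.maximalAtlas 𝓘(ℂ, E) ω M := IsManifold.chart_mem_maximalAtlas _
  have hxs : (x : M) ∈ φ.source := mem_chart_source E _
  set D : E →L[ℂ] P := mfderiv 𝓘(ℂ, E) 𝓘(ℂ, P) f (x : M) with hDdef
  obtain ⟨L, hL⟩ := exists_complementary_map (F := F) (D := (D : E →ₗ[ℂ] P)) hsurj hdim
  let L' : E →L[ℂ] F := LinearMap.toContinuousLinearMap L
  let T : E ≃L[ℂ] P × F := (LinearEquiv.ofBijective _ hL).toContinuousLinearEquiv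
  have hfd : ContDiffAt ℂ ω (f ∘ φ.symm) (φ x) := by
    rw [← contMDiffAt_iff_contDiffAt]
    exact (hf _).comp _ (contMDiffAt_symm_of_mem_maximalAtlas hφat (φ.map_source hxs))
  have hD : HasFDerivAt (f ∘ φ.symm) D (φ x) :=
    hasFDerivAt_comp_chart_symm ((hf x).mdifferentiableAt (by simp)).hasMFDerivAt
  -- The first component of these coordinates is `f` itself, so `N` becomes the locus where it
  -- vanishes and the second component is a chart of `N`.
  obtain ⟨H, haH, hH, hHs, -, hsymm⟩ := exists_analytic_openPartialHomeomorph
    (f := fun y => ((f ∘ φ.symm) y, L' y)) (a := φ x) (D := T) (A := φ.target)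
    (hfd.prodMk L'.contDiff.contDiffAt)
    (by
      have := hD.prodMk L'.hasFDerivAt (x := φ x)
      exact this)
    (φ.open_target.mem_nhds (φ.map_source hxs))
  let Φ := φ ≫ₕ H
  have hΦs : ∀ y ∈ Φ.source, y ∈ φ.source ∧ φ y ∈ H.source := fun y hy => hy
  have hΦ : ∀ y ∈ Φ.source, Φ y = (f y, L' (φ y)) := by
    intro y hy
    change H (φ y) = _
    rw [hH]
    simp [φ.left_inv (hΦs y hy).1]
  have hNt : ∀ v : F, ((0 : P), v) ∈ Φ.target → Φ.symm (0, v) ∈ N := by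
    intro v hv
    rw [hN]
    have h1 := hΦ _ (Φ.map_target hv)
    rw [Φ.right_inv hv] at h1
    exact (congrArg Prod.fst h1).symm
  classical
  let inv : F → N := fun v => if hv : Φ.symm ((0 : P), v) ∈ N then ⟨_, hv⟩ else x
  have hinv : ∀ v : F, ((0 : P), v) ∈ Φ.target → (inv v : M) = Φ.symm (0, v) := by
    intro v hv
    simp only [inv, dif_pos (hNt v hv)]
  have hmem : ∀ y : N, (y : M) ∈ Φ.source → Φ (y : M) = (0, L' (φ y)) := by
    intro y hy
    rw [hΦ _ hy, (hN _).1 y.2]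
  let e : OpenPartialHomeomorph N F :=
    { toFun := fun y => L' (φ y)
      invFun := inv
      source := Subtype.val ⁻¹' Φ.source
      target := (fun v : F => ((0 : P), v)) ⁻¹' Φ.target
      map_source' := fun y hy => by
        change ((0 : P), L' (φ y)) ∈ Φ.target
        rw [← hmem y hy]; exact Φ.map_source hy
      map_target' := fun v hv => by
        change (inv v : M) ∈ Φ.source
        rw [hinv v hv]; exact Φ.map_target hv
      left_inv' := fun y hy => by
        apply Subtype.ext
        have : ((0 : P), L' (φ y)) ∈ Φ.target := by rw [← hmem y hy]; exact Φ.map_source hy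
        rw [hinv _ this, ← hmem y hy, Φ.left_inv hy]
      right_inv' := fun v hv => by
        have h1 := hmem (inv v) (by rw [hinv v hv]; exact Φ.map_target hv)
        rw [hinv v hv, Φ.right_inv hv] at h1
        rw [hinv v hv]
        exact (congrArg Prod.snd h1).symm
      open_source := Φ.open_source.preimage continuous_subtype_val
      open_target := Φ.open_target.preimage (by fun_prop)
      continuousOn_toFun := by
        refine L'.continuous.comp_continuousOn ?_
        exact φ.continuousOn.comp continuous_subtype_val.continuousOn fun y hy => (hΦs _ hy).1
      continuousOn_invFun := by
        rw [Topology.IsInducing.subtypeVal.continuousOn_iff]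
        refine ContinuousOn.congr (f := fun v => Φ.symm ((0 : P), v)) ?_ fun v hv => hinv v hv
        exact Φ.symm.continuousOn.comp (by fun_prop) fun v hv => hv }
  refine ⟨e, ⟨?_, ?_⟩, ⟨hxs, haH⟩⟩
  · intro v hv
    have h1 : ContMDiffAt 𝓘(ℂ, F) 𝓘(ℂ, E) ω (fun v : F => H.symm ((0 : P), v)) v := by
      rw [contMDiffAt_iff_contDiffAt]
      exact (hsymm _ hv.1).comp v (contDiffAt_const.prodMk contDiffAt_id)
    have h2 : ContMDiffAt 𝓘(ℂ, F) 𝓘(ℂ, E) ω (fun v : F => φ.symm (H.symm ((0 : P), v))) v :=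
      (contMDiffAt_symm_of_mem_maximalAtlas hφat hv.2).comp v h1
    refine h2.congr_of_eventuallyEq ?_
    filter_upwards [e.open_target.mem_nhds hv] with u hu
    exact hinv u hu
  · intro y hy
    refine ⟨fun z => L' (φ z), ?_, Filter.Eventually.of_forall fun z => rfl⟩
    exact L'.contDiff.contMDiff.contMDiffAt.comp (y : M)
      (contMDiffAt_of_mem_maximalAtlas hφat (hΦs _ hy).1)

end LevelSet

/-! ### Quotients by proper free actions -/

section QuotientCharts

variable {F : Type*} [NormedAddCommGroup F] [NormedSpace ℂ F]
  {N : Type*} [TopologicalSpace N] [ChartedSpace F N]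
  {Γ : Type*} [Group Γ] [MulAction Γ N]
  {F' : Type*} [NormedAddCommGroup F'] [NormedSpace ℂ F']

/-- Charts of an orbit space which are holomorphic on the total space and whose inverses have
local holomorphic lifts through any given point. -/
structure IsQuotientChart (F : Type*) [NormedAddCommGroup F] [NormedSpace ℂ F]
    {N : Type*} [TopologicalSpace N] [ChartedSpace F N] {Γ : Type*} [Group Γ] [MulAction Γ N]
    (e : OpenPartialHomeomorph (Quotient (MulAction.orbitRel Γ N)) F') : Prop where
  holomorphic : ∀ x : N, Quotient.mk (MulAction.orbitRel Γ N) x ∈ e.source →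
    ContMDiffAt 𝓘(ℂ, F) 𝓘(ℂ, F') ω (fun x => e (Quotient.mk (MulAction.orbitRel Γ N) x)) x
  exists_lift : ∀ x : N, Quotient.mk (MulAction.orbitRel Γ N) x ∈ e.source →
    ∃ σ : F' → N, σ (e (Quotient.mk (MulAction.orbitRel Γ N) x)) = x ∧
      ContMDiffAt 𝓘(ℂ, F') 𝓘(ℂ, F) ω σ (e (Quotient.mk (MulAction.orbitRel Γ N) x)) ∧
      ∀ᶠ y in 𝓝 (e (Quotient.mk (MulAction.orbitRel Γ N) x)),
        Quotient.mk (MulAction.orbitRel Γ N) (σ y) = e.symm y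

/-- The charted space structure on an orbit space given by all quotient charts. -/
@[reducible] def quotientChartedSpace (F : Type*) [NormedAddCommGroup F] [NormedSpace ℂ F]
    (N : Type*) [TopologicalSpace N] [ChartedSpace F N] (Γ : Type*) [Group Γ] [MulAction Γ N]
    (F' : Type*) [NormedAddCommGroup F'] [NormedSpace ℂ F']
    (h : ∀ q : Quotient (MulAction.orbitRel Γ N),
      ∃ e : OpenPartialHomeomorph (Quotient (MulAction.orbitRel Γ N)) F',
        IsQuotientChart F e ∧ q ∈ e.source) :
    ChartedSpace F' (Quotient (MulAction.orbitRel Γ N)) where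
  atlas := {e | IsQuotientChart F e}
  chartAt q := (h q).choose
  mem_chart_source q := (h q).choose_spec.2
  chart_mem_atlas q := (h q).choose_spec.1

variable (h : ∀ q : Quotient (MulAction.orbitRel Γ N),
      ∃ e : OpenPartialHomeomorph (Quotient (MulAction.orbitRel Γ N)) F',
        IsQuotientChart F e ∧ q ∈ e.source)

/-- A transition map is a local lift of `e.symm` to `N` followed by `e' ∘ π`, and both are
holomorphic. -/
theorem quotient_isManifold :
    letI := quotientChartedSpace F N Γ F' h
    IsManifold 𝓘(ℂ, F') ω (Quotient (MulAction.orbitRel Γ N)) := by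
  let := quotientChartedSpace F N Γ F' h
  refine isManifold_of_contDiffOn _ _ _ fun e e' he he' => ?_
  have he : IsQuotientChart F e := he
  have he' : IsQuotientChart F e' := he'
  intro y hy
  simp only [modelWithCornersSelf_coe, modelWithCornersSelf_coe_symm, Set.preimage_id,
    Set.range_id, Set.inter_univ, Function.id_comp, Function.comp_id] at hy ⊢
  have hyt : y ∈ e.target := hy.1
  have hys : e.symm y ∈ e'.source := hy.2
  obtain ⟨x, hx⟩ := Quotient.exists_rep (e.symm y)
  have hxs : Quotient.mk (MulAction.orbitRel Γ N) x ∈ e.source := by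
    rw [hx]; exact e.map_target hyt
  have hey : e (Quotient.mk (MulAction.orbitRel Γ N) x) = y := by rw [hx, e.right_inv hyt]
  obtain ⟨σ, hσx, hσ, hσe⟩ := he.exists_lift x hxs
  rw [hey] at hσx hσ hσe
  have h1 : ContMDiffAt 𝓘(ℂ, F') 𝓘(ℂ, F') ω
      (fun y => e' (Quotient.mk (MulAction.orbitRel Γ N) (σ y))) y := by
    refine ContMDiffAt.comp (g := fun x => e' (Quotient.mk (MulAction.orbitRel Γ N) x)) y ?_ hσ
    exact he'.holomorphic _ (by rw [hσx, hx]; exact hys)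
  have h2 : (fun y => e' (Quotient.mk (MulAction.orbitRel Γ N) (σ y))) =ᶠ[𝓝 y] (e.symm ≫ₕ e') := by
    filter_upwards [hσe] with u hu
    rw [hu]; rfl
  exact ((contMDiffAt_iff_contDiffAt.1 h1).congr_of_eventuallyEq h2.symm).contDiffWithinAt

theorem quotient_contMDiff_mk (hc : Continuous (Quotient.mk (MulAction.orbitRel Γ N))) :
    letI := quotientChartedSpace F N Γ F' h
    ContMDiff 𝓘(ℂ, F) 𝓘(ℂ, F') ω (Quotient.mk (MulAction.orbitRel Γ N)) := by
  let := quotientChartedSpace F N Γ F' h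
  have := quotient_isManifold h
  intro x
  obtain ⟨e, he, hx⟩ := h (Quotient.mk _ x)
  have hat : e ∈ IsManifold.maximalAtlas 𝓘(ℂ, F') ω (Quotient (MulAction.orbitRel Γ N)) :=
    IsManifold.subset_maximalAtlas he
  have h1 := (contMDiffAt_symm_of_mem_maximalAtlas hat (e.map_source hx)).comp x
    (he.holomorphic x hx)
  refine h1.congr_of_eventuallyEq ?_
  filter_upwards [hc.continuousAt.eventually (e.open_source.mem_nhds hx)] with y hy
  simp [e.left_inv hy]

/-- Lifts exist through every prescribed point `x`, so `σ ∘ e` is a local section of the projection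
through `x`. -/
theorem quotient_submersion (hc : Continuous (Quotient.mk (MulAction.orbitRel Γ N))) (x : N) :
    letI := quotientChartedSpace F N Γ F' h
    Function.Surjective (mfderiv 𝓘(ℂ, F) 𝓘(ℂ, F') (Quotient.mk (MulAction.orbitRel Γ N)) x) := by
  let := quotientChartedSpace F N Γ F' h
  have := quotient_isManifold h
  obtain ⟨e, he, hx⟩ := h (Quotient.mk _ x)
  have hat : e ∈ IsManifold.maximalAtlas 𝓘(ℂ, F') ω (Quotient (MulAction.orbitRel Γ N)) :=
    IsManifold.subset_maximalAtlas he
  obtain ⟨σ, hσx, hσ, hσe⟩ := he.exists_lift x hx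
  set q := Quotient.mk (MulAction.orbitRel Γ N) x with hq
  have hπ : MDifferentiableAt 𝓘(ℂ, F) 𝓘(ℂ, F') (Quotient.mk (MulAction.orbitRel Γ N)) x :=
    (quotient_contMDiff_mk h hc x).mdifferentiableAt (by simp)
  have hed : MDifferentiableAt 𝓘(ℂ, F') 𝓘(ℂ, F') e q :=
    (contMDiffAt_of_mem_maximalAtlas hat hx).mdifferentiableAt (by simp)
  have hσd : MDifferentiableAt 𝓘(ℂ, F') 𝓘(ℂ, F) σ (e q) := hσ.mdifferentiableAt (by simp)
  have hid : (Quotient.mk (MulAction.orbitRel Γ N) ∘ σ ∘ e) =ᶠ[𝓝 q] id := by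
    filter_upwards [(e.continuousAt hx).eventually hσe, e.open_source.mem_nhds hx] with y hy hy'
    simp only [Function.comp_apply, hy, e.left_inv hy', id]
  have hsd : MDifferentiableAt 𝓘(ℂ, F') 𝓘(ℂ, F) (σ ∘ e) q := hσd.comp q hed
  have hπ' : MDifferentiableAt 𝓘(ℂ, F) 𝓘(ℂ, F') (Quotient.mk (MulAction.orbitRel Γ N))
      ((σ ∘ e) q) := by
    rw [Function.comp_apply, hσx]; exact hπ
  have h1 := hid.mfderiv_eq (I := 𝓘(ℂ, F')) (I' := 𝓘(ℂ, F'))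
  have h2 := mfderiv_comp q (I := 𝓘(ℂ, F')) (I'' := 𝓘(ℂ, F')) hπ' hsd
  rw [h1, mfderiv_id] at h2
  have key : Function.Surjective (mfderiv 𝓘(ℂ, F) 𝓘(ℂ, F')
      (Quotient.mk (MulAction.orbitRel Γ N)) ((σ ∘ e) q)) := fun w =>
    ⟨mfderiv 𝓘(ℂ, F') 𝓘(ℂ, F) (σ ∘ e) q w, (DFunLike.congr_fun h2 w).symm⟩
  have hx' : (σ ∘ e) q = x := hσx
  rw [hx'] at key
  exact key

end QuotientCharts

/-! ### The slice theorem for proper free actions -/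

section SliceTheorem

theorem exists_complementary_inclusion {E F F' : Type*} [AddCommGroup E] [Module ℂ E]
    [AddCommGroup F] [Module ℂ F] [AddCommGroup F'] [Module ℂ F'] [FiniteDimensional ℂ E]
    [FiniteDimensional ℂ F] [FiniteDimensional ℂ F'] {D : E →ₗ[ℂ] F} (hD : Function.Injective D)
    (hdim : Module.finrank ℂ E + Module.finrank ℂ F' = Module.finrank ℂ F) :
    ∃ L : F' →ₗ[ℂ] F, Function.Bijective (D.coprod L) := by
  obtain ⟨C, hC⟩ := Submodule.exists_isCompl (LinearMap.range D)
  have hr := LinearMap.finrank_range_of_inj hD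
  have hs := Submodule.finrank_add_eq_of_isCompl hC
  let i : F' ≃ₗ[ℂ] C := LinearEquiv.ofFinrankEq _ _ (by omega)
  refine ⟨C.subtype ∘ₗ i.toLinearMap, ?_⟩
  have hinj : Function.Injective (D.coprod (C.subtype ∘ₗ i.toLinearMap)) := by
    rw [← LinearMap.ker_eq_bot, Submodule.eq_bot_iff]
    rintro ⟨u, v⟩ h
    have h0 : D u + (i v : F) = 0 := h
    have h1 : (i v : F) ∈ LinearMap.range D ⊓ C :=
      ⟨⟨-u, by rw [map_neg, neg_eq_of_add_eq_zero_right h0]⟩, (i v).2⟩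
    rw [hC.inf_eq_bot, Submodule.mem_bot] at h1
    rw [h1, add_zero] at h0
    have hv : v = 0 := i.map_eq_zero_iff.1 (Subtype.ext h1)
    have hu : u = 0 := hD (by rw [h0, map_zero])
    rw [hu, hv]; rfl
  exact ⟨hinj, (LinearMap.injective_iff_surjective_of_finrank_eq_finrank
    (by rw [Module.finrank_prod]; exact hdim)).1 hinj⟩

variable {F : Type*} [NormedAddCommGroup F] [NormedSpace ℂ F] [FiniteDimensional ℂ F]
  {N : Type*} [TopologicalSpace N] [ChartedSpace F N] [IsManifold 𝓘(ℂ, F) ω N]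
  {EC : Type*} [NormedAddCommGroup EC] [NormedSpace ℂ EC] [FiniteDimensional ℂ EC]
  {Γ : Type*} [TopologicalSpace Γ] [ChartedSpace EC Γ] [Group Γ] [IsManifold 𝓘(ℂ, EC) ω Γ]
  [MulAction Γ N]
  {F' : Type*} [NormedAddCommGroup F'] [NormedSpace ℂ F'] [FiniteDimensional ℂ F']

/-- A slice through `x₀` transverse to the orbit has the right dimension, and group times slice is
locally `N`. Properness and freeness ensure that a small slice meets each orbit at most once, so the
slice is a chart of the quotient. -/
theorem exists_quotientChart [ProperSMul Γ N]
    (hact : ContMDiff (𝓘(ℂ, EC).prod 𝓘(ℂ, F)) 𝓘(ℂ, F) ω (fun p : Γ × N => p.1 • p.2))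
    (hfree : ∀ (z : Γ) (n : N), z • n = n → z = 1) (x₀ : N)
    (hinj : Function.Injective (mfderiv 𝓘(ℂ, EC) 𝓘(ℂ, F) (fun z : Γ => z • x₀) 1))
    (hdim : Module.finrank ℂ EC + Module.finrank ℂ F' = Module.finrank ℂ F) :
    ∃ e : OpenPartialHomeomorph (Quotient (MulAction.orbitRel Γ N)) F',
      IsQuotientChart F e ∧ Quotient.mk (MulAction.orbitRel Γ N) x₀ ∈ e.source := by
  have : CompleteSpace EC := FiniteDimensional.complete ℂ EC
  have : CompleteSpace F' := FiniteDimensional.complete ℂ F'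
  set φ := chartAt EC (1 : Γ) with hφ
  set ψ := chartAt F x₀ with hψ
  set π : N → Quotient (MulAction.orbitRel Γ N) := Quotient.mk (MulAction.orbitRel Γ N) with hπ
  have hφat : φ ∈ IsManifold.maximalAtlas 𝓘(ℂ, EC) ω Γ := IsManifold.chart_mem_maximalAtlas _
  have hψat : ψ ∈ IsManifold.maximalAtlas 𝓘(ℂ, F) ω N := IsManifold.chart_mem_maximalAtlas _
  have hφ1 : (1 : Γ) ∈ φ.source := mem_chart_source EC _
  have hψ1 : x₀ ∈ ψ.source := mem_chart_source F _
  have hπs : ∀ (z : Γ) x, π (z • x) = π x := fun z x => Quotient.sound ⟨z, rfl⟩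
  have horb : ContMDiff 𝓘(ℂ, EC) 𝓘(ℂ, F) ω (fun z : Γ => z • x₀) :=
    hact.comp (contMDiff_id.prodMk contMDiff_const)
  have hsm : ∀ z : Γ, ContMDiff 𝓘(ℂ, F) 𝓘(ℂ, F) ω (fun x : N => z • x) := fun z =>
    hact.comp (contMDiff_const.prodMk contMDiff_id)
  -- the differential of the orbit map in charts
  set D : EC →L[ℂ] F := mfderiv 𝓘(ℂ, EC) 𝓘(ℂ, F) (fun z : Γ => z • x₀) 1 with hDdef
  have hD : HasFDerivAt (fun y => ψ (φ.symm y • x₀)) D (φ 1) := by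
    rw [← hasFDerivWithinAt_univ]
    have h1 : HasFDerivWithinAt (writtenInExtChartAt 𝓘(ℂ, EC) 𝓘(ℂ, F) (1 : Γ)
        (fun z : Γ => z • x₀)) D (Set.range 𝓘(ℂ, EC)) (extChartAt 𝓘(ℂ, EC) (1 : Γ) 1) :=
      ((horb 1).mdifferentiableAt (by simp)).hasMFDerivAt.2
    simpa [writtenInExtChartAt, extChartAt, mfld_simps, Function.comp_def] using h1
  obtain ⟨L, hL⟩ := exists_complementary_inclusion (F' := F') (D := (D : EC →ₗ[ℂ] F)) hinj hdim
  let L' : F' →L[ℂ] F := LinearMap.toContinuousLinearMap L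
  let T : (EC × F') ≃L[ℂ] F := (LinearEquiv.ofBijective _ hL).toContinuousLinearEquiv
  let σ₀ : F' → N := fun v => ψ.symm (ψ x₀ + L' v)
  have hσ0 : σ₀ 0 = x₀ := by simp [σ₀, ψ.left_inv hψ1]
  have hσ : ∀ v, ψ x₀ + L' v ∈ ψ.target → ContMDiffAt 𝓘(ℂ, F') 𝓘(ℂ, F) ω σ₀ v := by
    intro v hv
    refine ContMDiffAt.comp (g := ψ.symm) v (contMDiffAt_symm_of_mem_maximalAtlas hψat hv) ?_
    rw [contMDiffAt_iff_contDiffAt]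
    exact contDiffAt_const.add L'.contDiff.contDiffAt
  have h0t : ψ x₀ + L' 0 ∈ ψ.target := by simpa using ψ.map_source hψ1
  -- `Θ` is the action of the group on the slice, in charts. Its differential at the base point is
  -- `D` on the group factor and `L` on the slice factor, bijective by the choice of `L`.
  let Θ : EC × F' → F := fun p => ψ (φ.symm p.1 • σ₀ p.2)
  have hpair : ContMDiffAt 𝓘(ℂ, EC × F') (𝓘(ℂ, EC).prod 𝓘(ℂ, F)) ω
      (fun p : EC × F' => (φ.symm p.1, σ₀ p.2)) (φ 1, 0) := by
    refine ContMDiffAt.prodMk ?_ ?_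
    · refine ContMDiffAt.comp (g := φ.symm) (φ 1, (0 : F'))
        (contMDiffAt_symm_of_mem_maximalAtlas hφat (φ.map_source hφ1)) ?_
      rw [contMDiffAt_iff_contDiffAt]; exact contDiffAt_fst
    · refine ContMDiffAt.comp (g := σ₀) (φ 1, (0 : F')) (hσ 0 h0t) ?_
      rw [contMDiffAt_iff_contDiffAt]; exact contDiffAt_snd
  have hbase : φ.symm (φ 1) • σ₀ 0 = x₀ := by rw [φ.left_inv hφ1, one_smul, hσ0]
  have hΘact : ContMDiffAt 𝓘(ℂ, EC × F') 𝓘(ℂ, F) ω (fun p : EC × F' => φ.symm p.1 • σ₀ p.2)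
      (φ 1, 0) := (hact _).comp (φ 1, (0 : F')) hpair
  have hΘ : ContDiffAt ℂ ω Θ (φ 1, 0) := by
    rw [← contMDiffAt_iff_contDiffAt]
    refine ContMDiffAt.comp (g := ψ) (φ 1, (0 : F')) ?_ hΘact
    change ContMDiffAt 𝓘(ℂ, F) 𝓘(ℂ, F) ω ψ (φ.symm (φ 1) • σ₀ 0)
    rw [hbase]
    exact contMDiffAt_of_mem_maximalAtlas hψat hψ1
  have hLc : Filter.Tendsto (fun v : F' => ψ x₀ + L' v) (𝓝 0) (𝓝 (ψ x₀ + L' 0)) :=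
    (continuous_const.add L'.continuous).continuousAt
  have hΘD : HasFDerivAt Θ (T : EC × F' →L[ℂ] F) (φ 1, 0) := by
    have hd := (hΘ.differentiableAt (by simp)).hasFDerivAt
    have e1 : (fderiv ℂ Θ (φ 1, 0)).comp (ContinuousLinearMap.inl ℂ EC F') = D := by
      have h1 : HasFDerivAt (fun y : EC => Θ (y, 0))
          ((fderiv ℂ Θ (φ 1, 0)).comp (ContinuousLinearMap.inl ℂ EC F')) (φ 1) :=
        HasFDerivAt.comp (g := Θ) (f := fun y : EC => (y, (0 : F'))) (φ 1) hd
          (hasFDerivAt_prodMk_left (𝕜 := ℂ) (φ 1) (0 : F'))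
      refine h1.unique ?_
      simpa [Θ, hσ0] using hD
    have e2 : (fderiv ℂ Θ (φ 1, 0)).comp (ContinuousLinearMap.inr ℂ EC F') = L' := by
      have h1 : HasFDerivAt (fun v : F' => Θ (φ 1, v))
          ((fderiv ℂ Θ (φ 1, 0)).comp (ContinuousLinearMap.inr ℂ EC F')) 0 :=
        HasFDerivAt.comp (g := Θ) (f := fun v : F' => (φ 1, v)) (0 : F') hd
          (hasFDerivAt_prodMk_right (𝕜 := ℂ) (φ 1) (0 : F'))
      refine h1.unique ?_
      have h2 : HasFDerivAt (fun v : F' => ψ x₀ + L' v) L' 0 := L'.hasFDerivAt.const_add _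
      refine h2.congr_of_eventuallyEq ?_
      filter_upwards [hLc.eventually (ψ.open_target.mem_nhds h0t)] with v hv
      simp [Θ, σ₀, φ.left_inv hφ1, ψ.right_inv hv]
    have e3 : fderiv ℂ Θ (φ 1, 0) = (T : EC × F' →L[ℂ] F) := by
      ext p
      · exact DFunLike.congr_fun e1 p |>.trans (by simp [T])
      · exact DFunLike.congr_fun e2 p |>.trans (by simp [T, L'])
    rw [← e3]; exact hd
  -- the local inverse
  have hA : {p : EC × F' | p.1 ∈ φ.target ∧ ψ x₀ + L' p.2 ∈ ψ.target ∧
      φ.symm p.1 • σ₀ p.2 ∈ ψ.source} ∈ 𝓝 (φ 1, (0 : F')) := by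
    have a1 : ∀ᶠ p : EC × F' in 𝓝 (φ 1, (0 : F')), p.1 ∈ φ.target :=
      continuous_fst.continuousAt.eventually (φ.open_target.mem_nhds (φ.map_source hφ1))
    have a2 : ∀ᶠ p : EC × F' in 𝓝 (φ 1, (0 : F')), ψ x₀ + L' p.2 ∈ ψ.target :=
      (hLc.comp (continuous_snd.tendsto' (φ 1, (0 : F')) (0 : F') rfl)).eventually
        (ψ.open_target.mem_nhds h0t)
    have a3 : ∀ᶠ p : EC × F' in 𝓝 (φ 1, (0 : F')), φ.symm p.1 • σ₀ p.2 ∈ ψ.source :=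
      hΘact.continuousAt.eventually (ψ.open_source.mem_nhds (by
        change φ.symm (φ 1) • σ₀ 0 ∈ _
        rw [hbase]; exact hψ1))
    filter_upwards [a1, a2, a3] with p b1 b2 b3 using ⟨b1, b2, b3⟩
  obtain ⟨H, haH, hH, hHA, -, hHsymm⟩ := exists_analytic_openPartialHomeomorph hΘ hΘD hA
  have hcσ : ContinuousAt σ₀ 0 := (hσ 0 h0t).continuousAt
  -- the slice meets nearby orbits once
  have hslice : ∀ᶠ p : F' × F' in 𝓝 (0, 0), ∀ z : Γ, z • σ₀ p.1 = σ₀ p.2 → p.1 = p.2 := by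
    by_contra hcon
    rw [Filter.not_eventually] at hcon
    let B : Set (Γ × F' × F') := {t | t.1 • σ₀ t.2.1 = σ₀ t.2.2 ∧ t.2.1 ≠ t.2.2}
    -- The first factor is left free: an ultrafilter finer than `l` consists of coincidences `z • σ₀
    -- v = σ₀ w`, `v ≠ w`, with `v, w → 0` and no control on `z`. Properness will supply the limit
    -- of `z`.
    let l : Filter (Γ × F' × F') := Filter.comap Prod.snd (𝓝 ((0 : F'), (0 : F'))) ⊓ Filter.principal B
    have hl : l.NeBot := by
      rw [Filter.inf_principal_neBot_iff]
      intro U hU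
      obtain ⟨U', hU', hsub⟩ := hU
      obtain ⟨p, hp, hpU⟩ := (hcon.and_eventually hU').exists
      push Not at hp
      obtain ⟨z, hz, hne⟩ := hp
      exact ⟨(z, p), hsub hpU, hz, hne⟩
    let 𝒰 : Ultrafilter (Γ × F' × F') := Ultrafilter.of l
    have h𝒰 : (𝒰 : Filter (Γ × F' × F')) ≤ l := Ultrafilter.of_le l
    have t1 : Filter.Tendsto (fun t : Γ × F' × F' => t.2) 𝒰 (𝓝 (0, 0)) :=
      Filter.tendsto_comap.mono_left (h𝒰.trans inf_le_left)
    have tv : Filter.Tendsto (fun t : Γ × F' × F' => t.2.1) 𝒰 (𝓝 0) :=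
      (continuous_fst.tendsto _).comp t1
    have tv' : Filter.Tendsto (fun t : Γ × F' × F' => t.2.2) 𝒰 (𝓝 0) :=
      (continuous_snd.tendsto _).comp t1
    have hB : ∀ᶠ t in (𝒰 : Filter (Γ × F' × F')), t ∈ B :=
      h𝒰 (Filter.mem_inf_of_right (Filter.mem_principal_self B))
    have tσ : Filter.Tendsto (fun t : Γ × F' × F' => σ₀ t.2.1) 𝒰 (𝓝 x₀) := by
      rw [← hσ0]; exact hcσ.tendsto.comp tv
    have tσ' : Filter.Tendsto (fun t : Γ × F' × F' => σ₀ t.2.2) 𝒰 (𝓝 x₀) := by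
      rw [← hσ0]; exact hcσ.tendsto.comp tv'
    have tp : Filter.Tendsto (fun gx : Γ × N => (gx.1 • gx.2, gx.2))
        (𝒰.map fun t => (t.1, σ₀ t.2.1)) (𝓝 (x₀, x₀)) := by
      rw [Ultrafilter.coe_map, Filter.tendsto_map'_iff, nhds_prod_eq]
      refine Filter.Tendsto.prodMk ?_ tσ
      refine tσ'.congr' ?_
      filter_upwards [hB] with t ht using ht.1.symm
    obtain ⟨g, hg, hgt⟩ := (properSMul_iff_continuousSMul_ultrafilter_tendsto.1 ‹_›).2 _ _ _ tp
    -- The limit of the group elements fixes `x₀`, so freeness makes it `1`.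
    have hg1 : g = 1 := hfree g x₀ hg
    rw [hg1, Ultrafilter.coe_map, Filter.tendsto_map'_iff] at hgt
    have tz : Filter.Tendsto (fun t : Γ × F' × F' => t.1) 𝒰 (𝓝 1) := hgt
    have tφ : Filter.Tendsto (fun t : Γ × F' × F' => (φ t.1, t.2.1)) 𝒰 (𝓝 (φ 1, 0)) := by
      rw [nhds_prod_eq]
      exact ((φ.continuousAt hφ1).tendsto.comp tz).prodMk tv
    have tφ' : Filter.Tendsto (fun t : Γ × F' × F' => (φ 1, t.2.2)) 𝒰 (𝓝 (φ 1, 0)) := by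
      rw [nhds_prod_eq]
      exact tendsto_const_nhds.prodMk tv'
    have hev := (((tφ.eventually (H.open_source.mem_nhds haH)).and
      (tφ'.eventually (H.open_source.mem_nhds haH))).and
      (tz.eventually (φ.open_source.mem_nhds hφ1))).and hB
    obtain ⟨t, ⟨⟨ht1, ht2⟩, ht3⟩, ht4⟩ := hev.exists
    -- Now `(φ z, v)` and `(φ 1, w)` both lie in the domain where `Θ` is injective and have the same
    -- image, so `v = w`.
    have := H.injOn ht1 ht2 (by
      rw [hH, hH]
      simp only [Θ, φ.left_inv ht3, φ.left_inv hφ1, one_smul, ht4.1])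
    exact ht4.2 (congrArg Prod.snd this)
  obtain ⟨O, hOsub, hOopen, h0O⟩ : ∃ O : Set F', (∀ v ∈ O, (∀ w ∈ O, ∀ z : Γ,
      z • σ₀ v = σ₀ w → v = w) ∧ (φ 1, v) ∈ H.source) ∧ IsOpen O ∧ (0 : F') ∈ O := by
    rw [nhds_prod_eq, Filter.Eventually, Filter.mem_prod_self_iff] at hslice
    obtain ⟨t, ht, hts⟩ := hslice
    have h2 : ∀ᶠ v : F' in 𝓝 0, (φ 1, v) ∈ H.source :=
      (Continuous.prodMk_right (φ 1)).continuousAt.eventually (H.open_source.mem_nhds haH)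
    obtain ⟨O, hO, hOo, h0⟩ := mem_nhds_iff.1 (Filter.inter_mem ht h2)
    exact ⟨O, fun v hv => ⟨fun w hw z hz =>
      hts (Set.mk_mem_prod (hO hv).1 (hO hw).1) z hz, (hO hv).2⟩, hOo, h0⟩
  let j : F' → Quotient (MulAction.orbitRel Γ N) := fun v => π (σ₀ v)
  have hjinj : Set.InjOn j O := by
    intro v hv w hw hvw
    obtain ⟨z, hz⟩ := Quotient.exact hvw.symm
    exact (hOsub v hv).1 w hw z hz
  have htv : ∀ v ∈ O, ψ x₀ + L' v ∈ ψ.target := fun v hv => (hHA (hOsub v hv).2).2.1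
  have hπc : Continuous π := continuous_quotient_mk'
  have hjc : ContinuousOn j O := hπc.comp_continuousOn fun v hv =>
    (hσ v (htv v hv)).continuousAt.continuousWithinAt
  -- points near the slice
  let tube : Set F' → Set N := fun O' =>
    ψ.source ∩ ψ ⁻¹' (H.target ∩ H.symm ⁻¹' (Prod.snd ⁻¹' O'))
  have htube : ∀ O', IsOpen O' → IsOpen (tube O') := fun O' hO' =>
    ψ.isOpen_inter_preimage (H.symm.isOpen_inter_preimage (hO'.preimage continuous_snd))
  have htubeπ : ∀ O' x, x ∈ tube O' → π x = j (H.symm (ψ x)).2 := by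
    rintro O' x ⟨hxs, hxt, -⟩
    have hm := hHA (H.map_target hxt)
    have h1 : ψ x = ψ (φ.symm (H.symm (ψ x)).1 • σ₀ (H.symm (ψ x)).2) := by
      have := H.right_inv hxt
      rw [hH] at this
      exact this.symm
    have h2 := ψ.injOn hxs hm.2.2 h1
    calc π x = π (φ.symm (H.symm (ψ x)).1 • σ₀ (H.symm (ψ x)).2) := congrArg π h2
      _ = _ := hπs _ _
  have hσtube : ∀ v ∈ O, H.symm (ψ (σ₀ v)) = (φ 1, v) ∧ σ₀ v ∈ ψ.source ∧
      ψ (σ₀ v) ∈ H.target := by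
    intro v hv
    have hm := (hOsub v hv).2
    have h1 : H (φ 1, v) = ψ (σ₀ v) := by rw [hH]; simp [Θ, φ.left_inv hφ1]
    refine ⟨by rw [← h1, H.left_inv hm], ?_, by rw [← h1]; exact H.map_source hm⟩
    have := (hHA hm).2.2
    rwa [φ.left_inv hφ1, one_smul] at this
  have hjopen : IsOpenMap (O.domRestrict j) := by
    intro U hU
    have hU' : IsOpen ((↑) '' U : Set F') := hOopen.isOpenMap_subtype_val U hU
    have : O.domRestrict j '' U = π '' (tube ((↑) '' U)) := by
      ext q
      constructor
      · rintro ⟨v, hv, rfl⟩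
        obtain ⟨a, b, c⟩ := hσtube v v.2
        refine ⟨σ₀ v, ⟨b, c, ?_⟩, rfl⟩
        change (H.symm (ψ (σ₀ v))).2 ∈ ((↑) '' U : Set F')
        rw [a]; exact ⟨v, hv, rfl⟩
      · rintro ⟨x, hx, rfl⟩
        obtain ⟨v, hv, hve⟩ := hx.2.2
        refine ⟨v, hv, ?_⟩
        rw [htubeπ _ x hx, ← hve]; rfl
    rw [this]
    exact isOpenMap_quotient_mk'_mul _ (htube _ hU')
  let e' : OpenPartialHomeomorph F' (Quotient (MulAction.orbitRel Γ N)) :=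
    OpenPartialHomeomorph.ofContinuousOpenRestrict (hjinj.toPartialEquiv j O) hjc hjopen hOopen
  have he' : ∀ v, e' v = j v := fun v => rfl
  have he's : e'.source = O := rfl
  refine ⟨e'.symm, ⟨?_, ?_⟩, ?_⟩
  · intro x hx
    obtain ⟨v, hv, hvx⟩ : ∃ v ∈ O, j v = π x := ⟨e'.symm (π x), e'.map_target hx, e'.right_inv hx⟩
    obtain ⟨z, hz⟩ := Quotient.exact hvx
    have hz : z • x = σ₀ v := hz
    obtain ⟨a, b, c⟩ := hσtube v hv
    have hmem : z • x ∈ tube O := by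
      rw [hz]
      refine ⟨b, c, ?_⟩
      change (H.symm (ψ (σ₀ v))).2 ∈ O
      rw [a]; exact hv
    have hcz : ContinuousAt (fun x : N => z • x) x := (hsm z x).continuousAt
    -- Near any point of the orbit the chart is: translate by the fixed `z` to the slice, then take
    -- the slice coordinate of `H.symm`.
    have h1 : ContMDiffAt 𝓘(ℂ, F) 𝓘(ℂ, F) ω (fun x : N => ψ (z • x)) x :=
      (contMDiffAt_of_mem_maximalAtlas hψat hmem.1).comp x (hsm z x)
    have h2 : ContMDiffAt 𝓘(ℂ, F) 𝓘(ℂ, F') ω (fun y : F => (H.symm y).2) (ψ (z • x)) := by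
      rw [contMDiffAt_iff_contDiffAt]
      exact contDiffAt_snd.comp _ (hHsymm _ hmem.2.1)
    refine (h2.comp x h1).congr_of_eventuallyEq ?_
    filter_upwards [hcz.eventually ((htube O hOopen).mem_nhds hmem)] with y hy
    change e'.symm (π y) = (H.symm (ψ (z • y))).2
    have hy' : (H.symm (ψ (z • y))).2 ∈ O := hy.2.2
    rw [← hπs z y, htubeπ O _ hy, ← he', e'.left_inv hy']
  · intro x hx
    obtain ⟨v, hv, hvx⟩ : ∃ v ∈ O, j v = π x := ⟨e'.symm (π x), e'.map_target hx, e'.right_inv hx⟩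
    obtain ⟨z, hz⟩ := Quotient.exact hvx.symm
    have hz : z • σ₀ v = x := hz
    have hev : e'.symm (π x) = v := by rw [← hvx, ← he', e'.left_inv hv]
    refine ⟨fun u => z • σ₀ u, ?_, ?_, ?_⟩
    · rw [hev]; exact hz
    · rw [hev]
      exact (hsm z _).comp v (hσ v (htv v hv))
    · refine Filter.Eventually.of_forall fun u => ?_
      exact hπs z _
  · change π x₀ ∈ e'.target
    have := e'.map_source (x := 0) h0O
    rwa [he', show j 0 = π x₀ by simp only [j, hσ0]] at this

end SliceTheorem

/-! ### Injective orbit maps are immersions -/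

section OrbitMaps

/-- A locally injective map `o` which is equivariant for a local multiplication `m` with unit `a`
has injective differential at `a`: along integral curves of a left-invariant vector field in the
kernel of the differential, `o` would be constant. -/
theorem injective_fderiv_of_equivariant {EC E : Type*} [NormedAddCommGroup EC] [NormedSpace ℂ EC]
    [CompleteSpace EC] [NormedAddCommGroup E] [NormedSpace ℂ E] {a : EC} {m : EC × EC → EC}
    {o : EC → E} {Φ : EC × E → E}
    (hm : ContDiffAt ℂ ω m (a, a)) (hml : ∀ᶠ w in 𝓝 a, m (a, w) = w)
    (hmr : ∀ᶠ y in 𝓝 a, m (y, a) = y) (ho : ContDiffAt ℂ ω o a)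
    {U : Set EC} (hU : U ∈ 𝓝 a) (hoU : Set.InjOn o U)
    (hΦ : ContDiffAt ℂ ω Φ (a, o a)) (hΦo : ∀ᶠ p in 𝓝 (a, a), Φ (p.1, o p.2) = o (m p)) :
    Function.Injective (fderiv ℂ o a) := by
  rw [injective_iff_map_eq_zero]
  intro ξ hξ
  -- The left-invariant vector field with value `ξ` at the unit, written in the local
  -- multiplication.
  let X : EC → EC := fun y => fderiv ℂ m (y, a) (0, ξ)
  have hX : ContDiffAt ℂ 1 X a := by
    have h1 : ContDiffAt ℂ 1 (fderiv ℂ m) (a, a) := hm.fderiv_right (by simp)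
    have h2 : ContDiffAt ℂ 1 (fun y : EC => fderiv ℂ m (y, a)) a :=
      ContDiffAt.comp (g := fderiv ℂ m) (f := fun y : EC => (y, a)) a h1
        (contDiffAt_id.prodMk contDiffAt_const)
    exact h2.clm_apply contDiffAt_const
  have hdm : ∀ᶠ y in 𝓝 a, DifferentiableAt ℂ m (y, a) := by
    have h1 : ∀ᶠ p in 𝓝 (a, a), ContDiffAt ℂ ω m p := hm.eventually (by simp)
    have h2 : Filter.Tendsto (fun y : EC => (y, a)) (𝓝 a) (𝓝 (a, a)) :=
      (Continuous.prodMk_left a).tendsto a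
    exact (h2.eventually h1).mono fun y hy => hy.differentiableAt (by simp)
  have hpart : ∀ y, DifferentiableAt ℂ m (y, a) →
      HasFDerivAt (fun w => m (y, w)) ((fderiv ℂ m (y, a)).comp
        (ContinuousLinearMap.inr ℂ EC EC)) a := fun y hy =>
    HasFDerivAt.comp (g := m) (f := fun w : EC => (y, w)) a hy.hasFDerivAt
      (hasFDerivAt_prodMk_right (𝕜 := ℂ) y a)
  have hXa : X a = ξ := by
    have h1 := hpart a hdm.self_of_nhds
    have h2 : HasFDerivAt (fun w => m (a, w)) (ContinuousLinearMap.id ℂ EC) a :=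
      (hasFDerivAt_id a).congr_of_eventuallyEq hml
    have h3 := DFunLike.congr_fun (h1.unique h2) ξ
    exact h3
  -- Differentiating `Φ (y, o w) = o (m (y, w))` in `w` at the unit gives `do_y (X y) = dΦ (0, do_a
  -- ξ)`, which vanishes because `do_a ξ = 0`.
  have hkey : ∀ᶠ y in 𝓝 a, DifferentiableAt ℂ o y ∧ fderiv ℂ o y (X y) = 0 := by
    have h1 : ∀ᶠ y in 𝓝 a, ContDiffAt ℂ ω o y := ho.eventually (by simp)
    have h2 : ∀ᶠ y in 𝓝 a, ContDiffAt ℂ ω Φ (y, o a) := by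
      have h2 : Filter.Tendsto (fun y : EC => (y, o a)) (𝓝 a) (𝓝 (a, o a)) :=
        (Continuous.prodMk_left _).tendsto a
      exact h2.eventually (hΦ.eventually (by simp))
    have h3 : ∀ᶠ y in 𝓝 a, ∀ᶠ w in 𝓝 a, Φ (y, o w) = o (m (y, w)) := hΦo.curry_nhds
    filter_upwards [h1, h2, h3, hdm, hmr] with y b1 b2 b3 b4 b5
    refine ⟨b1.differentiableAt (by simp), ?_⟩
    have c1 := hpart y b4
    have b1' : HasFDerivAt o (fderiv ℂ o y) (m (y, a)) := by
      rw [b5]; exact (b1.differentiableAt (by simp)).hasFDerivAt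
    have c2 := HasFDerivAt.comp (g := o) a b1' c1
    have c3 : HasFDerivAt (fun u : E => Φ (y, u)) ((fderiv ℂ Φ (y, o a)).comp
        (ContinuousLinearMap.inr ℂ EC E)) (o a) :=
      HasFDerivAt.comp (g := Φ) (f := fun u : E => (y, u)) (o a)
        (b2.differentiableAt (by simp)).hasFDerivAt (hasFDerivAt_prodMk_right (𝕜 := ℂ) y (o a))
    have c4 := HasFDerivAt.comp (g := fun u : E => Φ (y, u)) a c3
      (ho.differentiableAt (by simp)).hasFDerivAt
    have c5 := DFunLike.congr_fun ((c2.congr_of_eventuallyEq b3).unique c4) ξ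
    have c6 : fderiv ℂ o y (X y) = fderiv ℂ Φ (y, o a) (0, fderiv ℂ o a ξ) := c5
    rw [c6, hξ]
    exact map_zero _
  have hXR : ContDiffAt ℝ 1 X a := hX.restrict_scalars ℝ
  -- A real-time integral curve of `X` suffices. Along it `o` is constant, so local injectivity
  -- makes the curve constant and its velocity `ξ` zero.
  obtain ⟨α, hα0, ε, hε, hα⟩ :=
    hXR.exists_forall_mem_closedBall_exists_eq_forall_mem_Ioo_hasDerivAt₀ 0
  have hαc : Filter.Tendsto α (𝓝 0) (𝓝 a) := by
    rw [← hα0]; exact (hα 0 (by simpa using hε)).continuousAt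
  have hev : ∀ᶠ t in 𝓝 (0 : ℝ), α t ∈ U ∧ HasDerivAt (fun t => o (α t)) 0 t := by
    filter_upwards [hαc.eventually hkey, hαc.eventually hU,
      Ioo_mem_nhds (show (0 : ℝ) - ε < 0 by linarith) (show (0 : ℝ) < 0 + ε by linarith)]
      with t b1 b2 b3
    refine ⟨b2, ?_⟩
    have h1 : HasFDerivAt o ((fderiv ℂ o (α t)).restrictScalars ℝ) (α t) :=
      b1.1.hasFDerivAt.restrictScalars ℝ
    have h2 := h1.comp_hasDerivAt t (hα t b3)
    have h3 : ((fderiv ℂ o (α t)).restrictScalars ℝ) (X (α t)) = 0 := b1.2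
    rwa [h3] at h2
  obtain ⟨δ, hδ, hball⟩ := Metric.eventually_nhds_iff_ball.1 hev
  have hconst : ∀ t ∈ Metric.ball (0 : ℝ) δ, α t = a := by
    intro t ht
    have h1 : o (α t) = o (α 0) := by
      refine Metric.isOpen_ball.is_const_of_deriv_eq_zero (convex_ball (0 : ℝ) δ).isPreconnected
        (f := fun t => o (α t)) ?_ ?_ ht (Metric.mem_ball_self hδ)
      · exact fun s hs => (hball s hs).2.differentiableAt.differentiableWithinAt
      · exact fun s hs => (hball s hs).2.deriv
    rw [← hα0]
    exact hoU (hball t ht).1 (hball 0 (Metric.mem_ball_self hδ)).1 h1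
  have hd0 : HasDerivAt α 0 0 := (hasDerivAt_const (0 : ℝ) a).congr_of_eventuallyEq
    (Filter.eventually_of_mem (Metric.ball_mem_nhds 0 hδ) hconst)
  have := (hα 0 (by simpa using hε)).unique hd0
  rwa [hα0, hXa] at this

variable {E : Type*} [NormedAddCommGroup E] [NormedSpace ℂ E]
  {M : Type*} [TopologicalSpace M] [ChartedSpace E M] [IsManifold 𝓘(ℂ, E) ω M]
  {EC : Type*} [NormedAddCommGroup EC] [NormedSpace ℂ EC] [CompleteSpace EC]
  {Γ : Type*} [TopologicalSpace Γ] [ChartedSpace EC Γ] [Group Γ] [LieGroup 𝓘(ℂ, EC) ω Γ]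

/-- An injective orbit map of a complex Lie group is an immersion at the identity. -/
theorem injective_mfderiv_orbit {o : Γ → M} (ho : ContMDiffAt 𝓘(ℂ, EC) 𝓘(ℂ, E) ω o 1)
    (hinj : Function.Injective o) {F : Γ × M → M}
    (hF : ContMDiffAt (𝓘(ℂ, EC).prod 𝓘(ℂ, E)) 𝓘(ℂ, E) ω F (1, o 1))
    (hFo : ∀ᶠ p : Γ × Γ in 𝓝 (1, 1), F (p.1, o p.2) = o (p.1 * p.2)) :
    Function.Injective (mfderiv 𝓘(ℂ, EC) 𝓘(ℂ, E) o 1) := by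
  have : IsManifold 𝓘(ℂ, EC) ω Γ := LieGroup.toContMDiffMul.toIsManifold
  set φ := chartAt EC (1 : Γ) with hφ
  set ψ := chartAt E (o 1) with hψ
  have hφat : φ ∈ IsManifold.maximalAtlas 𝓘(ℂ, EC) ω Γ := IsManifold.chart_mem_maximalAtlas _
  have hψat : ψ ∈ IsManifold.maximalAtlas 𝓘(ℂ, E) ω M := IsManifold.chart_mem_maximalAtlas _
  have hφ1 : (1 : Γ) ∈ φ.source := mem_chart_source EC _
  have hψ1 : o 1 ∈ ψ.source := mem_chart_source E _
  have hφs : ContMDiffAt 𝓘(ℂ, EC) 𝓘(ℂ, EC) ω φ.symm (φ 1) :=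
    contMDiffAt_symm_of_mem_maximalAtlas hφat (φ.map_source hφ1)
  have hφl : φ.symm (φ 1) = 1 := φ.left_inv hφ1
  have hψl : ψ.symm (ψ (o 1)) = o 1 := ψ.left_inv hψ1
  have hF1 : F (1, o 1) = o 1 := by simpa using hFo.self_of_nhds
  have hfst : ContMDiffAt 𝓘(ℂ, EC × EC) 𝓘(ℂ, EC) ω (fun p : EC × EC => φ.symm p.1)
      (φ 1, φ 1) := ContMDiffAt.comp (g := φ.symm) (φ 1, φ 1) hφs
        (contMDiffAt_iff_contDiffAt.2 contDiffAt_fst)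
  have hsnd : ContMDiffAt 𝓘(ℂ, EC × EC) 𝓘(ℂ, EC) ω (fun p : EC × EC => φ.symm p.2)
      (φ 1, φ 1) := ContMDiffAt.comp (g := φ.symm) (φ 1, φ 1) hφs
        (contMDiffAt_iff_contDiffAt.2 contDiffAt_snd)
  have hmul : ContMDiffAt 𝓘(ℂ, EC × EC) 𝓘(ℂ, EC) ω
      (fun p : EC × EC => φ.symm p.1 * φ.symm p.2) (φ 1, φ 1) := hfst.mul hsnd
  have hmul1 : φ.symm (φ 1) * φ.symm (φ 1) = 1 := by rw [hφl, one_mul]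
  have hm : ContDiffAt ℂ ω (fun p : EC × EC => φ (φ.symm p.1 * φ.symm p.2)) (φ 1, φ 1) := by
    rw [← contMDiffAt_iff_contDiffAt]
    refine ContMDiffAt.comp (g := φ) (φ 1, φ 1) ?_ hmul
    change ContMDiffAt 𝓘(ℂ, EC) 𝓘(ℂ, EC) ω φ (φ.symm (φ 1) * φ.symm (φ 1))
    rw [hmul1]
    exact contMDiffAt_of_mem_maximalAtlas hφat hφ1
  have hos : ContMDiffAt 𝓘(ℂ, EC) 𝓘(ℂ, E) ω (fun y => o (φ.symm y)) (φ 1) :=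
    ContMDiffAt.comp (g := o) (φ 1) (by rwa [hφl]) hφs
  have hψo : ContMDiffAt 𝓘(ℂ, E) 𝓘(ℂ, E) ω ψ (o 1) := contMDiffAt_of_mem_maximalAtlas hψat hψ1
  have ho' : ContDiffAt ℂ ω (fun y => ψ (o (φ.symm y))) (φ 1) := by
    rw [← contMDiffAt_iff_contDiffAt]
    exact ContMDiffAt.comp (g := ψ) (φ 1) (by rwa [hφl]) hos
  set D : EC →L[ℂ] E := mfderiv 𝓘(ℂ, EC) 𝓘(ℂ, E) o 1 with hDdef
  have hD : HasFDerivAt (fun y => ψ (o (φ.symm y))) D (φ 1) := by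
    rw [← hasFDerivWithinAt_univ]
    have h1 : HasFDerivWithinAt (writtenInExtChartAt 𝓘(ℂ, EC) 𝓘(ℂ, E) (1 : Γ) o) D (Set.range 𝓘(ℂ, EC))
        (extChartAt 𝓘(ℂ, EC) (1 : Γ) 1) :=
      (ho.mdifferentiableAt (by simp)).hasMFDerivAt.2
    simpa [writtenInExtChartAt, extChartAt, mfld_simps, Function.comp_def] using h1
  have hΦ : ContDiffAt ℂ ω (fun p : EC × E => ψ (F (φ.symm p.1, ψ.symm p.2)))
      (φ 1, ψ (o (φ.symm (φ 1)))) := by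
    rw [hφl, ← contMDiffAt_iff_contDiffAt]
    have h1 : ContMDiffAt 𝓘(ℂ, EC × E) 𝓘(ℂ, EC) ω (fun p : EC × E => φ.symm p.1)
      (φ 1, ψ (o 1)) := ContMDiffAt.comp (g := φ.symm) (φ 1, ψ (o 1)) hφs
        (contMDiffAt_iff_contDiffAt.2 contDiffAt_fst)
    have h2 : ContMDiffAt 𝓘(ℂ, EC × E) 𝓘(ℂ, E) ω (fun p : EC × E => ψ.symm p.2)
      (φ 1, ψ (o 1)) := ContMDiffAt.comp (g := ψ.symm) (φ 1, ψ (o 1))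
        (contMDiffAt_symm_of_mem_maximalAtlas hψat (ψ.map_source hψ1))
        (contMDiffAt_iff_contDiffAt.2 contDiffAt_snd)
    have h3 : ContMDiffAt 𝓘(ℂ, EC × E) 𝓘(ℂ, E) ω
        (fun p : EC × E => F (φ.symm p.1, ψ.symm p.2)) (φ 1, ψ (o 1)) :=
      ContMDiffAt.comp (g := F) (φ 1, ψ (o 1)) (by rwa [hφl, hψl]) (h1.prodMk h2)
    exact ContMDiffAt.comp (g := ψ) (φ 1, ψ (o 1)) (by rwa [hφl, hψl, hF1]) h3
  have hUs : {y | y ∈ φ.target ∧ o (φ.symm y) ∈ ψ.source} ∈ 𝓝 (φ 1) :=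
    Filter.inter_mem (φ.open_target.mem_nhds (φ.map_source hφ1))
      (hos.continuousAt.eventually (ψ.open_source.mem_nhds (by simpa only [hφl] using hψ1)))
  have key := injective_fderiv_of_equivariant hm ?_ ?_ ho' hUs ?_ hΦ ?_
  · rw [hD.fderiv] at key
    exact key
  · filter_upwards [φ.open_target.mem_nhds (φ.map_source hφ1)] with w hw
    simp [hφl, φ.right_inv hw]
  · filter_upwards [φ.open_target.mem_nhds (φ.map_source hφ1)] with w hw
    simp [hφl, φ.right_inv hw]
  · intro y hy y' hy' h
    have h1 := hinj (ψ.injOn hy.2 hy'.2 h)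
    rw [← φ.right_inv hy.1, ← φ.right_inv hy'.1, h1]
  · have t1 : Filter.Tendsto (fun p : EC × EC => (φ.symm p.1, φ.symm p.2)) (𝓝 (φ 1, φ 1))
        (𝓝 (1, 1)) := by
      have := (hfst.continuousAt.prodMk hsnd.continuousAt).tendsto
      simpa [hφl] using this
    have t2 : ∀ᶠ p : EC × EC in 𝓝 (φ 1, φ 1), φ.symm p.1 * φ.symm p.2 ∈ φ.source :=
      hmul.continuousAt.eventually (φ.open_source.mem_nhds (by simpa only [hmul1] using hφ1))
    have t3 : ∀ᶠ p : EC × EC in 𝓝 (φ 1, φ 1), o (φ.symm p.2) ∈ ψ.source :=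
      (ContMDiffAt.comp (g := o) (φ 1, φ 1) (by rwa [hφl]) hsnd).continuousAt.eventually
        (ψ.open_source.mem_nhds (by
          change o (φ.symm (φ 1)) ∈ _
          rwa [hφl]))
    filter_upwards [t1.eventually hFo, t2, t3] with p b1 b2 b3
    simp only [ψ.left_inv b3, φ.left_inv b2, b1]

end OrbitMaps

/-! ### Pullbacks of holomorphic forms -/

section ContDiffForms

variable {E E₁ : Type*} [NormedAddCommGroup E] [NormedSpace ℂ E]
  [NormedAddCommGroup E₁] [NormedSpace ℂ E₁]

/-- A continuous linear retraction of multilinear maps onto alternating ones. It transfers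
analyticity of pullbacks from multilinear maps to forms. -/
theorem exists_alternatization_clm : ∃ L : ContinuousMultilinearMap ℂ (fun _ : Fin 2 => E) ℂ →L[ℂ]
    E [⋀^Fin 2]→L[ℂ] ℂ, ∀ η : E [⋀^Fin 2]→L[ℂ] ℂ, L η.toContinuousMultilinearMap = η := by
  have happ : ∀ (f : ContinuousMultilinearMap ℂ (fun _ : Fin 2 => E) ℂ) (v : Fin 2 → E),
      ContinuousMultilinearMap.alternatization f v = f v - f (v ∘ Equiv.swap 0 1) := by
    intro f v
    rw [ContinuousMultilinearMap.alternatization_apply_apply]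
    have : (Finset.univ : Finset (Equiv.Perm (Fin 2))) = {1, Equiv.swap 0 1} := by decide
    rw [this, Finset.sum_pair (by decide)]
    simp [sub_eq_add_neg]
  let L₀ : ContinuousMultilinearMap ℂ (fun _ : Fin 2 => E) ℂ →ₗ[ℂ] E [⋀^Fin 2]→L[ℂ] ℂ :=
    -- Alternatization doubles an alternating form in two variables, hence the factor `1/2`.
    { toFun := fun f => (2⁻¹ : ℂ) • ContinuousMultilinearMap.alternatization f
      map_add' := fun f g => by rw [map_add, smul_add]
      map_smul' := fun c f => by
        ext v
        simp only [ContinuousAlternatingMap.smul_apply, happ, smul_apply,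
          smul_eq_mul, RingHom.id_apply]
        ring }
  refine ⟨L₀.mkContinuous 1 fun f => ?_, fun η => ?_⟩
  · rw [one_mul]
    refine ContinuousAlternatingMap.opNorm_le_bound _ (norm_nonneg _) fun v => ?_
    have h1 := f.le_opNorm v
    have h2 := f.le_opNorm (v ∘ Equiv.swap 0 1)
    have h3 : ∏ i, ‖(v ∘ Equiv.swap 0 1) i‖ = ∏ i, ‖v i‖ := by
      simp [Fin.prod_univ_two, mul_comm]
    rw [h3] at h2
    have h4 : L₀ f v = 2⁻¹ * (f v - f (v ∘ Equiv.swap 0 1)) := by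
      change (2⁻¹ : ℂ) • (ContinuousMultilinearMap.alternatization f v) = _
      rw [happ, smul_eq_mul]
    rw [h4, norm_mul]
    have h5 := norm_sub_le (f v) (f (v ∘ Equiv.swap 0 1))
    have h6 : ‖(2⁻¹ : ℂ)‖ = 2⁻¹ := by simp
    rw [h6]
    linarith
  · ext v
    change (2⁻¹ : ℂ) • (ContinuousMultilinearMap.alternatization η.toContinuousMultilinearMap v)
      = η v
    rw [happ, smul_eq_mul]
    have := η.toAlternatingMap.map_swap v (i := 0) (j := 1) (by simp)
    have h' : η.toContinuousMultilinearMap (v ∘ Equiv.swap 0 1) = - η v := this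
    rw [h']
    change 2⁻¹ * (η v - -η v) = η v
    ring

/-- Pulling back is linear in the form and multilinear in the two copies of the linear map, hence
analytic in both together. -/
theorem ContDiffAt.compContinuousLinearMap_form {X : Type*} [NormedAddCommGroup X] [NormedSpace ℂ X]
    {n : WithTop ℕ∞} {β : X → E [⋀^Fin 2]→L[ℂ] ℂ} {g : X → E₁ →L[ℂ] E} {x : X}
    (hβ : ContDiffAt ℂ n β x) (hg : ContDiffAt ℂ n g x) :
    ContDiffAt ℂ n (fun y => (β y).compContinuousLinearMap (g y)) x := by
  obtain ⟨L, hL⟩ := exists_alternatization_clm (E := E₁)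
  let C := ContinuousMultilinearMap.compContinuousLinearMapContinuousMultilinear ℂ
    (fun _ : Fin 2 => E₁) (fun _ : Fin 2 => E) ℂ
  have hC : ContDiff ℂ n (fun f : Fin 2 → E₁ →L[ℂ] E => C f) :=
    @ContinuousMultilinearMap.contDiff ℂ _ ((ContinuousMultilinearMap ℂ (fun _ : Fin 2 => E) ℂ) →L[ℂ]
      ContinuousMultilinearMap ℂ (fun _ : Fin 2 => E₁) ℂ) _ _ (Fin 2) (fun _ => E₁ →L[ℂ] E)
      (fun _ => inferInstance) (fun _ => inferInstance) _ C n
  have hJ : ContDiff ℂ n (fun η : E [⋀^Fin 2]→L[ℂ] ℂ => η.toContinuousMultilinearMap) :=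
    (ContinuousAlternatingMap.toContinuousMultilinearMapLI (𝕜 := ℂ) (E := E) (F := ℂ)
      (ι := Fin 2)).contDiff
  have h1 : ContDiffAt ℂ n (fun y => C fun _ => g y) x :=
    ContDiffAt.comp (g := fun f : Fin 2 → E₁ →L[ℂ] E => C f) (f := fun y _ => g y) x
      hC.contDiffAt (contDiffAt_pi.2 fun _ => hg)
  have h2 : ContDiffAt ℂ n (fun y => (β y).toContinuousMultilinearMap) x :=
    ContDiffAt.comp (g := fun η : E [⋀^Fin 2]→L[ℂ] ℂ => η.toContinuousMultilinearMap) x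
      hJ.contDiffAt hβ
  have h3 := L.contDiff.contDiffAt.comp x (h1.clm_apply h2)
  refine h3.congr_of_eventuallyEq (Filter.Eventually.of_forall fun y => ?_)
  exact (hL ((β y).compContinuousLinearMap (g y))).symm

theorem extDeriv_two_form_apply {α : E → E [⋀^Fin 2]→L[ℂ] ℂ} {p : E} (hα : DifferentiableAt ℂ α p)
    (a b c : E) :
    extDeriv α p ![a, b, c] = fderiv ℂ (fun q => α q ![b, c]) p a
      - fderiv ℂ (fun q => α q ![a, c]) p b + fderiv ℂ (fun q => α q ![a, b]) p c := by
  rw [extDeriv_apply hα, Fin.sum_univ_three]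
  have e0 : (0 : Fin 3).removeNth ![a, b, c] = ![b, c] := by
    ext i; fin_cases i <;> rfl
  have e1 : (1 : Fin 3).removeNth ![a, b, c] = ![a, c] := by
    ext i; fin_cases i <;> rfl
  have e2 : (2 : Fin 3).removeNth ![a, b, c] = ![a, b] := by
    ext i; fin_cases i <;> rfl
  rw [e0, e1, e2]
  simp [sub_eq_add_neg]

/-- A closed form which annihilates the first factor of a product does not depend on the first
variable. -/
theorem eventually_const_of_closed_of_horizontal {α : E₁ × E → (E₁ × E) [⋀^Fin 2]→L[ℂ] ℂ}
    {p : E₁ × E} (hα : ∀ᶠ q in 𝓝 p, DifferentiableAt ℂ α q)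
    (hd : ∀ᶠ q in 𝓝 p, extDeriv α q = 0)
    (hh : ∀ᶠ q in 𝓝 p, ∀ (ξ : E₁) (w : E₁ × E), α q ![(ξ, 0), w] = 0) :
    ∀ᶠ y in 𝓝 p.1, ∀ v w : E, α (y, p.2) ![(0, v), (0, w)] = α p ![(0, v), (0, w)] := by
  have ht : Filter.Tendsto (fun y : E₁ => (y, p.2)) (𝓝 p.1) (𝓝 p) :=
    (Continuous.prodMk_left p.2).tendsto p.1
  have hev := ht.eventually (hα.and (hd.and hh.eventually_nhds))
  obtain ⟨δ, hδ, hball⟩ := Metric.eventually_nhds_iff_ball.1 hev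
  refine Filter.eventually_of_mem (Metric.ball_mem_nhds p.1 hδ) fun y hy v w => ?_
  have key : ∀ y ∈ Metric.ball p.1 δ, HasFDerivAt
      (fun y => α (y, p.2) ![(0, v), (0, w)]) (0 : E₁ →L[ℂ] ℂ) y := by
    intro y hy
    obtain ⟨h1, h2, h3⟩ := hball y hy
    have hdiff : ∀ u : Fin 2 → E₁ × E, DifferentiableAt ℂ (fun q => α q u) (y, p.2) := fun u =>
      h1.continuousAlternatingMap_apply_const u
    have c1 : HasFDerivAt (fun y => α (y, p.2) ![(0, v), (0, w)])
        ((fderiv ℂ (fun q => α q ![((0 : E₁), v), (0, w)]) (y, p.2)).comp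
          (ContinuousLinearMap.inl ℂ E₁ E)) y :=
      HasFDerivAt.comp (g := fun q => α q ![((0 : E₁), v), (0, w)]) (f := fun y : E₁ => (y, p.2)) y
        (hdiff _).hasFDerivAt (hasFDerivAt_prodMk_left (𝕜 := ℂ) y p.2)
    have c2 : (fderiv ℂ (fun q => α q ![((0 : E₁), v), (0, w)]) (y, p.2)).comp
          (ContinuousLinearMap.inl ℂ E₁ E) = 0 := by
      ext ξ
      -- Of the three terms of `dα (ξ, v, w)`, two differentiate `α (ξ, ·)`, which vanishes in a
      -- neighbourhood. What remains is the `ξ`-derivative of `α (v, w)`.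
      have d1 := extDeriv_two_form_apply h1 (ξ, 0) (0, v) (0, w)
      have d2 : ∀ u : E₁ × E, fderiv ℂ (fun q => α q ![(ξ, 0), u]) (y, p.2) = 0 := by
        intro u
        have : (fun q => α q ![(ξ, 0), u]) =ᶠ[𝓝 (y, p.2)] fun _ => (0 : ℂ) :=
          h3.mono fun q hq => hq ξ u
        rw [this.fderiv_eq]
        exact fderiv_const_apply _
      rw [h2, d2, d2] at d1
      simpa using d1.symm
    rwa [c2] at c1
  refine Metric.isOpen_ball.is_const_of_fderiv_eq_zero (𝕜 := ℂ)
    ((convex_ball p.1 δ).isPreconnected)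
    (f := fun y => α (y, p.2) ![(0, v), (0, w)]) ?_ ?_ hy (Metric.mem_ball_self hδ)
  · exact fun s hs => (key s hs).differentiableAt.differentiableWithinAt
  · exact fun s hs => (key s hs).fderiv

end ContDiffForms

/-! ### Pullbacks along maps between manifolds -/

section Pullback

variable {E : Type*} [NormedAddCommGroup E] [NormedSpace ℂ E]
  {M : Type*} [TopologicalSpace M] [ChartedSpace E M]
  {E₁ : Type*} [NormedAddCommGroup E₁] [NormedSpace ℂ E₁]
  {M₁ : Type*} [TopologicalSpace M₁] [ChartedSpace E₁ M₁]
  {E₂ : Type*} [NormedAddCommGroup E₂] [NormedSpace ℂ E₂]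
  {M₂ : Type*} [TopologicalSpace M₂] [ChartedSpace E₂ M₂]

theorem pullback_apply (f : M₁ → M) (η : TwoForm E M) (x : M₁) (v w : TangentSpace 𝓘(ℂ, E₁) x) :
    pullback (E := E₁) f η x ![v, w] =
      η (f x) ![mfderiv 𝓘(ℂ, E₁) 𝓘(ℂ, E) f x v, mfderiv 𝓘(ℂ, E₁) 𝓘(ℂ, E) f x w] := by
  change η (f x) (mfderiv 𝓘(ℂ, E₁) 𝓘(ℂ, E) f x ∘ ![v, w]) = _
  congr 1
  ext i; fin_cases i <;> rfl

theorem pullback_comp_apply {f : M₁ → M₂} {g : M₂ → M} {x : M₁} (η : TwoForm E M)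
    (hf : MDifferentiableAt 𝓘(ℂ, E₁) 𝓘(ℂ, E₂) f x)
    (hg : MDifferentiableAt 𝓘(ℂ, E₂) 𝓘(ℂ, E) g (f x)) :
    pullback (E := E₁) (fun x => g (f x)) η x =
      pullback (E := E₁) f (pullback (E := E₂) g η) x := by
  apply form_ext
  intro v w
  rw [pullback_apply, pullback_apply, pullback_apply]
  have : mfderiv 𝓘(ℂ, E₁) 𝓘(ℂ, E) (fun x => g (f x)) x =
    (mfderiv 𝓘(ℂ, E₂) 𝓘(ℂ, E) g (f x)).comp (mfderiv 𝓘(ℂ, E₁) 𝓘(ℂ, E₂) f x) :=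
      mfderiv_comp x hg hf
  rw [this]
  rfl

theorem pullback_congr {f g : M₁ → M} {x : M₁} (η : TwoForm E M) (h : f =ᶠ[𝓝 x] g) :
    pullback (E := E₁) f η x = pullback (E := E₁) g η x := by
  apply form_ext
  intro v w
  rw [pullback_apply, pullback_apply, h.mfderiv_eq, h.self_of_nhds]

/-- The pullback of a form along a map from a vector space. -/
def modelPullback (s : E₁ → M) (η : TwoForm E M) : E₁ → E₁ [⋀^Fin 2]→L[ℂ] ℂ :=
  fun y => pullback (E := E₁) (M := E₁) s η y

section Holomorphic

variable [IsManifold 𝓘(ℂ, E) ω M] {s : E₁ → M} {y : E₁}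

theorem contDiffAt_chart_comp (hs : ContMDiffAt 𝓘(ℂ, E₁) 𝓘(ℂ, E) ω s y) :
    ContDiffAt ℂ ω (fun z => chartAt E (s y) (s z)) y := by
  rw [← contMDiffAt_iff_contDiffAt]
  exact ContMDiffAt.comp (g := chartAt E (s y)) y (contMDiffAt_of_mem_maximalAtlas
    (IsManifold.chart_mem_maximalAtlas _) (mem_chart_source E _)) hs

/-- Locally `s` factors through a chart of `M`, so the pullback becomes one between open sets of
vector spaces, where analyticity and the exterior derivative are accessible. -/
theorem modelPullback_eventuallyEq (hs : ContMDiffAt 𝓘(ℂ, E₁) 𝓘(ℂ, E) ω s y)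
    (η : TwoForm E M) :
    modelPullback s η =ᶠ[𝓝 y] fun z => (inChart (chartAt E (s y)) η
      (chartAt E (s y) (s z))).compContinuousLinearMap
        (fderiv ℂ (fun z => chartAt E (s y) (s z)) z) := by
  set e := chartAt E (s y) with he
  have heat : e ∈ IsManifold.maximalAtlas 𝓘(ℂ, E) ω M := IsManifold.chart_mem_maximalAtlas _
  have h1 : ∀ᶠ z in 𝓝 y, s z ∈ e.source :=
    hs.continuousAt.eventually (e.open_source.mem_nhds (mem_chart_source E _))
  have h2 : ∀ᶠ z in 𝓝 y, ContDiffAt ℂ ω (fun z => e (s z)) z :=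
    (contDiffAt_chart_comp hs).eventually (by simp)
  filter_upwards [h1.eventually_nhds, h2] with z b1 b2
  have c1 : s =ᶠ[𝓝 z] fun z => e.symm (e (s z)) := b1.mono fun w hw => (e.left_inv hw).symm
  have c2 : MDifferentiableAt 𝓘(ℂ, E₁) 𝓘(ℂ, E) (fun z => e (s z)) z :=
    (b2.differentiableAt (by simp)).mdifferentiableAt
  have c3 : MDifferentiableAt 𝓘(ℂ, E) 𝓘(ℂ, E) e.symm (e (s z)) :=
    (contMDiffAt_symm_of_mem_maximalAtlas heat
      (e.map_source b1.self_of_nhds)).mdifferentiableAt (by simp)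
  have c4 := pullback_comp_apply (f := fun z => e (s z)) (g := e.symm) η c2 c3
  change pullback (E := E₁) (M := E₁) s η z = _
  rw [pullback_congr η c1, c4, ← mfderiv_eq_fderiv]
  rfl

theorem contDiffAt_modelPullback (hs : ContMDiffAt 𝓘(ℂ, E₁) 𝓘(ℂ, E) ω s y) {η : TwoForm E M}
    (hη : IsHolomorphic η) : ContDiffAt ℂ ω (modelPullback s η) y := by
  refine ContDiffAt.congr_of_eventuallyEq ?_ (modelPullback_eventuallyEq hs η)
  have h1 : AnalyticAt ℂ (inChart (chartAt E (s y)) η) (chartAt E (s y) (s y)) :=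
    hη _ (chart_mem_atlas E _) _ ((chartAt E (s y)).map_source (mem_chart_source E _))
  have h2 := contDiffAt_chart_comp hs
  refine ContDiffAt.compContinuousLinearMap_form ?_ (h2.fderiv_right (by simp))
  exact ContDiffAt.comp (g := inChart (chartAt E (s y)) η) y h1.contDiffAt h2

theorem extDeriv_modelPullback (hs : ContMDiffAt 𝓘(ℂ, E₁) 𝓘(ℂ, E) ω s y) {η : TwoForm E M}
    (hη : IsHolomorphic η) (hc : IsClosedForm η) : extDeriv (modelPullback s η) y = 0 := by
  rw [(modelPullback_eventuallyEq hs η).extDeriv_eq]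
  have ht := (chartAt E (s y)).map_source (mem_chart_source E (s y))
  have h1 : AnalyticAt ℂ (inChart (chartAt E (s y)) η) (chartAt E (s y) (s y)) :=
    hη _ (chart_mem_atlas E _) _ ht
  have h2 := extDeriv_pullback (f := fun z => chartAt E (s y) (s z)) h1.differentiableAt
    (contDiffAt_chart_comp hs) (by simp)
  rw [h2, hc _ (chart_mem_atlas E _) _ ht]
  ext v
  rfl

end Holomorphic

end Pullback

/-! ### Invariance and descent of forms -/

theorem mfderiv_comp_apply_eq {𝕜 : Type*} [NontriviallyNormedField 𝕜]
    {E₁ E₂ E₃ : Type*} [NormedAddCommGroup E₁] [NormedSpace 𝕜 E₁] [NormedAddCommGroup E₂]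
    [NormedSpace 𝕜 E₂] [NormedAddCommGroup E₃] [NormedSpace 𝕜 E₃]
    {M₁ M₂ M₃ : Type*} [TopologicalSpace M₁] [ChartedSpace E₁ M₁] [TopologicalSpace M₂]
    [ChartedSpace E₂ M₂] [TopologicalSpace M₃] [ChartedSpace E₃ M₃]
    {f : M₁ → M₂} {g : M₂ → M₃} {a : M₁} {b : M₂}
    (hg : MDifferentiableAt 𝓘(𝕜, E₂) 𝓘(𝕜, E₃) g b) (hf : MDifferentiableAt 𝓘(𝕜, E₁) 𝓘(𝕜, E₂) f a)
    (hb : f a = b) (v : E₁) :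
    (mfderiv 𝓘(𝕜, E₁) 𝓘(𝕜, E₃) (fun a => g (f a)) a v : E₃)
      = mfderiv 𝓘(𝕜, E₂) 𝓘(𝕜, E₃) g b (mfderiv 𝓘(𝕜, E₁) 𝓘(𝕜, E₂) f a v : E₂) := by
  subst hb
  exact DFunLike.congr_fun (mfderiv_comp a hg hf) v

section Invariance

variable {E : Type*} [NormedAddCommGroup E] [NormedSpace ℂ E]
  {M : Type*} [TopologicalSpace M] [ChartedSpace E M] [IsManifold 𝓘(ℂ, E) ω M]
  {F : Type*} [NormedAddCommGroup F] [NormedSpace ℂ F]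
  {N : Type*} [TopologicalSpace N] [ChartedSpace F N] [IsManifold 𝓘(ℂ, F) ω N]
  {EC : Type*} [NormedAddCommGroup EC] [NormedSpace ℂ EC]
  {Γ : Type*} [TopologicalSpace Γ] [ChartedSpace EC Γ] [Group Γ] [LieGroup 𝓘(ℂ, EC) ω Γ]
  [MulAction Γ N]

-- The type of `β n` depends on `n`, so the base point and the vectors are replaced together.
omit [IsManifold 𝓘(ℂ, F) ω N] in
theorem twoForm_congr (β : TwoForm F N) {n n' : N} (h : n = n') {a a' b b' : F} (ha : a = a')
    (hb : b = b') : (β n : F [⋀^Fin 2]→L[ℂ] ℂ) ![a, b] = (β n' : F [⋀^Fin 2]→L[ℂ] ℂ) ![a', b'] := by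
  subst h ha hb
  rfl

theorem mfderiv_chart_symm_apply (x : N) (v : TangentSpace 𝓘(ℂ, F) x) :
    mfderiv 𝓘(ℂ, F) 𝓘(ℂ, F) (chartAt F x).symm (chartAt F x x)
      (mfderiv 𝓘(ℂ, F) 𝓘(ℂ, F) (chartAt F x) x v) = v := by
  have hat : chartAt F x ∈ IsManifold.maximalAtlas 𝓘(ℂ, F) ω N :=
    IsManifold.chart_mem_maximalAtlas _
  have hx := mem_chart_source F x
  have h1 : MDifferentiableAt 𝓘(ℂ, F) 𝓘(ℂ, F) (chartAt F x) x :=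
    (contMDiffAt_of_mem_maximalAtlas hat hx).mdifferentiableAt (by simp)
  have h2 : MDifferentiableAt 𝓘(ℂ, F) 𝓘(ℂ, F) (chartAt F x).symm (chartAt F x x) :=
    (contMDiffAt_symm_of_mem_maximalAtlas hat
      ((chartAt F x).map_source hx)).mdifferentiableAt (by simp)
  have h3 := mfderiv_comp x h2 h1
  have h4 : ((chartAt F x).symm ∘ chartAt F x) =ᶠ[𝓝 x] id := by
    filter_upwards [(chartAt F x).open_source.mem_nhds hx] with y hy
    exact (chartAt F x).left_inv hy
  rw [h4.mfderiv_eq, mfderiv_id] at h3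
  exact (DFunLike.congr_fun h3 v).symm

variable (hact : ContMDiff (𝓘(ℂ, EC).prod 𝓘(ℂ, F)) 𝓘(ℂ, F) ω (fun p : Γ × N => p.1 • p.2))
include hact

omit [IsManifold 𝓘(ℂ, F) ω N] [LieGroup 𝓘(ℂ, EC) ω Γ] in
theorem contMDiff_orbit (x : N) : ContMDiff 𝓘(ℂ, EC) 𝓘(ℂ, F) ω (fun z : Γ => z • x) :=
  hact.comp (contMDiff_id.prodMk contMDiff_const)

omit [IsManifold 𝓘(ℂ, F) ω N] [LieGroup 𝓘(ℂ, EC) ω Γ] in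
theorem contMDiff_smul_left (z : Γ) : ContMDiff 𝓘(ℂ, F) 𝓘(ℂ, F) ω (fun x : N => z • x) :=
  hact.comp (contMDiff_const.prodMk contMDiff_id)

omit [IsManifold 𝓘(ℂ, F) ω N] [LieGroup 𝓘(ℂ, EC) ω Γ] in
theorem contMDiffAt_action_charts {φ : OpenPartialHomeomorph Γ EC} {ψ : OpenPartialHomeomorph N F}
    (hφ : φ ∈ IsManifold.maximalAtlas 𝓘(ℂ, EC) ω Γ) (hψ : ψ ∈ IsManifold.maximalAtlas 𝓘(ℂ, F) ω N)
    {p : EC × F} (hp : p.1 ∈ φ.target) (hp' : p.2 ∈ ψ.target) :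
    ContMDiffAt 𝓘(ℂ, EC × F) 𝓘(ℂ, F) ω (fun p : EC × F => φ.symm p.1 • ψ.symm p.2) p := by
  have h1 : ContMDiffAt 𝓘(ℂ, EC × F) 𝓘(ℂ, EC) ω (fun p : EC × F => φ.symm p.1) p :=
    ContMDiffAt.comp (g := φ.symm) p (contMDiffAt_symm_of_mem_maximalAtlas hφ hp)
      (contMDiffAt_iff_contDiffAt.2 contDiffAt_fst)
  have h2 : ContMDiffAt 𝓘(ℂ, EC × F) 𝓘(ℂ, F) ω (fun p : EC × F => ψ.symm p.2) p :=
    ContMDiffAt.comp (g := ψ.symm) p (contMDiffAt_symm_of_mem_maximalAtlas hψ hp')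
      (contMDiffAt_iff_contDiffAt.2 contDiffAt_snd)
  exact (hact _).comp p (h1.prodMk h2)

-- Writing `g • u = (g h⁻¹) • (h • u)` with `h = φ.symm p.1` fixed turns a derivative in the group
-- variable at `h` into an orbit direction at the image point.
omit [IsManifold 𝓘(ℂ, F) ω N] in
theorem mfderiv_action_charts_left {φ : OpenPartialHomeomorph Γ EC}
    {ψ : OpenPartialHomeomorph N F} (hφ : φ ∈ IsManifold.maximalAtlas 𝓘(ℂ, EC) ω Γ)
    (hψ : ψ ∈ IsManifold.maximalAtlas 𝓘(ℂ, F) ω N) {p : EC × F} (hp : p.1 ∈ φ.target)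
    (hp' : p.2 ∈ ψ.target) (ξ : EC) :
    ∃ ζ : EC, mfderiv 𝓘(ℂ, EC × F) 𝓘(ℂ, F) (fun p : EC × F => φ.symm p.1 • ψ.symm p.2) p (ξ, 0)
      = mfderiv 𝓘(ℂ, EC) 𝓘(ℂ, F) (fun z : Γ => z • (φ.symm p.1 • ψ.symm p.2)) 1 ζ := by
  have hA := (contMDiffAt_action_charts hact hφ hψ hp hp').mdifferentiableAt (by simp)
  have hi : HasFDerivAt (fun y : EC => (y, p.2)) (ContinuousLinearMap.inl ℂ EC F) p.1 :=
    hasFDerivAt_prodMk_left (𝕜 := ℂ) p.1 p.2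
  have h1 := mfderiv_comp p.1 (g := fun p : EC × F => φ.symm p.1 • ψ.symm p.2)
    (f := fun y : EC => (y, p.2)) hA hi.hasMFDerivAt.mdifferentiableAt
  rw [hi.hasMFDerivAt.mfderiv] at h1
  have hφs : ContMDiffAt 𝓘(ℂ, EC) 𝓘(ℂ, EC) ω φ.symm p.1 :=
    contMDiffAt_symm_of_mem_maximalAtlas hφ hp
  have hr : ContMDiffAt 𝓘(ℂ, EC) 𝓘(ℂ, EC) ω (fun y => φ.symm y * (φ.symm p.1)⁻¹) p.1 :=
    hφs.mul contMDiffAt_const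
  have ho := contMDiff_orbit hact (φ.symm p.1 • ψ.symm p.2)
  have h2 := mfderiv_comp_apply_eq (b := (1 : Γ))
    (g := fun z : Γ => z • (φ.symm p.1 • ψ.symm p.2))
    (f := fun y => φ.symm y * (φ.symm p.1)⁻¹) ((ho 1).mdifferentiableAt (by simp))
    (hr.mdifferentiableAt (by simp)) (mul_inv_cancel _) ξ
  have h3 : (fun y => (φ.symm y * (φ.symm p.1)⁻¹) • (φ.symm p.1 • ψ.symm p.2))
      = (fun p : EC × F => φ.symm p.1 • ψ.symm p.2) ∘ (fun y : EC => (y, p.2)) := by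
    ext y
    simp [← mul_smul]
  rw [h3] at h2
  refine ⟨mfderiv 𝓘(ℂ, EC) 𝓘(ℂ, EC) (fun y => φ.symm y * (φ.symm p.1)⁻¹) p.1 ξ, ?_⟩
  exact Eq.trans (DFunLike.congr_fun h1 ξ).symm h2

omit [LieGroup 𝓘(ℂ, EC) ω Γ] in
theorem mfderiv_action_charts_right {φ : OpenPartialHomeomorph Γ EC}
    (hφ : φ ∈ IsManifold.maximalAtlas 𝓘(ℂ, EC) ω Γ) (x : N) {z : Γ} (hz : z ∈ φ.source)
    (v : TangentSpace 𝓘(ℂ, F) x) :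
    (mfderiv 𝓘(ℂ, EC × F) 𝓘(ℂ, F) (fun p : EC × F => φ.symm p.1 • (chartAt F x).symm p.2)
      (φ z, chartAt F x x) (0, (mfderiv 𝓘(ℂ, F) 𝓘(ℂ, F) (chartAt F x) x v : F)) : F)
      = mfderiv 𝓘(ℂ, F) 𝓘(ℂ, F) (fun x : N => z • x) x v := by
  have hψ : chartAt F x ∈ IsManifold.maximalAtlas 𝓘(ℂ, F) ω N :=
    IsManifold.chart_mem_maximalAtlas _
  have hx := mem_chart_source F x
  have hA := (contMDiffAt_action_charts (p := (φ z, chartAt F x x)) hact hφ hψ (φ.map_source hz)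
    ((chartAt F x).map_source hx)).mdifferentiableAt (by simp)
  have hi : HasFDerivAt (fun u : F => (φ z, u)) (ContinuousLinearMap.inr ℂ EC F)
      (chartAt F x x) := hasFDerivAt_prodMk_right (𝕜 := ℂ) (φ z) (chartAt F x x)
  set v' : F := mfderiv 𝓘(ℂ, F) 𝓘(ℂ, F) (chartAt F x) x v with hv'
  have h1 := mfderiv_comp (chartAt F x x)
    (g := fun p : EC × F => φ.symm p.1 • (chartAt F x).symm p.2)
    (f := fun u : F => (φ z, u)) hA hi.hasMFDerivAt.mdifferentiableAt
  rw [hi.hasMFDerivAt.mfderiv] at h1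
  have h2 := mfderiv_comp_apply_eq (b := x) (g := fun x : N => z • x)
    (f := (chartAt F x).symm) (a := chartAt F x x)
    ((contMDiff_smul_left hact z x).mdifferentiableAt (by simp))
    ((contMDiffAt_symm_of_mem_maximalAtlas hψ
      ((chartAt F x).map_source hx)).mdifferentiableAt (by simp)) ((chartAt F x).left_inv hx) v'
  have h3 : (fun u : F => z • (chartAt F x).symm u) =
      (fun p : EC × F => φ.symm p.1 • (chartAt F x).symm p.2) ∘ fun u : F => (φ z, u) := by
    ext u
    simp [φ.left_inv hz]
  rw [h3] at h2
  refine (Eq.trans (DFunLike.congr_fun h1 v').symm h2).trans ?_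
  exact congrArg (mfderiv 𝓘(ℂ, F) 𝓘(ℂ, F) (fun x : N => z • x) x)
    (mfderiv_chart_symm_apply x v)

/-- The restriction of a closed form which is annihilated by orbit directions is locally constant
along the group. -/
theorem eventually_pullback_smul_eq {j : N → M} (hj : ContMDiff 𝓘(ℂ, F) 𝓘(ℂ, E) ω j)
    {η : TwoForm E M} (hη : IsHolomorphic η) (hc : IsClosedForm η)
    (hor : ∀ (x : N) (ξ : EC) (v : F), (pullback (E := F) j η x : F [⋀^Fin 2]→L[ℂ] ℂ)
      ![(mfderiv 𝓘(ℂ, EC) 𝓘(ℂ, F) (fun z : Γ => z • x) 1 ξ : F), v] = 0)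
    (z₀ : Γ) (x : N) (v w : TangentSpace 𝓘(ℂ, F) x) :
    ∀ᶠ z in 𝓝 z₀, pullback (E := F) (fun x : N => z • x) (pullback (E := F) j η) x ![v, w]
      = pullback (E := F) (fun x : N => z₀ • x) (pullback (E := F) j η) x ![v, w] := by
  have : IsManifold 𝓘(ℂ, EC) ω Γ := LieGroup.toContMDiffMul.toIsManifold
  set φ := chartAt EC z₀ with hφdef
  set ψ := chartAt F x with hψdef
  have hφ : φ ∈ IsManifold.maximalAtlas 𝓘(ℂ, EC) ω Γ := IsManifold.chart_mem_maximalAtlas _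
  have hψ : ψ ∈ IsManifold.maximalAtlas 𝓘(ℂ, F) ω N := IsManifold.chart_mem_maximalAtlas _
  have hz₀ : z₀ ∈ φ.source := mem_chart_source EC _
  have hx : x ∈ ψ.source := mem_chart_source F _
  set A : EC × F → N := fun p => φ.symm p.1 • ψ.symm p.2 with hA
  have hAs : ∀ p : EC × F, p.1 ∈ φ.target → p.2 ∈ ψ.target →
      ContMDiffAt 𝓘(ℂ, EC × F) 𝓘(ℂ, F) ω A p := fun p h h' =>
    contMDiffAt_action_charts hact hφ hψ h h'
  have hT : φ.target ×ˢ ψ.target ∈ 𝓝 (φ z₀, ψ x) :=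
    prod_mem_nhds (φ.open_target.mem_nhds (φ.map_source hz₀))
      (ψ.open_target.mem_nhds (ψ.map_source hx))
  have hAj : ∀ p ∈ φ.target ×ˢ ψ.target,
      ContMDiffAt 𝓘(ℂ, EC × F) 𝓘(ℂ, E) ω (fun p => j (A p)) p := fun p hp =>
    (hj _).comp p (hAs p hp.1 hp.2)
  have hval : ∀ p ∈ φ.target ×ˢ ψ.target, ∀ a b : EC × F,
      modelPullback (fun p => j (A p)) η p ![a, b] = pullback (E := F) j η (A p)
        ![mfderiv 𝓘(ℂ, EC × F) 𝓘(ℂ, F) A p a, mfderiv 𝓘(ℂ, EC × F) 𝓘(ℂ, F) A p b] := by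
    intro p hp a b
    have h1 := pullback_comp_apply η ((hAs p hp.1 hp.2).mdifferentiableAt (by simp))
      ((hj _).mdifferentiableAt (by simp))
    have h2 : modelPullback (fun p => j (A p)) η p
      = pullback (E := EC × F) A (pullback (E := F) j η) p := h1
    rw [h2]
    exact pullback_apply A _ p a b
  -- On `EC × F` the pulled-back form is closed, and it is annihilated by the group directions
  -- because these are sent to orbit directions. So it does not depend on the group variable.
  have hconst := eventually_const_of_closed_of_horizontal
    (α := modelPullback (fun p => j (A p)) η) (p := (φ z₀, ψ x)) ?_ ?_ ?_
  · have h1 : ∀ᶠ z in 𝓝 z₀, z ∈ φ.source := φ.open_source.mem_nhds hz₀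
    have key : ∀ z ∈ φ.source, modelPullback (fun p => j (A p)) η (φ z, ψ x)
        ![(0, (mfderiv 𝓘(ℂ, F) 𝓘(ℂ, F) ψ x v : F)), (0, (mfderiv 𝓘(ℂ, F) 𝓘(ℂ, F) ψ x w : F))]
        = pullback (E := F) (fun x : N => z • x) (pullback (E := F) j η) x ![v, w] := by
      intro z hz
      rw [hval _ ⟨φ.map_source hz, ψ.map_source hx⟩]
      refine Eq.trans ?_ (pullback_apply _ _ _ _ _).symm
      refine twoForm_congr (pullback (E := F) j η) ?_ (mfderiv_action_charts_right hact hφ x hz v)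
        (mfderiv_action_charts_right hact hφ x hz w)
      simp only [hA, φ.left_inv hz, ψ.left_inv hx]
    filter_upwards [h1, (φ.continuousAt hz₀).eventually hconst] with z b1 b2
    rw [← key z b1, ← key z₀ hz₀]
    exact b2 _ _
  · filter_upwards [hT] with p hp
    exact (contDiffAt_modelPullback (hAj p hp) hη).differentiableAt (by simp)
  · filter_upwards [hT] with p hp
    exact extDeriv_modelPullback (hAj p hp) hη hc
  · filter_upwards [hT] with p hp ξ u
    rw [hval p hp]
    obtain ⟨ζ, hζ⟩ := mfderiv_action_charts_left hact hφ hψ hp.1 hp.2 ξ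
    have h1 := hor (A p) ζ (mfderiv 𝓘(ℂ, EC × F) 𝓘(ℂ, F) A p u : F)
    refine Eq.trans ?_ h1
    exact twoForm_congr (pullback (E := F) j η) rfl hζ rfl

/-- Evaluated at fixed vectors, the translated form is locally constant in the group element, and a
path has connected domain. -/
theorem pullback_smul_eq_of_path {j : N → M} (hj : ContMDiff 𝓘(ℂ, F) 𝓘(ℂ, E) ω j)
    {η : TwoForm E M} (hη : IsHolomorphic η) (hc : IsClosedForm η)
    (hor : ∀ (x : N) (ξ : EC) (v : F), (pullback (E := F) j η x : F [⋀^Fin 2]→L[ℂ] ℂ)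
      ![(mfderiv 𝓘(ℂ, EC) 𝓘(ℂ, F) (fun z : Γ => z • x) 1 ξ : F), v] = 0)
    {γ : ℝ → Γ} (hγ : Continuous γ) (s t : ℝ) :
    pullback (E := F) (fun x : N => γ s • x) (pullback (E := F) j η)
      = pullback (E := F) (fun x : N => γ t • x) (pullback (E := F) j η) := by
  ext1 x
  apply form_ext
  intro v w
  have h1 : IsLocallyConstant fun z : Γ =>
      pullback (E := F) (fun x : N => z • x) (pullback (E := F) j η) x ![v, w] :=
    (IsLocallyConstant.iff_eventually_eq _).2 fun z₀ =>
      eventually_pullback_smul_eq hact hj hη hc hor z₀ x v w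
  exact (h1.comp_continuous hγ).apply_eq_of_preconnectedSpace s t

end Invariance

/-! ### Descent of forms to the orbit space -/

section Descent

variable {E : Type*} [NormedAddCommGroup E] [NormedSpace ℂ E]
  {M : Type*} [TopologicalSpace M] [ChartedSpace E M] [IsManifold 𝓘(ℂ, E) ω M]
  {F : Type*} [NormedAddCommGroup F] [NormedSpace ℂ F]
  {N : Type*} [TopologicalSpace N] [ChartedSpace F N] [IsManifold 𝓘(ℂ, F) ω N]
  {EC : Type*} [NormedAddCommGroup EC] [NormedSpace ℂ EC]
  {Γ : Type*} [TopologicalSpace Γ] [ChartedSpace EC Γ] [Group Γ]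
  [MulAction Γ N]
  {F' : Type*} [NormedAddCommGroup F'] [NormedSpace ℂ F']

omit [IsManifold 𝓘(ℂ, F) ω N] in
/-- An invariant form annihilated by orbit directions descends to the orbit space. -/
theorem exists_pullback_mk_eq [FiniteDimensional ℂ F']
    [ChartedSpace F' (Quotient (MulAction.orbitRel Γ N))]
    (hact : ContMDiff (𝓘(ℂ, EC).prod 𝓘(ℂ, F)) 𝓘(ℂ, F) ω (fun p : Γ × N => p.1 • p.2))
    (hπ : ContMDiff 𝓘(ℂ, F) 𝓘(ℂ, F') ω (Quotient.mk (MulAction.orbitRel Γ N)))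
    (hsub : ∀ x : N, Function.Surjective
      (mfderiv 𝓘(ℂ, F) 𝓘(ℂ, F') (Quotient.mk (MulAction.orbitRel Γ N)) x))
    (hker : ∀ (x : N) (v : F),
      (mfderiv 𝓘(ℂ, F) 𝓘(ℂ, F') (Quotient.mk (MulAction.orbitRel Γ N)) x v : F') = 0 →
      ∃ ξ : EC, (mfderiv 𝓘(ℂ, EC) 𝓘(ℂ, F) (fun z : Γ => z • x) 1 ξ : F) = v)
    {β : TwoForm F N}
    (hor : ∀ (x : N) (ξ : EC) (v : F), (β x : F [⋀^Fin 2]→L[ℂ] ℂ)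
      ![(mfderiv 𝓘(ℂ, EC) 𝓘(ℂ, F) (fun z : Γ => z • x) 1 ξ : F), v] = 0)
    (hinv : ∀ z : Γ, pullback (E := F) (fun x : N => z • x) β = β) :
    ∃ η' : TwoForm F' (Quotient (MulAction.orbitRel Γ N)),
      pullback (E := F) (Quotient.mk (MulAction.orbitRel Γ N)) η' = β := by
  set π : N → Quotient (MulAction.orbitRel Γ N) := Quotient.mk (MulAction.orbitRel Γ N) with hπdef
  let B : N → F [⋀^Fin 2]→L[ℂ] ℂ := β
  let D : N → F →L[ℂ] F' := fun x => mfderiv 𝓘(ℂ, F) 𝓘(ℂ, F') π x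
  have hR : ∀ x, ∃ R : F' →L[ℂ] F, ∀ u, D x (R u) = u := by
    intro x
    obtain ⟨R, hR⟩ := LinearMap.exists_rightInverse_of_surjective (D x : F →ₗ[ℂ] F')
      (LinearMap.range_eq_top.2 (hsub x))
    exact ⟨LinearMap.toContinuousLinearMap R, fun u => DFunLike.congr_fun hR u⟩
  choose R hR using hR
  have hor' : ∀ x k v, D x k = 0 → B x ![k, v] = 0 := by
    intro x k v hk
    obtain ⟨ξ, rfl⟩ := hker x k hk
    exact hor x ξ v
  have hor'' : ∀ x k v, D x k = 0 → B x ![v, k] = 0 := by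
    intro x k v hk
    rw [form_swap, hor' x k v hk, neg_zero]
  have hbase : ∀ x u v u' v', D x u = D x u' → D x v = D x v' → B x ![u, v] = B x ![u', v'] := by
    intro x u v u' v' hu hv
    have e1 : u = u' + (u - u') := by abel
    have e2 : v = v' + (v - v') := by abel
    rw [e1, form_add_left, hor' x (u - u') v (by rw [map_sub, hu, sub_self]), add_zero]
    rw [e2, form_add_right, hor'' x (v - v') u' (by rw [map_sub, hv, sub_self]), add_zero]
  -- The form is defined with a chosen representative of each orbit and a chosen right inverse of
  -- the differential. `hbase` shows that the right inverse does not matter, and invariance that the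
  -- representative does not.
  refine ⟨fun q => (B q.out).compContinuousLinearMap (R q.out), ?_⟩
  ext1 x
  apply form_ext
  intro v w
  obtain ⟨z, hz⟩ : ∃ z : Γ, z • x = (π x).out := Quotient.exact (π x).out_eq
  let A : F →L[ℂ] F := mfderiv 𝓘(ℂ, F) 𝓘(ℂ, F) (fun x : N => z • x) x
  have hDA : ∀ u : F, D (π x).out (A u) = D x u := by
    intro u
    have h1 := mfderiv_comp_apply_eq (g := π) (f := fun x : N => z • x) (a := x) (b := (π x).out)
      ((hπ _).mdifferentiableAt (by simp))
      ((contMDiff_smul_left hact z x).mdifferentiableAt (by simp)) hz u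
    have h2 : (fun x : N => π (z • x)) = π := funext fun x => Quotient.sound ⟨z, rfl⟩
    rw [h2] at h1
    exact h1.symm
  have h1 : B x ![v, w] = B (π x).out ![A v, A w] := by
    have h2 := congrFun (hinv z) x
    have h3 : β x ![v, w] = pullback (E := F) (fun x : N => z • x) β x ![v, w] := by rw [h2]
    refine Eq.trans h3 ((pullback_apply _ _ _ _ _).trans ?_)
    exact twoForm_congr β hz rfl rfl
  rw [pullback_apply]
  refine Eq.trans ?_ h1.symm
  have h2 : ∀ u u' : F', (B (π x).out).compContinuousLinearMap (R (π x).out) ![u, u']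
      = B (π x).out ![R (π x).out u, R (π x).out u'] := by
    intro u u'
    change B (π x).out (R (π x).out ∘ ![u, u']) = _
    congr 1
    ext i; fin_cases i <;> rfl
  refine Eq.trans (h2 (D x v) (D x w)) ?_
  exact hbase _ _ _ _ _ ((hR _ _).trans (hDA v).symm) ((hR _ _).trans (hDA w).symm)

omit [IsManifold 𝓘(ℂ, F) ω N] in
theorem pullback_injective {M₁ : Type*} [TopologicalSpace M₁] [ChartedSpace F' M₁] {π : N → M₁}
    (hπ : Function.Surjective π)
    (hsub : ∀ x : N, Function.Surjective (mfderiv 𝓘(ℂ, F) 𝓘(ℂ, F') π x)) :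
    Function.Injective (pullback (E := F) π : TwoForm F' M₁ → TwoForm F N) := by
  intro η θ h
  ext1 q
  obtain ⟨x, rfl⟩ := hπ q
  apply form_ext
  intro u u'
  obtain ⟨v, rfl⟩ := hsub x u
  obtain ⟨v', rfl⟩ := hsub x u'
  have := DFunLike.congr_fun (congrFun h x) ![v, v']
  rwa [pullback_apply, pullback_apply] at this

variable (h : ∀ q : Quotient (MulAction.orbitRel Γ N),
      ∃ e : OpenPartialHomeomorph (Quotient (MulAction.orbitRel Γ N)) F',
        IsQuotientChart F e ∧ q ∈ e.source)

omit [IsManifold 𝓘(ℂ, E) ω M] [TopologicalSpace Γ] in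
/-- In a quotient chart, a form on the orbit space is the pullback by a local lift of its pullback
to the total space. -/
theorem exists_inChart_eventuallyEq (hc : Continuous (Quotient.mk (MulAction.orbitRel Γ N)))
    {j : N → M} (hj : ContMDiff 𝓘(ℂ, F) 𝓘(ℂ, E) ω j) {η : TwoForm E M} :
    letI := quotientChartedSpace F N Γ F' h
    ∀ {η' : TwoForm F' (Quotient (MulAction.orbitRel Γ N))},
    pullback (E := F) (Quotient.mk (MulAction.orbitRel Γ N)) η' = pullback (E := F) j η →
    ∀ e ∈ atlas F' (Quotient (MulAction.orbitRel Γ N)), ∀ y ∈ e.target,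
    ∃ s : F' → M, ContMDiffAt 𝓘(ℂ, F') 𝓘(ℂ, E) ω s y ∧ inChart e η' =ᶠ[𝓝 y] modelPullback s η := by
  let := quotientChartedSpace F N Γ F' h
  intro η' hη e he y hy
  have he : IsQuotientChart F e := he
  have hπ := quotient_contMDiff_mk h hc
  set π : N → Quotient (MulAction.orbitRel Γ N) := Quotient.mk (MulAction.orbitRel Γ N) with hπdef
  obtain ⟨x, hx⟩ := Quotient.exists_rep (e.symm y)
  have hxs : π x ∈ e.source := by rw [hπdef, hx]; exact e.map_target hy
  have hey : e (π x) = y := by rw [hπdef, hx, e.right_inv hy]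
  obtain ⟨σ, hσx, hσ, hσe⟩ := he.exists_lift x hxs
  change ContMDiffAt 𝓘(ℂ, F') 𝓘(ℂ, F) ω σ (e (π x)) at hσ
  change ∀ᶠ y in 𝓝 (e (π x)), π (σ y) = e.symm y at hσe
  rw [hey] at hσ hσe
  refine ⟨fun y => j (σ y), (hj _).comp y hσ, ?_⟩
  have hσ' : ∀ᶠ y in 𝓝 y, ContMDiffAt 𝓘(ℂ, F') 𝓘(ℂ, F) ω σ y :=
    (contMDiffAt_iff_contMDiffAt_nhds (by simp)).1 hσ
  filter_upwards [hσ', hσe.eventually_nhds] with u hu hu'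
  have hud := hu.mdifferentiableAt (by simp : (ω : WithTop ℕ∞) ≠ 0)
  have h1 : e.symm =ᶠ[𝓝 u] fun y => π (σ y) := hu'.mono fun y hy => hy.symm
  have h2 := pullback_congr (E₁ := F') η' h1
  have h3 := pullback_comp_apply (E₁ := F') (f := σ) (g := π) η' hud
    ((hπ _).mdifferentiableAt (by simp))
  have h4 := pullback_comp_apply (E₁ := F') (f := σ) (g := j) η hud
    ((hj _).mdifferentiableAt (by simp))
  rw [hη] at h3
  exact h2.trans (h3.trans h4.symm)

omit [TopologicalSpace Γ] in
theorem isHolomorphic_of_pullback_mk (hc : Continuous (Quotient.mk (MulAction.orbitRel Γ N)))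
    {j : N → M} (hj : ContMDiff 𝓘(ℂ, F) 𝓘(ℂ, E) ω j) {η : TwoForm E M} (hη : IsHolomorphic η) :
    letI := quotientChartedSpace F N Γ F' h
    ∀ {η' : TwoForm F' (Quotient (MulAction.orbitRel Γ N))},
    pullback (E := F) (Quotient.mk (MulAction.orbitRel Γ N)) η' = pullback (E := F) j η →
    IsHolomorphic η' := by
  let := quotientChartedSpace F N Γ F' h
  intro η' hη' e he y hy
  obtain ⟨s, hs, hse⟩ := exists_inChart_eventuallyEq h hc hj hη' e he y hy
  have h1 := (contDiffAt_modelPullback hs hη).congr_of_eventuallyEq hse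
  exact h1.analyticAt

omit [TopologicalSpace Γ] in
theorem isClosedForm_of_pullback_mk (hc : Continuous (Quotient.mk (MulAction.orbitRel Γ N)))
    {j : N → M} (hj : ContMDiff 𝓘(ℂ, F) 𝓘(ℂ, E) ω j) {η : TwoForm E M} (hη : IsHolomorphic η)
    (hcl : IsClosedForm η) :
    letI := quotientChartedSpace F N Γ F' h
    ∀ {η' : TwoForm F' (Quotient (MulAction.orbitRel Γ N))},
    pullback (E := F) (Quotient.mk (MulAction.orbitRel Γ N)) η' = pullback (E := F) j η →
    IsClosedForm η' := by
  let := quotientChartedSpace F N Γ F' h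
  intro η' hη' e he y hy
  obtain ⟨s, hs, hse⟩ := exists_inChart_eventuallyEq h hc hj hη' e he y hy
  rw [hse.extDeriv_eq, extDeriv_modelPullback hs hη hcl]

end Descent

/-! ### The orbits in the zero level set -/

section RestrictScalars

variable {E₁ : Type*} [NormedAddCommGroup E₁] [NormedSpace ℂ E₁]
  {M₁ : Type*} [TopologicalSpace M₁] [ChartedSpace E₁ M₁]
  {E₂ : Type*} [NormedAddCommGroup E₂] [NormedSpace ℂ E₂]
  {M₂ : Type*} [TopologicalSpace M₂] [ChartedSpace E₂ M₂]

theorem hasMFDerivAt_restrictScalars {f : M₁ → M₂} {x : M₁} {D : E₁ →L[ℂ] E₂}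
    (h : HasMFDerivAt 𝓘(ℂ, E₁) 𝓘(ℂ, E₂) f x D) :
    HasMFDerivAt 𝓘(ℝ, E₁) 𝓘(ℝ, E₂) f x (D.restrictScalars ℝ : E₁ →L[ℝ] E₂) := by
  have h2 : HasFDerivWithinAt (writtenInExtChartAt 𝓘(ℂ, E₁) 𝓘(ℂ, E₂) x f) D
    (Set.range 𝓘(ℂ, E₁)) (extChartAt 𝓘(ℂ, E₁) x x) := h.2
  exact ⟨h.1, h2.restrictScalars ℝ⟩

theorem mfderiv_restrictScalars_apply {f : M₁ → M₂} {x : M₁}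
    (h : MDifferentiableAt 𝓘(ℂ, E₁) 𝓘(ℂ, E₂) f x) (v : E₁) :
    (mfderiv 𝓘(ℝ, E₁) 𝓘(ℝ, E₂) f x v : E₂) = mfderiv 𝓘(ℂ, E₁) 𝓘(ℂ, E₂) f x v := by
  rw [(hasMFDerivAt_restrictScalars h.hasMFDerivAt).mfderiv]
  rfl

theorem mdifferentiableAt_restrictScalars {f : M₁ → M₂} {x : M₁}
    (h : MDifferentiableAt 𝓘(ℂ, E₁) 𝓘(ℂ, E₂) f x) :
    MDifferentiableAt 𝓘(ℝ, E₁) 𝓘(ℝ, E₂) f x :=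
  (hasMFDerivAt_restrictScalars h.hasMFDerivAt).mdifferentiableAt

end RestrictScalars

section Orbits

variable {E : Type*} [NormedAddCommGroup E] [NormedSpace ℂ E]
  {M : Type*} [TopologicalSpace M] [ChartedSpace E M]
  {EG : Type*} [NormedAddCommGroup EG] [NormedSpace ℝ EG]
  {G : Type*} [TopologicalSpace G] [ChartedSpace EG G] [Group G]
  {EC : Type*} [NormedAddCommGroup EC] [NormedSpace ℂ EC]
  {GC : Type*} [TopologicalSpace GC] [ChartedSpace EC GC] [Group GC]
  {N : Set M} [MulAction GC N]

theorem contMDiff_orbit_val (hhol : IsHolomorphicActionOn (E := E) EC GC N) (n : N) :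
    ContMDiff 𝓘(ℂ, EC) 𝓘(ℂ, E) ω (fun z : GC => ((z • n : N) : M)) := by
  intro z
  obtain ⟨F, hF, hFe⟩ := hhol z n
  have h1 : ContMDiffAt 𝓘(ℂ, EC) 𝓘(ℂ, E) ω (fun z : GC => F (z, (n : M))) z :=
    ContMDiffAt.comp (g := F) z hF (contMDiffAt_id.prodMk contMDiffAt_const)
  refine h1.congr_of_eventuallyEq ?_
  have ht : Filter.Tendsto (fun z : GC => (z, n)) (𝓝 z) (𝓝 (z, n)) :=
    (Continuous.prodMk_left n).tendsto z
  filter_upwards [ht.eventually hFe] with w hw using hw.symm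

/-- The differential at the identity of the orbit map through a point of `N`. -/
def orbitDeriv (EC : Type*) [NormedAddCommGroup EC] [NormedSpace ℂ EC] (GC : Type*)
    [TopologicalSpace GC] [ChartedSpace EC GC] [Group GC] {N : Set M} [MulAction GC N] (n : N) :
    EC →L[ℂ] E :=
  mfderiv 𝓘(ℂ, EC) 𝓘(ℂ, E) (fun z : GC => ((z • n : N) : M)) 1

/-- Freeness makes the orbit map injective, and the local holomorphic extension of the action near
`(1, n)` supplies the equivariance required by `injective_mfderiv_orbit`. -/
theorem injective_orbitDeriv [IsManifold 𝓘(ℂ, E) ω M] [CompleteSpace EC] [LieGroup 𝓘(ℂ, EC) ω GC]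
    [ContinuousSMul GC N] (hhol : IsHolomorphicActionOn (E := E) EC GC N)
    (hfree : ∀ (z : GC) (n : N), z • n = n → z = 1) (n : N) :
    Function.Injective (orbitDeriv (E := E) EC GC n) := by
  obtain ⟨F, hF, hFe⟩ := hhol 1 n
  refine injective_mfderiv_orbit (contMDiff_orbit_val hhol n 1) ?_ (F := F) ?_ ?_
  · intro z w hzw
    have h1 : z • n = w • n := Subtype.ext hzw
    have h2 : (w⁻¹ * z) • n = n := by rw [mul_smul, h1, inv_smul_smul]
    exact (inv_mul_eq_one.1 (hfree _ _ h2)).symm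
  · simpa using hF
  · have hc : Continuous (fun p : GC × GC => (p.1, p.2 • n)) := by fun_prop
    have ht := hc.tendsto (1, 1)
    simp only [one_smul] at ht
    filter_upwards [ht.eventually hFe] with p hp
    rw [hp, mul_smul]

variable {ι : G →* GC} (hι : IsComplexification (EG := EG) (EC := EC) ι) [MulAction G M]
  (hext : ∀ (g : G) (n : N), ((ι g • n : N) : M) = g • (n : M))
  (hhol : IsHolomorphicActionOn (E := E) EC GC N)
include hι hext hhol

theorem fundamentalField_eq (X : GroupLieAlgebra 𝓘(ℝ, EG) G) (n : N) :
    (fundamentalField X (n : M) : E) = orbitDeriv (E := E) EC GC n (lieMap (EC := EC) ι X : EC) := by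
  have h1 : (fun g : G => g • (n : M)) = fun g => ((ι g • n : N) : M) :=
    funext fun g => (hext g n).symm
  have h2 := (contMDiff_orbit_val hhol n 1).mdifferentiableAt (by simp)
  have h3 := mfderiv_comp_apply_eq (g := fun z : GC => ((z • n : N) : M)) (f := ι) (a := 1) (b := 1)
    (mdifferentiableAt_restrictScalars h2) ((hι.smooth 1).mdifferentiableAt (by simp))
    (map_one ι) X
  rw [← h1] at h3
  exact h3.trans (mfderiv_restrictScalars_apply h2 _)

/-- The differential of the `G_ℂ`-orbit map is complex linear and `Lie G_ℂ = 𝔤 ⊕ i𝔤`, so its range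
is the complex span of the `G`-directions. -/
theorem orbitDirections_eq_range (n : N) :
    orbitDirections (E := E) EG G (n : M) =
      (LinearMap.range (orbitDeriv (E := E) EC GC n : EC →ₗ[ℂ] E) : Submodule ℂ E) := by
  apply le_antisymm
  · refine Submodule.span_le.2 ?_
    rintro _ ⟨X, rfl⟩
    exact ⟨lieMap (EC := EC) ι X, (fundamentalField_eq hι hext hhol X n).symm⟩
  · rintro _ ⟨ζ, rfl⟩
    obtain ⟨⟨X, Y⟩, hXY⟩ := hι.lieAlgebra.2 ζ
    have hmem : ∀ X : GroupLieAlgebra 𝓘(ℝ, EG) G,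
        (fundamentalField X (n : M) : TangentSpace 𝓘(ℂ, E) (n : M)) ∈
          orbitDirections (E := E) EG G (n : M) := fun X => Submodule.subset_span ⟨X, rfl⟩
    have h1 := (orbitDirections (E := E) EG G (n : M)).add_mem (hmem X)
      ((orbitDirections (E := E) EG G (n : M)).smul_mem Complex.I (hmem Y))
    have h2 : orbitDeriv (E := E) EC GC n ζ
        = (fundamentalField X (n : M) : E) + Complex.I • (fundamentalField Y (n : M) : E) := by
      rw [fundamentalField_eq hι hext hhol X n, fundamentalField_eq hι hext hhol Y n, ← hXY]
      let x : EC := lieMap (EC := EC) ι X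
      let y : EC := lieMap (EC := EC) ι Y
      change orbitDeriv (E := E) EC GC n (x + Complex.I • y)
        = orbitDeriv (E := E) EC GC n x + Complex.I • orbitDeriv (E := E) EC GC n y
      rw [map_add, map_smul]
    change orbitDeriv (E := E) EC GC n ζ ∈ _
    rw [h2]
    exact h1

end Orbits

section Dimension

variable {EG : Type*} [NormedAddCommGroup EG] [NormedSpace ℝ EG] [FiniteDimensional ℝ EG]
  {G : Type*} [TopologicalSpace G] [ChartedSpace EG G] [Group G]
  {EC : Type*} [NormedAddCommGroup EC] [NormedSpace ℂ EC] [FiniteDimensional ℂ EC]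
  {GC : Type*} [TopologicalSpace GC] [ChartedSpace EC GC] [Group GC]

-- Count real dimensions in `Lie G_ℂ = 𝔤 ⊕ i𝔤`.
omit [FiniteDimensional ℂ EC] in
theorem IsComplexification.finrank_eq {ι : G →* GC}
    (hι : IsComplexification (EG := EG) (EC := EC) ι) :
    Module.finrank ℂ EC = Module.finrank ℝ EG := by
  let D₀ : EG →L[ℝ] EC := mfderiv 𝓘(ℝ, EG) 𝓘(ℝ, EC) ι 1
  let D : EG →ₗ[ℝ] EC := D₀
  let J : EC →ₗ[ℝ] EC := (Complex.I • LinearMap.id : EC →ₗ[ℂ] EC).restrictScalars ℝ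
  let T : EG × EG →ₗ[ℝ] EC := D.coprod (J ∘ₗ D)
  have hT : Function.Bijective T := hι.lieAlgebra
  have h1 := (LinearEquiv.ofBijective T hT).finrank_eq
  rw [Module.finrank_prod, finrank_real_of_complex] at h1
  omega

end Dimension

/-! ### The zero level set of a moment map -/

section MomentMap

variable {E : Type*} [NormedAddCommGroup E] [NormedSpace ℂ E]
  {M : Type*} [TopologicalSpace M] [ChartedSpace E M]
  {EG : Type*} [NormedAddCommGroup EG] [NormedSpace ℝ EG]
  {G : Type*} [TopologicalSpace G] [ChartedSpace EG G] [Group G] [MulAction G M]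
  {Ω : Submodule ℂ (TwoForm E M)} {μ : M → MomentTarget EG G Ω} (hμ : IsMomentMap Ω μ)
include hμ

/-- Tangent vectors of the zero level set are orthogonal to the orbit directions. -/
theorem mfderiv_mem_perp {E₁ : Type*} [NormedAddCommGroup E₁] [NormedSpace ℂ E₁]
    {A : Type*} [TopologicalSpace A] [ChartedSpace E₁ A] {s : A → M} {a : A} {x : M}
    (hs : MDifferentiableAt 𝓘(ℂ, E₁) 𝓘(ℂ, E) s a) (h0 : ∀ a, s a ∈ zeroLevel μ) (hx : s a = x)
    (v : E₁) :
    (mfderiv 𝓘(ℂ, E₁) 𝓘(ℂ, E) s a v : E) ∈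
      (perp (evalAt Ω x) (orbitDirections (E := E) EG G x) : Submodule ℂ E) := by
  let u₀ : E := mfderiv 𝓘(ℂ, E₁) 𝓘(ℂ, E) s a v
  let u : TangentSpace 𝓘(ℂ, E) x := u₀
  change u ∈ perp (evalAt Ω x) (orbitDirections (E := E) EG G x)
  refine mem_perp.2 ?_
  rintro _ ⟨η, hη, rfl⟩ w hw
  refine Submodule.span_induction (p := fun w _ => η x ![w, u] = 0) ?_ ?_ ?_ ?_ hw
  · rintro _ ⟨X, rfl⟩
    have h1 := mfderiv_comp_apply_eq (g := fun x => μ x X ⟨η, hη⟩) (f := s) (a := a) (b := x)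
      ((hμ.holomorphic X ⟨η, hη⟩ x).mdifferentiableAt (by simp)) hs hx v
    have h2 : (fun a => μ (s a) X ⟨η, hη⟩) = fun _ => (0 : ℂ) := by
      funext a
      rw [show μ (s a) = 0 from h0 a]
      rfl
    rw [h2, mfderiv_const] at h1
    exact ((h1.trans (hμ.differential X ⟨η, hη⟩ x u)).symm)
  · exact form_zero_left _ _
  · intro a b _ _ ha hb
    rw [form_add_left, ha, hb, add_zero]
  · intro c a _ ha
    rw [form_smul_left, ha, mul_zero]

variable [FiniteDimensional ℝ EG]

/-- The zero level set is cut out by `3 dim G` holomorphic functions, whose common differential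
has the orthogonal complement of the orbit directions as kernel. -/
theorem exists_level_function (hΩ : Module.finrank ℂ Ω = 3) :
    ∃ f : M → (Fin (Module.finrank ℝ EG) × Fin 3 → ℂ),
      ContMDiff 𝓘(ℂ, E) 𝓘(ℂ, Fin (Module.finrank ℝ EG) × Fin 3 → ℂ) ω f ∧
      (∀ x, x ∈ zeroLevel μ ↔ f x = 0) ∧
      ∀ (x : M) (v : E),
        (mfderiv 𝓘(ℂ, E) 𝓘(ℂ, Fin (Module.finrank ℝ EG) × Fin 3 → ℂ) f x v :
          Fin (Module.finrank ℝ EG) × Fin 3 → ℂ) = 0 →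
        v ∈ (perp (evalAt Ω x) (orbitDirections (E := E) EG G x) : Submodule ℂ E) := by
  have : Module.Free ℂ Ω := Module.Free.of_divisionRing ℂ Ω
  have : Module.Finite ℂ Ω := Module.finite_of_finrank_pos (by omega)
  let b₀ : Module.Basis (Fin (Module.finrank ℝ EG)) ℝ EG := Module.finBasis ℝ EG
  let b : Module.Basis (Fin (Module.finrank ℝ EG)) ℝ (GroupLieAlgebra 𝓘(ℝ, EG) G) := b₀
  let c : Module.Basis (Fin 3) ℂ Ω := Module.finBasisOfFinrankEq ℂ Ω hΩ
  let f : M → (Fin (Module.finrank ℝ EG) × Fin 3 → ℂ) := fun x p => μ x (b p.1) (c p.2)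
  have hf : ContMDiff 𝓘(ℂ, E) 𝓘(ℂ, Fin (Module.finrank ℝ EG) × Fin 3 → ℂ) ω f :=
    contMDiff_pi_space.2 fun p => hμ.holomorphic (b p.1) (c p.2)
  refine ⟨f, hf, fun x => ⟨fun hx => ?_, fun hx => ?_⟩, fun x v hv => ?_⟩
  · funext p
    change μ x (b p.1) (c p.2) = 0
    rw [show μ x = 0 from hx]
    rfl
  · change μ x = 0
    refine b.ext fun i => c.ext fun k => ?_
    exact congrFun hx (i, k)
  · let u : TangentSpace 𝓘(ℂ, E) x := v
    change u ∈ perp (evalAt Ω x) (orbitDirections (E := E) EG G x)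
    have hcoord : ∀ p : Fin (Module.finrank ℝ EG) × Fin 3,
        (c p.2 : TwoForm E M) x ![fundamentalField (b p.1) x, u] = 0 := by
      intro p
      let pr : (Fin (Module.finrank ℝ EG) × Fin 3 → ℂ) →L[ℂ] ℂ := ContinuousLinearMap.proj p
      have h1 := mfderiv_comp_apply_eq (g := pr) (f := f) (a := x) (b := f x)
        pr.mdifferentiableAt ((hf x).mdifferentiableAt (by simp)) rfl v
      rw [hv, map_zero] at h1
      exact (hμ.differential (b p.1) (c p.2) x u).symm.trans h1
    refine mem_perp.2 ?_
    rintro _ ⟨η, hη, rfl⟩ w hw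
    -- Vanishing on the two bases extends first to all `X`, real linearly, and then to all `η ∈ Ω`,
    -- complex linearly.
    let D : EG →L[ℝ] E := mfderiv 𝓘(ℝ, EG) 𝓘(ℝ, E) (fun g : G => g • x) 1
    let L : (E [⋀^Fin 2]→L[ℂ] ℂ) → EG →ₗ[ℝ] ℂ := fun θ =>
      { toFun := fun X => θ ![D X, v]
        map_add' := fun X Y => by rw [map_add, form_add_left]
        map_smul' := fun r X => by
          rw [map_smul, ← Complex.coe_smul, form_smul_left]
          simp }
    have hL : ∀ k, L ((c k : TwoForm E M) x) = 0 := fun k => b₀.ext fun i => hcoord (i, k)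
    have hη' : ∀ X : GroupLieAlgebra 𝓘(ℝ, EG) G, η x ![fundamentalField X x, u] = 0 := by
      intro X
      let T : Ω →ₗ[ℂ] ℂ :=
        { toFun := fun θ => (θ : TwoForm E M) x ![fundamentalField X x, u]
          map_add' := fun _ _ => rfl
          map_smul' := fun _ _ => rfl }
      have hT : T = 0 := c.ext fun k => DFunLike.congr_fun (hL k) X
      exact DFunLike.congr_fun hT ⟨η, hη⟩
    refine Submodule.span_induction (p := fun w _ => η x ![w, u] = 0) ?_ ?_ ?_ ?_ hw
    · rintro _ ⟨X, rfl⟩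
      exact hη' X
    · exact form_zero_left _ _
    · intro a b _ _ ha hb
      rw [form_add_left, ha, hb, add_zero]
    · intro c a _ ha
      rw [form_smul_left, ha, mul_zero]

end MomentMap

/-! ### The zero level set as a submanifold -/

section ZeroLevel

variable {E : Type*} [NormedAddCommGroup E] [NormedSpace ℂ E] [FiniteDimensional ℂ E]
  {M : Type*} [TopologicalSpace M] [ChartedSpace E M] [IsManifold 𝓘(ℂ, E) ω M]
  {EG : Type*} [NormedAddCommGroup EG] [NormedSpace ℝ EG] [FiniteDimensional ℝ EG]
  {G : Type*} [TopologicalSpace G] [ChartedSpace EG G] [Group G]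
  {EC : Type*} [NormedAddCommGroup EC] [NormedSpace ℂ EC] [FiniteDimensional ℂ EC]
  {GC : Type*} [TopologicalSpace GC] [ChartedSpace EC GC] [Group GC] [LieGroup 𝓘(ℂ, EC) ω GC]
  {ι : G →* GC} (hι : IsComplexification (EG := EG) (EC := EC) ι)
  {Ω : Submodule ℂ (TwoForm E M)} (hΩ : IsTrisymplecticStructure Ω) [MulAction G M]
  {μ : M → MomentTarget EG G Ω} (hμ : IsMomentMap Ω μ)
  (hnd : ∀ x : M, IsNondegenerateSubspace (evalAt Ω x) (orbitDirections EG G x))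
  [MulAction GC (zeroLevel μ)] [ContinuousSMul GC (zeroLevel μ)]
  (hext : ∀ (g : G) (n : zeroLevel μ), ((ι g • n : zeroLevel μ) : M) = g • (n : M))
  (hhol : IsHolomorphicActionOn (E := E) EC GC (zeroLevel μ))
  (hfree : ∀ (z : GC) (n : zeroLevel μ), z • n = n → z = 1)

section
include hι hext hhol hμ

-- Orbit directions are velocities of `G_ℂ`-orbits, which stay in the zero level set; by
-- `mfderiv_mem_perp` they are orthogonal to the orbit directions.
omit [FiniteDimensional ℂ E] [IsManifold 𝓘(ℂ, E) ω M] [FiniteDimensional ℝ EG]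
  [FiniteDimensional ℂ EC] [LieGroup 𝓘(ℂ, EC) ω GC] [ContinuousSMul GC (zeroLevel μ)] in
theorem orbitDirections_isotropic (n : zeroLevel μ) :
    ∀ η ∈ evalAt Ω (n : M), ∀ w ∈ orbitDirections (E := E) EG G (n : M),
      ∀ w' ∈ orbitDirections (E := E) EG G (n : M), η ![w, w'] = 0 := by
  intro η hη w hw w' hw'
  have h1 : (w' : E) ∈ LinearMap.range (orbitDeriv (E := E) EC GC n : EC →ₗ[ℂ] E) := by
    rw [← orbitDirections_eq_range hι hext hhol n]
    exact hw'
  obtain ⟨ζ, hζ⟩ := h1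
  have h2 := mfderiv_mem_perp hμ (s := fun z : GC => ((z • n : zeroLevel μ) : M)) (a := 1)
    (x := (n : M)) ((contMDiff_orbit_val hhol n 1).mdifferentiableAt (by simp))
    (fun z => (z • n).2) (by simp) ζ
  have h3 : orbitDeriv (E := E) EC GC n ζ = w' := hζ
  have h4 : w' ∈ perp (evalAt Ω (n : M)) (orbitDirections (E := E) EG G (n : M)) := by
    rw [← h3]; exact h2
  exact mem_perp.1 h4 η hη w hw

end

include hι hext hhol hfree

omit [FiniteDimensional ℂ E] in
theorem finrank_orbitDirections (n : zeroLevel μ) :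
    Module.finrank ℂ (orbitDirections (E := E) EG G (n : M)) = Module.finrank ℝ EG := by
  have : CompleteSpace EC := FiniteDimensional.complete ℂ EC
  have h1 : Module.finrank ℂ (orbitDirections (E := E) EG G (n : M)) =
      Module.finrank ℂ (LinearMap.range (orbitDeriv (E := E) EC GC n : EC →ₗ[ℂ] E)) := by
    rw [← orbitDirections_eq_range hι hext hhol n]
    rfl
  rw [h1, LinearMap.finrank_range_of_inj (injective_orbitDeriv hhol hfree n)]
  exact hι.finrank_eq

include hΩ hμ hnd

theorem finrank_perp_orbitDirections (n : zeroLevel μ) :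
    Module.finrank ℂ (perp (evalAt Ω (n : M)) (orbitDirections (E := E) EG G (n : M)))
      + 3 * Module.finrank ℝ EG = Module.finrank ℂ E := by
  have : FiniteDimensional ℂ (TangentSpace 𝓘(ℂ, E) (n : M)) := inferInstanceAs
    (FiniteDimensional ℂ E)
  have h1 := finrank_perp (hΩ.trisymplectic_at (n : M)) (hnd n)
    (orbitDirections_isotropic hι hμ hext hhol n)
  rwa [finrank_orbitDirections hι hext hhol hfree n] at h1

/-- The kernel of the differential of the level function lies in a space of codimension `3 dim G`,
and its target has dimension `3 dim G`. So the differential is onto. -/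
theorem exists_sliceChart_zeroLevel {F : Type*} [NormedAddCommGroup F] [NormedSpace ℂ F]
    [FiniteDimensional ℂ F]
    (hF : Module.finrank ℂ F + 3 * Module.finrank ℝ EG = Module.finrank ℂ E) (n : zeroLevel μ) :
    ∃ e : OpenPartialHomeomorph (zeroLevel μ) F, IsSliceChart E e ∧ n ∈ e.source := by
  obtain ⟨f, hf, hf0, hfk⟩ := exists_level_function hμ hΩ.finrank_eq
  have hP : Module.finrank ℂ (Fin (Module.finrank ℝ EG) × Fin 3 → ℂ)
      = 3 * Module.finrank ℝ EG := by
    simp [mul_comm]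
  refine exists_sliceChart_levelSet hf hf0 n ?_ (by omega)
  let D₀ : E →L[ℂ] (Fin (Module.finrank ℝ EG) × Fin 3 → ℂ) :=
    mfderiv 𝓘(ℂ, E) 𝓘(ℂ, Fin (Module.finrank ℝ EG) × Fin 3 → ℂ) f (n : M)
  let D : E →ₗ[ℂ] (Fin (Module.finrank ℝ EG) × Fin 3 → ℂ) := D₀
  have h1 := LinearMap.finrank_range_add_finrank_ker D
  let K : Submodule ℂ E := perp (evalAt Ω (n : M)) (orbitDirections (E := E) EG G (n : M))
  have h2 : LinearMap.ker D ≤ K := fun v hv => hfk n v hv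
  have h3 := Submodule.finrank_mono h2
  have h4 : Module.finrank ℂ K + 3 * Module.finrank ℝ EG = Module.finrank ℂ E :=
    finrank_perp_orbitDirections hι hΩ hμ hnd hext hhol hfree n
  have h5 := Submodule.finrank_le (LinearMap.range D)
  have h6 : LinearMap.range D = ⊤ := Submodule.eq_top_of_finrank_eq (by omega)
  exact LinearMap.range_eq_top.1 h6

end ZeroLevel

/-! ### Trisymplectic reduction -/

section SliceAction

variable {E : Type*} [NormedAddCommGroup E] [NormedSpace ℂ E]
  {M : Type*} [TopologicalSpace M] [ChartedSpace E M]
  {F : Type*} [NormedAddCommGroup F] [NormedSpace ℂ F]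
  {EC : Type*} [NormedAddCommGroup EC] [NormedSpace ℂ EC]
  {GC : Type*} [TopologicalSpace GC] [ChartedSpace EC GC] [Group GC]
  {N : Set M} [MulAction GC N]

theorem slice_contMDiff_smul [ContinuousSMul GC N]
    (h : ∀ x : N, ∃ e : OpenPartialHomeomorph N F, IsSliceChart E e ∧ x ∈ e.source)
    (hhol : IsHolomorphicActionOn (E := E) EC GC N) :
    letI := sliceChartedSpace E F N h
    ContMDiff (𝓘(ℂ, EC).prod 𝓘(ℂ, F)) 𝓘(ℂ, F) ω (fun p : GC × N => p.1 • p.2) := by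
  let := sliceChartedSpace E F N h
  rintro ⟨z, n⟩
  refine slice_contMDiffAt_of_val h continuous_smul.continuousAt ?_
  obtain ⟨Φ, hΦ, hΦe⟩ := hhol z n
  have h1 : ContMDiffAt (𝓘(ℂ, EC).prod 𝓘(ℂ, F)) (𝓘(ℂ, EC).prod 𝓘(ℂ, E)) ω
      (fun p : GC × N => (p.1, (p.2 : M))) (z, n) :=
    contMDiffAt_fst.prodMk (((slice_contMDiff_val h) n).comp (z, n) contMDiffAt_snd)
  have h2 := ContMDiffAt.comp (g := Φ) (z, n) hΦ h1
  exact h2.congr_of_eventuallyEq (hΦe.mono fun p hp => hp.symm)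

/-- The orbit maps in `N` and in `M` have the same differential. -/
theorem mfderiv_val_orbit [ChartedSpace F N]
    (hval : ContMDiff 𝓘(ℂ, F) 𝓘(ℂ, E) ω (Subtype.val : N → M))
    (hact : ContMDiff (𝓘(ℂ, EC).prod 𝓘(ℂ, F)) 𝓘(ℂ, F) ω (fun p : GC × N => p.1 • p.2))
    (n : N) (ξ : EC) :
    (mfderiv 𝓘(ℂ, F) 𝓘(ℂ, E) (Subtype.val : N → M) n
      (mfderiv 𝓘(ℂ, EC) 𝓘(ℂ, F) (fun z : GC => z • n) 1 ξ : F) : E)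
      = orbitDeriv (E := E) EC GC n ξ :=
  (mfderiv_comp_apply_eq (g := (Subtype.val : N → M)) (f := fun z : GC => z • n) (a := 1) (b := n)
    ((hval n).mdifferentiableAt (by simp))
    ((contMDiff_orbit hact n 1).mdifferentiableAt (by simp)) (one_smul GC n) ξ).symm

/-- The projection is constant on orbits, so orbit directions lie in the kernel; the dimensions
agree. -/
theorem ker_mfderiv_mk {F' : Type*} [NormedAddCommGroup F'] [NormedSpace ℂ F']
    [FiniteDimensional ℂ F] [FiniteDimensional ℂ EC] [ChartedSpace F N]
    [ChartedSpace F' (Quotient (MulAction.orbitRel GC N))]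
    (hact : ContMDiff (𝓘(ℂ, EC).prod 𝓘(ℂ, F)) 𝓘(ℂ, F) ω (fun p : GC × N => p.1 • p.2))
    (hπ : ContMDiff 𝓘(ℂ, F) 𝓘(ℂ, F') ω (Quotient.mk (MulAction.orbitRel GC N)))
    (n : N) (hsub : Function.Surjective
      (mfderiv 𝓘(ℂ, F) 𝓘(ℂ, F') (Quotient.mk (MulAction.orbitRel GC N)) n))
    (hinj : Function.Injective (mfderiv 𝓘(ℂ, EC) 𝓘(ℂ, F) (fun z : GC => z • n) 1))
    (hdim : Module.finrank ℂ EC + Module.finrank ℂ F' = Module.finrank ℂ F) (v : F) :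
    (mfderiv 𝓘(ℂ, F) 𝓘(ℂ, F') (Quotient.mk (MulAction.orbitRel GC N)) n v : F') = 0 ↔
      ∃ ξ : EC, (mfderiv 𝓘(ℂ, EC) 𝓘(ℂ, F) (fun z : GC => z • n) 1 ξ : F) = v := by
  let O₀ : EC →L[ℂ] F := mfderiv 𝓘(ℂ, EC) 𝓘(ℂ, F) (fun z : GC => z • n) 1
  let O : EC →ₗ[ℂ] F := O₀
  let D₀ : F →L[ℂ] F' := mfderiv 𝓘(ℂ, F) 𝓘(ℂ, F') (Quotient.mk (MulAction.orbitRel GC N)) n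
  let D : F →ₗ[ℂ] F' := D₀
  have h1 : LinearMap.range O ≤ LinearMap.ker D := by
    rintro _ ⟨ξ, rfl⟩
    have h2 := mfderiv_comp_apply_eq (g := Quotient.mk (MulAction.orbitRel GC N))
      (f := fun z : GC => z • n) (a := 1) (b := n) ((hπ n).mdifferentiableAt (by simp))
      ((contMDiff_orbit hact n 1).mdifferentiableAt (by simp)) (one_smul GC n) ξ
    have h3 : (fun z : GC => Quotient.mk (MulAction.orbitRel GC N) (z • n)) =
        fun _ => Quotient.mk (MulAction.orbitRel GC N) n := funext fun z => Quotient.sound ⟨z, rfl⟩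
    rw [h3, mfderiv_const] at h2
    exact h2.symm
  have h2 := LinearMap.finrank_range_add_finrank_ker D
  have hD : LinearMap.range D = ⊤ := LinearMap.range_eq_top.2 hsub
  rw [hD, finrank_top] at h2
  have h3 : Module.finrank ℂ (LinearMap.range O) = Module.finrank ℂ EC :=
    LinearMap.finrank_range_of_inj hinj
  have h4 : LinearMap.range O = LinearMap.ker D :=
    Submodule.eq_of_le_of_finrank_eq h1 (by omega)
  constructor
  · intro hv
    have h5 : v ∈ LinearMap.ker D := hv
    rw [← h4] at h5
    exact h5
  · rintro ⟨ξ, rfl⟩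
    exact h1 ⟨ξ, rfl⟩

end SliceAction

/-! ### Restricted forms and tangent spaces on the zero level set -/

section Reduction

variable {E : Type*} [NormedAddCommGroup E] [NormedSpace ℂ E] [FiniteDimensional ℂ E]
  {M : Type*} [TopologicalSpace M] [ChartedSpace E M] [IsManifold 𝓘(ℂ, E) ω M]
  {EG : Type*} [NormedAddCommGroup EG] [NormedSpace ℝ EG] [FiniteDimensional ℝ EG]
  {G : Type*} [TopologicalSpace G] [ChartedSpace EG G] [Group G]
  {EC : Type*} [NormedAddCommGroup EC] [NormedSpace ℂ EC] [FiniteDimensional ℂ EC]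
  {GC : Type*} [TopologicalSpace GC] [ChartedSpace EC GC] [Group GC] [LieGroup 𝓘(ℂ, EC) ω GC]
  {ι : G →* GC} (hι : IsComplexification (EG := EG) (EC := EC) ι)
  {Ω : Submodule ℂ (TwoForm E M)} (hΩ : IsTrisymplecticStructure Ω) [MulAction G M]
  (hG : IsTrisymplecticAction EG G Ω)
  {μ : M → MomentTarget EG G Ω} (hμ : IsMomentMap Ω μ)
  (hnd : ∀ x : M, IsNondegenerateSubspace (evalAt Ω x) (orbitDirections EG G x))
  [MulAction GC (zeroLevel μ)] [ContinuousSMul GC (zeroLevel μ)]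
  (hext : ∀ (g : G) (n : zeroLevel μ), ((ι g • n : zeroLevel μ) : M) = g • (n : M))
  (hhol : IsHolomorphicActionOn (E := E) EC GC (zeroLevel μ))
  (hfree : ∀ (z : GC) (n : zeroLevel μ), z • n = n → z = 1)
  {F : Type*} [NormedAddCommGroup F] [NormedSpace ℂ F] [FiniteDimensional ℂ F]
  [ChartedSpace F (zeroLevel μ)]
  (hval : ContMDiff 𝓘(ℂ, F) 𝓘(ℂ, E) ω (Subtype.val : zeroLevel μ → M))
  (himm : ∀ x : zeroLevel μ,
    Function.Injective (mfderiv 𝓘(ℂ, F) 𝓘(ℂ, E) (Subtype.val : zeroLevel μ → M) x))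
  (hact : ContMDiff (𝓘(ℂ, EC).prod 𝓘(ℂ, F)) 𝓘(ℂ, F) ω (fun p : GC × zeroLevel μ => p.1 • p.2))

include hι hμ hext hhol hval hact in
omit [FiniteDimensional ℂ E] [IsManifold 𝓘(ℂ, E) ω M] [FiniteDimensional ℝ EG]
  [FiniteDimensional ℂ EC] [LieGroup 𝓘(ℂ, EC) ω GC] [ContinuousSMul GC (zeroLevel μ)]
  [FiniteDimensional ℂ F] in
theorem pullback_val_horizontal {η : TwoForm E M} (hη : η ∈ Ω) (n : zeroLevel μ) (ξ : EC) (v : F) :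
    (pullback (E := F) (Subtype.val : zeroLevel μ → M) η n : F [⋀^Fin 2]→L[ℂ] ℂ)
      ![(mfderiv 𝓘(ℂ, EC) 𝓘(ℂ, F) (fun z : GC => z • n) 1 ξ : F), v] = 0 := by
  let u : TangentSpace 𝓘(ℂ, E) (n : M) :=
    mfderiv 𝓘(ℂ, F) 𝓘(ℂ, E) (Subtype.val : zeroLevel μ → M) n v
  have h1 : u ∈ perp (evalAt Ω (n : M)) (orbitDirections (E := E) EG G (n : M)) :=
    mfderiv_mem_perp hμ (s := (Subtype.val : zeroLevel μ → M)) (a := n) (x := n)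
      ((hval n).mdifferentiableAt (by simp)) (fun n => n.2) rfl v
  have h2 : (orbitDeriv (E := E) EC GC n ξ : E) ∈ orbitDirections (E := E) EG G (n : M) := by
    rw [orbitDirections_eq_range hι hext hhol n]
    exact ⟨ξ, rfl⟩
  have h3 := mem_perp.1 h1 (η n) ⟨η, hη, rfl⟩ _ h2
  refine (pullback_apply (E₁ := F) (Subtype.val : zeroLevel μ → M) η n _ v).trans ?_
  refine Eq.trans ?_ h3
  exact twoForm_congr η rfl (mfderiv_val_orbit hval hact n ξ) rfl

-- By the polar decomposition `z = ι(k) γ(1)` with `γ` a one-parameter subgroup. The factor from `G`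
-- preserves the forms by hypothesis, and `γ(1)` does because it is joined to `1` by a path.
include hι hΩ hG hμ hext hhol hval hact in
omit [FiniteDimensional ℂ E] [FiniteDimensional ℝ EG]
  [FiniteDimensional ℂ EC] [ContinuousSMul GC (zeroLevel μ)]
  [FiniteDimensional ℂ F] in
theorem pullback_smul_pullback_val [IsManifold 𝓘(ℂ, F) ω (zeroLevel μ)] {η : TwoForm E M}
    (hη : η ∈ Ω) (z : GC) :
    pullback (E := F) (fun x : zeroLevel μ => z • x)
      (pullback (E := F) (Subtype.val : zeroLevel μ → M) η)
      = pullback (E := F) (Subtype.val : zeroLevel μ → M) η := by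
  obtain ⟨⟨k, X⟩, ⟨γ, hγ, hz⟩, -⟩ := hι.polar z
  dsimp only at hz
  set β := pullback (E := F) (Subtype.val : zeroLevel μ → M) η with hβ
  have hsm := fun z : GC => contMDiff_smul_left hact z
  have hk : pullback (E := F) (fun x : zeroLevel μ => ι k • x) β = β := by
    ext1 x
    have h1 := pullback_comp_apply (E₁ := F) (f := fun x : zeroLevel μ => ι k • x)
      (g := (Subtype.val : zeroLevel μ → M)) (x := x) η ((hsm _ x).mdifferentiableAt (by simp))
      ((hval _).mdifferentiableAt (by simp))
    have h2 := pullback_comp_apply (E₁ := F) (f := (Subtype.val : zeroLevel μ → M))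
      (g := fun y : M => k • y) (x := x) η ((hval _).mdifferentiableAt (by simp))
      ((hG.holomorphic k _).mdifferentiableAt (by simp))
    have h3 : (fun x : zeroLevel μ => ((ι k • x : zeroLevel μ) : M)) =
        fun x : zeroLevel μ => k • (x : M) :=
      funext fun x => hext k x
    rw [hG.preserves k η hη, ← h3] at h2
    exact h1.symm.trans h2
  have hγ0 : γ 0 = 1 := by
    have := hγ.map_add 0 0
    rw [add_zero] at this
    exact left_eq_mul.1 this
  have hone : pullback (E := F) (fun x : zeroLevel μ => (1 : GC) • x) β = β := by
    ext1 x
    apply form_ext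
    intro v w
    have h1 : (fun x : zeroLevel μ => (1 : GC) • x) = id := funext fun x => one_smul _ x
    rw [h1]
    refine (pullback_apply _ _ _ _ _).trans ?_
    rw [mfderiv_id]
    rfl
  have hpath : pullback (E := F) (fun x : zeroLevel μ => γ 1 • x) β = β := by
    have h1 := pullback_smul_eq_of_path hact hval (hΩ.holomorphic η hη) (hΩ.closed η hη)
      (fun n ξ v => pullback_val_horizontal hι hμ hext hhol hval hact hη n ξ v)
      hγ.smooth.continuous 1 0
    rw [hγ0] at h1
    exact h1.trans hone
  ext1 x
  have h1 := pullback_comp_apply (E₁ := F) (f := fun x : zeroLevel μ => γ 1 • x)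
    (g := fun x : zeroLevel μ => ι k • x) (x := x) β ((hsm _ x).mdifferentiableAt (by simp))
    ((hsm _ _).mdifferentiableAt (by simp))
  have h2 : (fun x : zeroLevel μ => ι k • γ 1 • x) = fun x => z • x :=
    funext fun x => by rw [hz, mul_smul]
  rw [hk, hpath, h2] at h1
  exact h1

-- The tangent space of `N` lies in the orthogonal of the orbit directions, and both have
-- codimension `3 dim G`.
include hι hΩ hμ hnd hext hhol hfree hval himm in
omit [FiniteDimensional ℂ F] in
theorem range_mfderiv_val
    (hF : Module.finrank ℂ F + 3 * Module.finrank ℝ EG = Module.finrank ℂ E) (n : zeroLevel μ)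
    (v : E) : v ∈ (perp (evalAt Ω (n : M)) (orbitDirections (E := E) EG G (n : M)) : Submodule ℂ E)
      ↔ ∃ u : F, (mfderiv 𝓘(ℂ, F) 𝓘(ℂ, E) (Subtype.val : zeroLevel μ → M) n u : E) = v := by
  let D₀ : F →L[ℂ] E := mfderiv 𝓘(ℂ, F) 𝓘(ℂ, E) (Subtype.val : zeroLevel μ → M) n
  let D : F →ₗ[ℂ] E := D₀
  let K : Submodule ℂ E := perp (evalAt Ω (n : M)) (orbitDirections (E := E) EG G (n : M))
  have h1 : LinearMap.range D ≤ K := by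
    rintro _ ⟨u, rfl⟩
    exact mfderiv_mem_perp hμ (s := (Subtype.val : zeroLevel μ → M)) (a := n) (x := n)
      ((hval n).mdifferentiableAt (by simp)) (fun n => n.2) rfl u
  have h2 : Module.finrank ℂ (LinearMap.range D) = Module.finrank ℂ F :=
    LinearMap.finrank_range_of_inj (himm n)
  have h3 : Module.finrank ℂ K + 3 * Module.finrank ℝ EG = Module.finrank ℂ E :=
    finrank_perp_orbitDirections hι hΩ hμ hnd hext hhol hfree n
  have h4 : LinearMap.range D = K := Submodule.eq_of_le_of_finrank_eq h1 (by omega)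
  change v ∈ K ↔ _
  rw [← h4]
  rfl

end Reduction

/-! ### The reduced trisymplectic structure -/

section Reduction

variable {E : Type*} [NormedAddCommGroup E] [NormedSpace ℂ E] [FiniteDimensional ℂ E]
  {M : Type*} [TopologicalSpace M] [ChartedSpace E M] [IsManifold 𝓘(ℂ, E) ω M]
  {EG : Type*} [NormedAddCommGroup EG] [NormedSpace ℝ EG] [FiniteDimensional ℝ EG]
  {G : Type*} [TopologicalSpace G] [ChartedSpace EG G] [Group G]
  {EC : Type*} [NormedAddCommGroup EC] [NormedSpace ℂ EC] [FiniteDimensional ℂ EC]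
  {GC : Type*} [TopologicalSpace GC] [ChartedSpace EC GC] [Group GC] [LieGroup 𝓘(ℂ, EC) ω GC]
  {ι : G →* GC} (hι : IsComplexification (EG := EG) (EC := EC) ι)
  {Ω : Submodule ℂ (TwoForm E M)} (hΩ : IsTrisymplecticStructure Ω) [MulAction G M]
  (hG : IsTrisymplecticAction EG G Ω)
  {μ : M → MomentTarget EG G Ω} (hμ : IsMomentMap Ω μ)
  (hnd : ∀ x : M, IsNondegenerateSubspace (evalAt Ω x) (orbitDirections EG G x))
  [MulAction GC (zeroLevel μ)]
  (hext : ∀ (g : G) (n : zeroLevel μ), ((ι g • n : zeroLevel μ) : M) = g • (n : M))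
  (hhol : IsHolomorphicActionOn (E := E) EC GC (zeroLevel μ))
  (hfree : ∀ (z : GC) (n : zeroLevel μ), z • n = n → z = 1)
  {F : Type*} [NormedAddCommGroup F] [NormedSpace ℂ F] [FiniteDimensional ℂ F]
  {F' : Type*} [NormedAddCommGroup F'] [NormedSpace ℂ F'] [FiniteDimensional ℂ F']
  (hF : Module.finrank ℂ F + 3 * Module.finrank ℝ EG = Module.finrank ℂ E)
  (hF' : Module.finrank ℂ F' + 4 * Module.finrank ℝ EG = Module.finrank ℂ E)
  (hne : (zeroLevel μ).Nonempty)
  (hdim : 4 * Module.finrank ℝ EG < Module.finrank ℂ E)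

include hι hΩ hG hμ hnd hext hhol hfree hF hF' hne hdim

/-- The forms on the quotient whose pullbacks are restrictions of forms in `Ω` are the unique
trisymplectic structure compatible with `Ω`. -/
theorem existsUnique_reducedForms [ContinuousSMul GC (zeroLevel μ)] [ChartedSpace F (zeroLevel μ)]
    [IsManifold 𝓘(ℂ, F) ω (zeroLevel μ)]
    (hval : ContMDiff 𝓘(ℂ, F) 𝓘(ℂ, E) ω (Subtype.val : zeroLevel μ → M))
    (himm : ∀ x : zeroLevel μ,
      Function.Injective (mfderiv 𝓘(ℂ, F) 𝓘(ℂ, E) (Subtype.val : zeroLevel μ → M) x))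
    (hact : ContMDiff (𝓘(ℂ, EC).prod 𝓘(ℂ, F)) 𝓘(ℂ, F) ω
      (fun p : GC × zeroLevel μ => p.1 • p.2))
    (hinj : ∀ x : zeroLevel μ,
      Function.Injective (mfderiv 𝓘(ℂ, EC) 𝓘(ℂ, F) (fun z : GC => z • x) 1))
    [ChartedSpace F' (Quotient (MulAction.orbitRel GC (zeroLevel μ)))]
    (hπ : ContMDiff 𝓘(ℂ, F) 𝓘(ℂ, F') ω (Quotient.mk (MulAction.orbitRel GC (zeroLevel μ))))
    (hsub : ∀ x : zeroLevel μ, Function.Surjective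
      (mfderiv 𝓘(ℂ, F) 𝓘(ℂ, F') (Quotient.mk (MulAction.orbitRel GC (zeroLevel μ))) x))
    (hforms : ∀ η ∈ Ω, ∀ η' : TwoForm F' (Quotient (MulAction.orbitRel GC (zeroLevel μ))),
      pullback (E := F) (Quotient.mk (MulAction.orbitRel GC (zeroLevel μ))) η'
        = pullback (E := F) (Subtype.val : zeroLevel μ → M) η →
      IsHolomorphic η' ∧ IsClosedForm η') :
    ∃! Ω' : Submodule ℂ (TwoForm F' (Quotient (MulAction.orbitRel GC (zeroLevel μ)))),
      IsTrisymplecticStructure Ω' ∧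
      Ω'.map (pullback (E := F) (Quotient.mk (MulAction.orbitRel GC (zeroLevel μ))))
        = Ω.map (pullback (E := F) (Subtype.val : zeroLevel μ → M)) := by
  set π := Quotient.mk (MulAction.orbitRel GC (zeroLevel μ)) with hπdef
  have hπs : Function.Surjective π := Quotient.exists_rep
  set P : TwoForm F' (Quotient (MulAction.orbitRel GC (zeroLevel μ))) →ₗ[ℂ]
    TwoForm F (zeroLevel μ) := pullback (E := F) π with hP
  set J : TwoForm E M →ₗ[ℂ] TwoForm F (zeroLevel μ) :=
    pullback (E := F) (Subtype.val : zeroLevel μ → M) with hJ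
  have hPinj : Function.Injective P := pullback_injective hπs hsub
  have hEC := hι.finrank_eq
  have hker : ∀ (n : zeroLevel μ) (v : F), (mfderiv 𝓘(ℂ, F) 𝓘(ℂ, F') π n v : F') = 0 ↔
      ∃ ξ : EC, (mfderiv 𝓘(ℂ, EC) 𝓘(ℂ, F) (fun z : GC => z • n) 1 ξ : F) = v := fun n v =>
    ker_mfderiv_mk hact hπ n (hsub n) (hinj n) (by omega) v
  have hdesc : ∀ η ∈ Ω, ∃ η', P η' = J η := fun η hη =>
    exists_pullback_mk_eq hact hπ hsub (fun n v => (hker n v).1)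
      (fun n ξ v => pullback_val_horizontal hι hμ hext hhol hval hact hη n ξ v)
      (fun z => pullback_smul_pullback_val hι hΩ hG hμ hext hhol hval hact hη z)
  -- All forms on the quotient whose pullback is a restriction of a form in `Ω`. Descent shows that
  -- every such restriction is attained.
  let Ω' := (Ω.map J).comap P
  have hmem : ∀ η' ∈ Ω', ∃ η ∈ Ω, P η' = J η := by
    rintro η' ⟨η, hη, h⟩
    exact ⟨η, hη, h.symm⟩
  have hmem' : ∀ η ∈ Ω, ∃ η' ∈ Ω', P η' = J η := by
    intro η hη
    obtain ⟨η', h⟩ := hdesc η hη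
    exact ⟨η', ⟨η, hη, h.symm⟩, h⟩
  have hmap : Ω'.map P = Ω.map J := by
    apply le_antisymm (Submodule.map_comap_le P _)
    rintro _ ⟨η, hη, rfl⟩
    obtain ⟨η', h1, h2⟩ := hmem' η hη
    exact ⟨η', h1, h2⟩
  have happ : ∀ (η : TwoForm E M) (η' : TwoForm F' (Quotient (MulAction.orbitRel GC (zeroLevel μ)))),
      P η' = J η → ∀ (n : zeroLevel μ) (u v : TangentSpace 𝓘(ℂ, F) n),
      η' (π n) ![mfderiv 𝓘(ℂ, F) 𝓘(ℂ, F') π n u, mfderiv 𝓘(ℂ, F) 𝓘(ℂ, F') π n v] =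
      η (n : M) ![mfderiv 𝓘(ℂ, F) 𝓘(ℂ, E) (Subtype.val : zeroLevel μ → M) n u,
        mfderiv 𝓘(ℂ, F) 𝓘(ℂ, E) (Subtype.val : zeroLevel μ → M) n v] := by
    intro η η' h n u v
    rw [← pullback_apply, ← pullback_apply]
    exact DFunLike.congr_fun (congrFun h n) ![u, v]
  have htri : ∀ q, IsTrisymplecticSpace (evalAt Ω' q) := by
    intro q
    obtain ⟨n, rfl⟩ := hπs q
    have : FiniteDimensional ℂ (TangentSpace 𝓘(ℂ, E) (n : M)) :=
      inferInstanceAs (FiniteDimensional ℂ E)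
    have : FiniteDimensional ℂ (TangentSpace 𝓘(ℂ, F') (π n)) :=
      inferInstanceAs (FiniteDimensional ℂ F')
    have hW := finrank_orbitDirections hι hext hhol hfree n
    refine isTrisymplecticSpace_reduction (hΩ.trisymplectic_at n) (hnd n)
      (orbitDirections_isotropic hι hμ hext hhol n) (by rw [hW]; exact hdim)
      (f := (mfderiv 𝓘(ℂ, F) 𝓘(ℂ, E) (Subtype.val : zeroLevel μ → M) n).toLinearMap)
      (p := (mfderiv 𝓘(ℂ, F) 𝓘(ℂ, F') π n).toLinearMap) (himm n) ?_ (hsub n) ?_ ?_ ?_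
    · ext v
      exact (range_mfderiv_val hι hΩ hμ hnd hext hhol hfree hval himm hF n v).symm
    · intro t
      refine (hker n t).trans ?_
      rw [orbitDirections_eq_range hι hext hhol n]
      constructor
      · rintro ⟨ξ, rfl⟩
        exact ⟨ξ, (mfderiv_val_orbit hval hact n ξ).symm⟩
      · rintro ⟨ξ, hξ⟩
        exact ⟨ξ, himm n ((mfderiv_val_orbit hval hact n ξ).trans hξ)⟩
    · rintro _ ⟨η, hη, rfl⟩
      obtain ⟨η', h1, h2⟩ := hmem' η hη
      exact ⟨η' (π n), ⟨η', h1, rfl⟩, fun u v => happ η η' h2 n u v⟩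
    · rintro _ ⟨η', hη', rfl⟩
      obtain ⟨η, h1, h2⟩ := hmem η' hη'
      exact ⟨η n, ⟨η, h1, rfl⟩, fun u v => happ η η' h2 n u v⟩
  -- At most 3 because `π^*` is injective with image `Ω|_N`. At least 3 because evaluation at a
  -- point, which exists as `N` is non-empty, already has dimension 3.
  have hrank : Module.finrank ℂ Ω' = 3 := by
    have : Module.Free ℂ Ω := Module.Free.of_divisionRing ℂ Ω
    have : Module.Finite ℂ Ω := Module.finite_of_finrank_pos (by rw [hΩ.finrank_eq]; omega)
    have h1 : Module.finrank ℂ (Ω.map J) ≤ 3 := by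
      rw [← hΩ.finrank_eq]; exact Submodule.finrank_map_le J Ω
    have : Module.Finite ℂ (Ω'.map P) := by rw [hmap]; infer_instance
    let i := Submodule.equivMapOfInjective P hPinj Ω'
    have : Module.Finite ℂ Ω' := Module.Finite.equiv i.symm
    have h2 : Module.finrank ℂ Ω' = Module.finrank ℂ (Ω'.map P) := i.finrank_eq
    rw [hmap] at h2
    obtain ⟨n, hn⟩ := hne
    have h3 := (htri (π ⟨n, hn⟩)).finrank_eq
    have h4 : Module.finrank ℂ (evalAt Ω' (π ⟨n, hn⟩)) ≤ Module.finrank ℂ Ω' :=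
      Submodule.finrank_map_le _ Ω'
    omega
  refine ⟨Ω', ⟨⟨hrank, ?_, ?_, htri⟩, hmap⟩, ?_⟩
  · intro η' hη'
    obtain ⟨η, h1, h2⟩ := hmem η' hη'
    exact (hforms η h1 η' h2).1
  · intro η' hη'
    obtain ⟨η, h1, h2⟩ := hmem η' hη'
    exact (hforms η h1 η' h2).2
  · rintro Ω'' ⟨-, h⟩
    exact Submodule.map_injective_of_injective hPinj (h.trans hmap.symm)

/-- Trisymplectic reduction. -/
theorem exists_reduction [T2Space M] [SecondCountableTopology M] [ProperSMul GC (zeroLevel μ)] :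
    ∃ (_ : ChartedSpace F (zeroLevel μ))
      (_ : ChartedSpace F' (Quotient (MulAction.orbitRel GC (zeroLevel μ)))),
      IsComplexSubmanifold (E := E) F (zeroLevel μ) ∧
      IsComplexQuotient F (zeroLevel μ) GC F' ∧
      ∃! Ω' : Submodule ℂ (TwoForm F' (Quotient (MulAction.orbitRel GC (zeroLevel μ)))),
        IsTrisymplecticStructure Ω' ∧
        Ω'.map (pullback (E := F) (Quotient.mk (MulAction.orbitRel GC (zeroLevel μ))))
          = Ω.map (pullback (E := F) (Subtype.val : zeroLevel μ → M)) := by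
  have : CompleteSpace EC := FiniteDimensional.complete ℂ EC
  have : IsManifold 𝓘(ℂ, EC) ω GC := LieGroup.toContMDiffMul.toIsManifold
  have hs := exists_sliceChart_zeroLevel hι hΩ hμ hnd hext hhol hfree hF
  let cs := sliceChartedSpace E F (zeroLevel μ) hs
  have hmf : IsManifold 𝓘(ℂ, F) ω (zeroLevel μ) := slice_isManifold hs
  have hval : ContMDiff 𝓘(ℂ, F) 𝓘(ℂ, E) ω (Subtype.val : zeroLevel μ → M) :=
    slice_contMDiff_val hs
  have himm : ∀ x : zeroLevel μ,
      Function.Injective (mfderiv 𝓘(ℂ, F) 𝓘(ℂ, E) (Subtype.val : zeroLevel μ → M) x) :=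
    slice_mfderiv_val_injective hs
  have hact : ContMDiff (𝓘(ℂ, EC).prod 𝓘(ℂ, F)) 𝓘(ℂ, F) ω
      (fun p : GC × zeroLevel μ => p.1 • p.2) := slice_contMDiff_smul hs hhol
  have hinj : ∀ x : zeroLevel μ,
      Function.Injective (mfderiv 𝓘(ℂ, EC) 𝓘(ℂ, F) (fun z : GC => z • x) 1) := by
    intro x ξ ζ h
    apply injective_orbitDeriv hhol hfree x
    refine (mfderiv_val_orbit hval hact x ξ).symm.trans (Eq.trans ?_ (mfderiv_val_orbit hval hact x ζ))
    exact congrArg (mfderiv 𝓘(ℂ, F) 𝓘(ℂ, E) (Subtype.val : zeroLevel μ → M) x) h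
  have hEC := hι.finrank_eq
  have hq : ∀ q : Quotient (MulAction.orbitRel GC (zeroLevel μ)),
      ∃ e : OpenPartialHomeomorph (Quotient (MulAction.orbitRel GC (zeroLevel μ))) F',
        IsQuotientChart F e ∧ q ∈ e.source := by
    intro q
    obtain ⟨x, rfl⟩ := Quotient.exists_rep q
    exact exists_quotientChart hact hfree x (hinj x) (by omega)
  have hc : Continuous (Quotient.mk (MulAction.orbitRel GC (zeroLevel μ))) := continuous_quotient_mk'
  let cq := quotientChartedSpace F (zeroLevel μ) GC F' hq
  have hπ : ContMDiff 𝓘(ℂ, F) 𝓘(ℂ, F') ω (Quotient.mk (MulAction.orbitRel GC (zeroLevel μ))) :=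
    quotient_contMDiff_mk hq hc
  have hsub : ∀ x : zeroLevel μ, Function.Surjective
      (mfderiv 𝓘(ℂ, F) 𝓘(ℂ, F') (Quotient.mk (MulAction.orbitRel GC (zeroLevel μ))) x) :=
    quotient_submersion hq hc
  refine ⟨cs, cq, ⟨hmf, hval, himm⟩, ⟨?_, ?_, quotient_isManifold hq, hπ, hsub⟩, ?_⟩
  · infer_instance
  · exact ContinuousConstSMul.secondCountableTopology
  · exact existsUnique_reducedForms hι hΩ hG hμ hnd hext hhol hfree hF hF' hne hdim hval himm hact
      hinj hπ hsub fun η hη η' h =>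
        ⟨isHolomorphic_of_pullback_mk hq hc hval (hΩ.holomorphic η hη) h,
          isClosedForm_of_pullback_mk hq hc hval (hΩ.holomorphic η hη) (hΩ.closed η hη) h⟩

end Reduction

end Trisymplectic

end

open Trisymplectic in
theorem mainTheorem4
    -- the complex manifold `M`
    {E : Type*} [NormedAddCommGroup E] [NormedSpace ℂ E] [FiniteDimensional ℂ E]
    {M : Type*} [TopologicalSpace M] [T2Space M] [SecondCountableTopology M]
    [ChartedSpace E M] [IsManifold 𝓘(ℂ, E) ω M]
    -- the compact Lie group `G` and its complexification `GC`
    {EG : Type*} [NormedAddCommGroup EG] [NormedSpace ℝ EG] [FiniteDimensional ℝ EG]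
    {G : Type*} [TopologicalSpace G] [ChartedSpace EG G] [Group G]
    [LieGroup 𝓘(ℝ, EG) ∞ G] [CompactSpace G]
    {EC : Type*} [NormedAddCommGroup EC] [NormedSpace ℂ EC] [FiniteDimensional ℂ EC]
    {GC : Type*} [TopologicalSpace GC] [ChartedSpace EC GC] [Group GC]
    [LieGroup 𝓘(ℂ, EC) ω GC]
    (ι : G →* GC) (hι : IsComplexification (EG := EG) (EC := EC) ι)
    -- the trisymplectic structure, the action of `G`, the moment map
    (Ω : Submodule ℂ (TwoForm E M)) (hΩ : IsTrisymplecticStructure Ω)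
    [MulAction G M] (hG : IsTrisymplecticAction EG G Ω)
    (μ : M → MomentTarget EG G Ω) (hμ : IsMomentMap Ω μ)
    (hnd : ∀ x : M, IsNondegenerateSubspace (evalAt Ω x) (orbitDirections EG G x))
    -- the action of `GC` on the zero level set: holomorphic, extending that of `G`, proper and free
    [MulAction GC (zeroLevel μ)]
    (hext : ∀ (g : G) (n : zeroLevel μ), ((ι g • n : zeroLevel μ) : M) = g • (n : M))
    (hhol : IsHolomorphicActionOn (E := E) EC GC (zeroLevel μ))
    [ProperSMul GC (zeroLevel μ)]
    (hfree : ∀ (z : GC) (n : zeroLevel μ), z • n = n → z = 1)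
    -- the quotient is non-empty and of positive dimension
    (hne : (zeroLevel μ).Nonempty)
    (hdim : 4 * Module.finrank ℝ EG < Module.finrank ℂ E) :
    ∃ (_ : ChartedSpace
          (EuclideanSpace ℂ (Fin (Module.finrank ℂ E - 3 * Module.finrank ℝ EG))) (zeroLevel μ))
      (_ : ChartedSpace
          (EuclideanSpace ℂ (Fin (Module.finrank ℂ E - 4 * Module.finrank ℝ EG)))
          (Quotient (MulAction.orbitRel GC (zeroLevel μ)))),
      IsComplexSubmanifold (E := E)
        (EuclideanSpace ℂ (Fin (Module.finrank ℂ E - 3 * Module.finrank ℝ EG))) (zeroLevel μ) ∧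
      IsComplexQuotient
        (EuclideanSpace ℂ (Fin (Module.finrank ℂ E - 3 * Module.finrank ℝ EG))) (zeroLevel μ) GC
        (EuclideanSpace ℂ (Fin (Module.finrank ℂ E - 4 * Module.finrank ℝ EG))) ∧
      ∃! Ω' : Submodule ℂ
          (TwoForm (EuclideanSpace ℂ (Fin (Module.finrank ℂ E - 4 * Module.finrank ℝ EG)))
            (Quotient (MulAction.orbitRel GC (zeroLevel μ)))),
        IsTrisymplecticStructure Ω' ∧
        Ω'.map (pullback
            (E := EuclideanSpace ℂ (Fin (Module.finrank ℂ E - 3 * Module.finrank ℝ EG)))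
            (Quotient.mk (MulAction.orbitRel GC (zeroLevel μ))))
          = Ω.map (pullback (Subtype.val : zeroLevel μ → M)) := by
  -- The inequality `4 dim G < dim M` makes the truncated subtractions in the model dimensions
  -- exact.
  exact exists_reduction hι hΩ hG hμ hnd hext hhol hfree
    (by rw [finrank_euclideanSpace_fin]; omega) (by rw [finrank_euclideanSpace_fin]; omega) hne hdim
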